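/- Conventions. A PROP is a strict symmetric monoidal category with objects the natural numbers and $+$ as tensor; a $\dagger$-PROP carries in addition an involutive, identity-on-objects, contravariant strict symmetric monoidal functor $\dagger$. Let $\mathbf P$ be the groupoid of permutations. A PROP is a monad on $\mathbf P$, i.e. a monoid in the monoidal category of $\mathbf P$-$\mathbf P$-bimodules internal to monoids, whose tensor product is the composite $X;Y$ over $\mathbf P$: an element $n\to m$ of $X;Y$ is a class of composable pairs ($X$ first, then $Y$), modulo moving a permutation across the middle. A distributive law $T;S\to S;T$ of PROPs is a distributive law (in the sense of Beck) between these monads. Let $\mathbf M$ be the PROP of commutative monoids (generators $\mu:2\to1$, $\eta:0\to1$; associativity, unit, commutativity), $\mathbf C=\mathbf M^{\mathrm{op}}$ the PROP of cocommutative comonoids (generators $\delta:1\to2$, $\epsilon:1\to0$) and, for an abelian group $G$, $\mathbf PG$ the PROP generated by maps $g:1\to1$ ($g\in G$) subject to the equations of $G$. Write $G^\times(m,m)=\prod_m G$ for the diagonal morphisms $g_1\otimes\cdots\otimes g_m$ of $\mathbf PG$. Consider the equations $$\text{(P1)}\quad \mu\circ(g\otimes h)=gh\circ\mu,\qquad \text{(P2)}\quad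 (g\otimes h)\circ\delta=\delta\circ gh\qquad(g,h\in G),$$ $$\text{(F)}\quad (1\otimes\mu)\circ(\delta\otimes1)=\delta\circ\mu=(\mu\otimes1)\circ(1\otimes\delta),\qquad \mu\circ\delta=1.$$ Theorem. Let $G$ be an abelian group. 1. There is exactly one distributive law $\lambda_F:\mathbf C;\mathbf M\to\mathbf M;\mathbf C$ satisfying (F), exactly one distributive law $\sigma:\mathbf PG;\mathbf M\to\mathbf M;\mathbf PG$ satisfying (P1), and exactly one distributive law $\rho:\mathbf C;\mathbf PG\to\mathbf PG;\mathbf C$ satisfying (P2), each equation being read as prescribing the value of the law on the composable pair in question. 2. The monads $\mathbf M,\mathbf PG,\mathbf C$ with the laws $\lambda_F,\sigma,\rho$ form a distributive series of monads: the two maps $\mathbf C;\mathbf PG;\mathbf M\to\mathbf M;\mathbf PG;\mathbf C$ built from the laws are equal (Yang–Baxter). The unit and the multiplication that the laws define on $\mathbf M;\mathbf PG;\mathbf C$ make it a monad, and the canonical map $(\nabla,g,\Delta)\mapsto\Delta\circ g\circ\nabla$ is an isomorphism of monads from it to the PROP $\mathbf FG$ presented by the generators and equations of $\mathbf M+\mathbf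 PG+\mathbf C$ together with (P1), (P2) and (F). 3. $G\mapsto\mathbf FG$ is a functor from abelian groups to $\dagger$-PROPs ($\mu^\dagger=\delta$, $\eta^\dagger=\epsilon$, $g^\dagger=g^{-1}$; homomorphisms relabel the $g$'s), and the isomorphism in 2 is natural in $G$. 4. Consequently every morphism $f:n\to n'$ of $\mathbf FG$ can be written as $$n\xrightarrow{\ \nabla\ }m\xrightarrow{\ g\ }m\xrightarrow{\ \Delta\ }n'$$ with $\nabla$ in $\mathbf M$, $g\in G^\times(m,m)$ and $\Delta$ in $\mathbf C$, for some $m$. -/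

import Mathlib

open CategoryTheory MonoidalCategory MonObj

universe u

/-! ## Bijections of finite ordinals: the groupoid `P`

The morphisms `n ⟶ m` of `P` are the bijections `Fin n ≃ Fin m`.  They exist only for `n = m`, and the
identification along an equation `h : n = m` is `finCongr h`. -/

/-- The block sum of two bijections. -/
def blockSum {a b c d : ℕ} (σ : Fin a ≃ Fin b) (τ : Fin c ≃ Fin d) : Fin (a + c) ≃ Fin (b + d) :=
  finSumFinEquiv.symm.trans ((σ.sumCongr τ).trans finSumFinEquiv)

section BlockSum

variable {a b c d e f : ℕ}

@[simp] theorem blockSum_castAdd (σ : Fin a ≃ Fin b) (τ : Fin c ≃ Fin d) (i : Fin a) :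
    blockSum σ τ (Fin.castAdd c i) = Fin.castAdd d (σ i) := by simp [blockSum]

@[simp] theorem blockSum_natAdd (σ : Fin a ≃ Fin b) (τ : Fin c ≃ Fin d) (i : Fin c) :
    blockSum σ τ (Fin.natAdd a i) = Fin.natAdd b (τ i) := by simp [blockSum]

@[simp] theorem blockSum_refl : blockSum (Equiv.refl (Fin a)) (Equiv.refl (Fin c)) = Equiv.refl _ := by
  simp [blockSum]

theorem blockSum_trans (σ : Fin a ≃ Fin b) (σ' : Fin b ≃ Fin c) (τ : Fin d ≃ Fin e)
    (τ' : Fin e ≃ Fin f) :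
    blockSum (σ.trans σ') (τ.trans τ') = (blockSum σ τ).trans (blockSum σ' τ') := by
  ext i
  refine Fin.addCases (fun i => ?_) (fun i => ?_) i <;> simp

@[simp] theorem blockSum_symm (σ : Fin a ≃ Fin b) (τ : Fin c ≃ Fin d) :
    (blockSum σ τ).symm = blockSum σ.symm τ.symm := by
  ext i
  simp [blockSum]

theorem blockSum_assoc (σ : Fin a ≃ Fin b) (τ : Fin c ≃ Fin d) (υ : Fin e ≃ Fin f) :
    (blockSum (blockSum σ τ) υ).trans (finCongr (Nat.add_assoc b d f)) =
      (finCongr (Nat.add_assoc a c e)).trans (blockSum σ (blockSum τ υ)) := by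
  ext i
  induction i using Fin.addCases with
  | left i =>
    induction i using Fin.addCases with
    | left i =>
      have h : Fin.cast (Nat.add_assoc a c e) (Fin.castAdd e (Fin.castAdd c i)) =
        Fin.castAdd (c + e) i := by ext; simp
      simp [h]
    | right i =>
      have h : Fin.cast (Nat.add_assoc a c e) (Fin.castAdd e (Fin.natAdd a i)) =
        Fin.natAdd a (Fin.castAdd e i) := by ext; simp
      simp [h]
  | right i =>
    have h : Fin.cast (Nat.add_assoc a c e) (Fin.natAdd (a + c) i) =
      Fin.natAdd a (Fin.natAdd c i) := by ext; simp [Nat.add_assoc]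
    simp [h, Nat.add_assoc]

theorem blockSum_zero_left (τ : Fin c ≃ Fin d) :
    (blockSum (Equiv.refl (Fin 0)) τ).trans (finCongr (Nat.zero_add d)) =
      (finCongr (Nat.zero_add c)).trans τ := by
  ext i
  refine Fin.addCases (fun i => i.elim0) (fun i => ?_) i
  have h : blockSum (Equiv.refl (Fin 0)) τ (Fin.cast (Nat.zero_add c).symm i) =
    Fin.natAdd 0 (τ i) := by
    rw [← blockSum_natAdd (Equiv.refl (Fin 0)) τ i]
    congr 1
    ext
    simp
  simp [h]

theorem blockSum_zero_right (τ : Fin c ≃ Fin d) :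
    blockSum τ (Equiv.refl (Fin 0)) = τ := by
  ext i
  refine Fin.addCases (m := c) (n := 0) (fun i => ?_) (fun i => i.elim0) i
  simp only [blockSum_castAdd]
  rfl

end BlockSum

/-! ## Bimodules over `P`, in monoids

An object of the monoidal category in which PROPs are monads on `P`: a profunctor from `P` to `P`
whose elements can be put side by side, strictly associatively and unitally and compatibly with
the two actions of `P`. -/

/-- A `P`-`P`-bimodule internal to monoids. -/
structure PermBimod where
  Hom : ℕ → ℕ → Type u
  lact {n m k : ℕ} : (Fin n ≃ Fin m) → Hom m k → Hom n k
  ract {n m k : ℕ} : Hom n m → (Fin m ≃ Fin k) → Hom n k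
  unit : Hom 0 0
  tensor {a b c d : ℕ} : Hom a b → Hom c d → Hom (a + c) (b + d)
  lact_refl {n k : ℕ} (x : Hom n k) : lact (Equiv.refl _) x = x
  lact_trans {n m l k : ℕ} (σ : Fin n ≃ Fin m) (τ : Fin m ≃ Fin l) (x : Hom l k) :
    lact (σ.trans τ) x = lact σ (lact τ x)
  ract_refl {n k : ℕ} (x : Hom n k) : ract x (Equiv.refl _) = x
  ract_trans {n m l k : ℕ} (x : Hom n m) (σ : Fin m ≃ Fin l) (τ : Fin l ≃ Fin k) :
    ract x (σ.trans τ) = ract (ract x σ) τ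
  lact_ract {n m l k : ℕ} (σ : Fin n ≃ Fin m) (x : Hom m l) (τ : Fin l ≃ Fin k) :
    lact σ (ract x τ) = ract (lact σ x) τ
  lact_tensor {a a' b c c' d : ℕ} (σ : Fin a ≃ Fin a') (τ : Fin c ≃ Fin c') (x : Hom a' b)
    (y : Hom c' d) : lact (blockSum σ τ) (tensor x y) = tensor (lact σ x) (lact τ y)
  ract_tensor {a b b' c d d' : ℕ} (x : Hom a b) (y : Hom c d) (σ : Fin b ≃ Fin b')
    (τ : Fin d ≃ Fin d') : ract (tensor x y) (blockSum σ τ) = tensor (ract x σ) (ract y τ)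
  tensor_assoc {a b c d e f : ℕ} (x : Hom a b) (y : Hom c d) (z : Hom e f) :
    ract (tensor (tensor x y) z) (finCongr (Nat.add_assoc b d f)) =
      lact (finCongr (Nat.add_assoc a c e)) (tensor x (tensor y z))
  unit_tensor {a b : ℕ} (x : Hom a b) :
    ract (tensor unit x) (finCongr (Nat.zero_add b)) = lact (finCongr (Nat.zero_add a)) x
  tensor_unit {a b : ℕ} (x : Hom a b) : tensor x unit = x

namespace PermBimod

/-- Maps of bimodules: equivariant and compatible with juxtaposition. -/
@[ext] structure BimodHom (X Y : PermBimod.{u}) where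
  app {n m : ℕ} : X.Hom n m → Y.Hom n m
  app_lact {n m k : ℕ} (σ : Fin n ≃ Fin m) (x : X.Hom m k) : app (X.lact σ x) = Y.lact σ (app x)
  app_ract {n m k : ℕ} (x : X.Hom n m) (σ : Fin m ≃ Fin k) : app (X.ract x σ) = Y.ract (app x) σ
  app_unit : app X.unit = Y.unit
  app_tensor {a b c d : ℕ} (x : X.Hom a b) (y : X.Hom c d) :
    app (X.tensor x y) = Y.tensor (app x) (app y)

attribute [simp] BimodHom.app_lact BimodHom.app_ract BimodHom.app_unit BimodHom.app_tensor

instance : Category PermBimod.{u} where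
  Hom := BimodHom
  id X := { app := id, app_lact := fun _ _ => rfl, app_ract := fun _ _ => rfl, app_unit := rfl,
            app_tensor := fun _ _ => rfl }
  comp F G :=
    { app := fun x => G.app (F.app x)
      app_lact := by intros; simp
      app_ract := by intros; simp
      app_unit := by simp
      app_tensor := by intros; simp }

/-- The map of hom-sets underlying a morphism of bimodules. -/
def app {X Y : PermBimod.{u}} (F : X ⟶ Y) {n m : ℕ} (x : X.Hom n m) : Y.Hom n m :=
  BimodHom.app F x

@[ext] theorem hom_ext {X Y : PermBimod.{u}} {F G : X ⟶ Y}
    (h : ∀ (n m : ℕ) (x : X.Hom n m), app F x = app G x) : F = G :=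
  BimodHom.ext (by funext n m x; exact h n m x)

theorem map_lact {X Y : PermBimod.{u}} (F : X ⟶ Y) {n m k : ℕ} (σ : Fin n ≃ Fin m)
    (x : X.Hom m k) : app F (X.lact σ x) = Y.lact σ (app F x) := BimodHom.app_lact F σ x

theorem map_ract {X Y : PermBimod.{u}} (F : X ⟶ Y) {n m k : ℕ} (x : X.Hom n m)
    (σ : Fin m ≃ Fin k) : app F (X.ract x σ) = Y.ract (app F x) σ := BimodHom.app_ract F x σ

theorem map_unit {X Y : PermBimod.{u}} (F : X ⟶ Y) : app F X.unit = Y.unit :=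
  BimodHom.app_unit F

theorem map_tensor {X Y : PermBimod.{u}} (F : X ⟶ Y) {a b c d : ℕ} (x : X.Hom a b)
    (y : X.Hom c d) : app F (X.tensor x y) = Y.tensor (app F x) (app F y) :=
  BimodHom.app_tensor F x y

@[simp] theorem app_id (X : PermBimod.{u}) {n m : ℕ} (x : X.Hom n m) : app (𝟙 X) x = x := rfl

@[simp] theorem app_comp {X Y Z : PermBimod.{u}} (F : X ⟶ Y) (G : Y ⟶ Z) {n m : ℕ}
    (x : X.Hom n m) : app (F ≫ G) x = app G (app F x) := rfl

/-- The groupoid `P` as a bimodule over itself. -/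
def permBimod : PermBimod.{u} where
  Hom n m := ULift.{u} (Fin n ≃ Fin m)
  lact σ x := ⟨σ.trans x.down⟩
  ract x σ := ⟨x.down.trans σ⟩
  unit := ⟨Equiv.refl _⟩
  tensor x y := ⟨blockSum x.down y.down⟩
  lact_refl _ := rfl
  lact_trans _ _ _ := rfl
  ract_refl _ := rfl
  ract_trans _ _ _ := rfl
  lact_ract _ _ _ := rfl
  lact_tensor _ _ _ _ := congrArg ULift.up (blockSum_trans ..).symm
  ract_tensor _ _ _ _ := congrArg ULift.up (blockSum_trans ..).symm
  tensor_assoc _ _ _ := congrArg ULift.up (blockSum_assoc ..)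
  unit_tensor _ := congrArg ULift.up (blockSum_zero_left ..)
  tensor_unit _ := congrArg ULift.up (blockSum_zero_right ..)

section Comp

variable (X Y : PermBimod.{u})

/-- Two composable pairs are identified when they differ by a permutation in the middle. -/
def compSetoid (n m : ℕ) : Setoid (Σ k : ℕ, X.Hom n k × Y.Hom k m) where
  r p q := ∃ σ : Fin p.1 ≃ Fin q.1, X.ract p.2.1 σ = q.2.1 ∧ p.2.2 = Y.lact σ q.2.2
  iseqv :=
    { refl := fun _ => ⟨Equiv.refl _, X.ract_refl _, (Y.lact_refl _).symm⟩
      symm := by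
        rintro _ _ ⟨σ, h₁, h₂⟩
        refine ⟨σ.symm, ?_, ?_⟩
        · rw [← h₁, ← X.ract_trans]; simp [X.ract_refl]
        · rw [h₂, ← Y.lact_trans]; simp [Y.lact_refl]
      trans := by
        rintro _ _ _ ⟨σ, h₁, h₂⟩ ⟨τ, h₃, h₄⟩
        refine ⟨σ.trans τ, ?_, ?_⟩
        · rw [X.ract_trans, h₁, h₃]
        · rw [h₂, h₄, Y.lact_trans] }

/-- Elements of the composite `X ; Y` over `P`. -/
def CompHom (n m : ℕ) : Type u := Quotient (compSetoid X Y n m)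

variable {X Y}

/-- The class of a composable pair. -/
def pair {n k m : ℕ} (x : X.Hom n k) (y : Y.Hom k m) : CompHom X Y n m :=
  Quotient.mk (compSetoid X Y n m) ⟨k, x, y⟩

theorem pair_eq_pair_iff {n k k' m : ℕ} {x : X.Hom n k} {y : Y.Hom k m} {x' : X.Hom n k'}
    {y' : Y.Hom k' m} :
    pair x y = pair x' y' ↔ ∃ σ : Fin k ≃ Fin k', X.ract x σ = x' ∧ y = Y.lact σ y' :=
  Quotient.eq (r := compSetoid X Y n m)

theorem pair_ract {n k k' m : ℕ} (x : X.Hom n k) (σ : Fin k ≃ Fin k') (y : Y.Hom k' m) :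
    pair (X.ract x σ) y = pair x (Y.lact σ y) :=
  (pair_eq_pair_iff.2 ⟨σ, rfl, rfl⟩).symm

theorem CompHom.ind {n m : ℕ} {p : CompHom X Y n m → Prop}
    (h : ∀ (k : ℕ) (x : X.Hom n k) (y : Y.Hom k m), p (pair x y)) (z : CompHom X Y n m) : p z :=
  Quotient.ind (fun a => h a.1 a.2.1 a.2.2) z

/-- Functions out of a composite. -/
def CompHom.lift {n m : ℕ} {A : Sort*} (F : ∀ k : ℕ, X.Hom n k → Y.Hom k m → A)
    (hF : ∀ (k k' : ℕ) (x : X.Hom n k) (σ : Fin k ≃ Fin k') (y : Y.Hom k' m),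
      F k' (X.ract x σ) y = F k x (Y.lact σ y)) (z : CompHom X Y n m) : A :=
  Quotient.lift (fun a : Σ k : ℕ, X.Hom n k × Y.Hom k m => F a.1 a.2.1 a.2.2)
    (by
      rintro ⟨k, x, y⟩ ⟨k', x', y'⟩ ⟨σ, h₁, h₂⟩
      dsimp only at h₁ h₂ σ ⊢
      rw [← h₁, h₂, hF]) z

@[simp] theorem CompHom.lift_pair {n m k : ℕ} {A : Sort*}
    (F : ∀ k : ℕ, X.Hom n k → Y.Hom k m → A)
    (hF : ∀ (k k' : ℕ) (x : X.Hom n k) (σ : Fin k ≃ Fin k') (y : Y.Hom k' m),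
      F k' (X.ract x σ) y = F k x (Y.lact σ y)) (x : X.Hom n k) (y : Y.Hom k m) :
    CompHom.lift F hF (pair x y) = F k x y := rfl

variable (X Y)

/-- Composition of bimodules over `P`. -/
def compBimod : PermBimod.{u} where
  Hom := CompHom X Y
  lact σ := CompHom.lift (fun _ x y => pair (X.lact σ x) y)
    (by intros; rw [X.lact_ract, pair_ract])
  ract z σ := CompHom.lift (fun _ x y => pair x (Y.ract y σ))
    (by intros; rw [← Y.lact_ract, pair_ract]) z
  unit := pair X.unit Y.unit
  tensor z w := CompHom.lift
    (fun _ x y => CompHom.lift (fun _ x' y' => pair (X.tensor x x') (Y.tensor y y'))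
      (by
        intro k k' x' σ y'
        have h := pair_ract (X.tensor x x') (blockSum (Equiv.refl _) σ) (Y.tensor y y')
        rwa [X.ract_tensor, Y.lact_tensor, X.ract_refl, Y.lact_refl] at h) w)
    (by
      intro k k' x σ y
      induction w using CompHom.ind with | _ l x' y' => ?_
      have h := pair_ract (X.tensor x x') (blockSum σ (Equiv.refl _)) (Y.tensor y y')
      rwa [X.ract_tensor, Y.lact_tensor, X.ract_refl, Y.lact_refl] at h) z
  lact_refl z := by
    induction z using CompHom.ind with | _ k x y => simp [X.lact_refl]
  lact_trans σ τ z := by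
    induction z using CompHom.ind with | _ k x y => simp [X.lact_trans]
  ract_refl z := by
    induction z using CompHom.ind with | _ k x y => simp [Y.ract_refl]
  ract_trans z σ τ := by
    induction z using CompHom.ind with | _ k x y => simp [Y.ract_trans]
  lact_ract σ z τ := by
    induction z using CompHom.ind with | _ k x y => simp
  lact_tensor σ τ z w := by
    induction z using CompHom.ind with | _ k x y => ?_
    induction w using CompHom.ind with | _ l x' y' => ?_
    simp [X.lact_tensor]
  ract_tensor z w σ τ := by
    induction z using CompHom.ind with | _ k x y => ?_
    induction w using CompHom.ind with | _ l x' y' => ?_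
    simp [Y.ract_tensor]
  tensor_assoc z w v := by
    induction z using CompHom.ind with | _ k x y => ?_
    induction w using CompHom.ind with | _ l x' y' => ?_
    induction v using CompHom.ind with | _ j x'' y'' => ?_
    simp only [CompHom.lift_pair]
    rw [Y.tensor_assoc, ← pair_ract, X.tensor_assoc]
  unit_tensor z := by
    induction z using CompHom.ind with | _ k x y => ?_
    simp only [CompHom.lift_pair]
    rw [Y.unit_tensor, ← pair_ract, X.unit_tensor]
  tensor_unit z := by
    induction z using CompHom.ind with | _ k x y => ?_
    simp only [CompHom.lift_pair]
    rw [Y.tensor_unit, X.tensor_unit]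

end Comp

@[simp] theorem compBimod_lact {X Y : PermBimod.{u}} {n n' k m : ℕ} (σ : Fin n' ≃ Fin n)
    (x : X.Hom n k) (y : Y.Hom k m) :
    (compBimod X Y).lact σ (pair x y) = pair (X.lact σ x) y := rfl

@[simp] theorem compBimod_ract {X Y : PermBimod.{u}} {n k m m' : ℕ} (x : X.Hom n k)
    (y : Y.Hom k m) (σ : Fin m ≃ Fin m') :
    (compBimod X Y).ract (pair x y) σ = pair x (Y.ract y σ) := rfl

@[simp] theorem compBimod_tensor {X Y : PermBimod.{u}} {a b c a' b' c' : ℕ} (x : X.Hom a b)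
    (y : Y.Hom b c) (x' : X.Hom a' b') (y' : Y.Hom b' c') :
    (compBimod X Y).tensor (pair x y) (pair x' y') = pair (X.tensor x x') (Y.tensor y y') := rfl

/-- Horizontal composition of maps of bimodules. -/
def compMap {X X' Y Y' : PermBimod.{u}} (F : X ⟶ X') (G : Y ⟶ Y') :
    compBimod X Y ⟶ compBimod X' Y' where
  app := CompHom.lift (fun _ x y => pair (app F x) (app G y))
    (by intros; rw [map_ract, map_lact, pair_ract])
  app_lact σ z := by
    induction z using CompHom.ind with | _ k x y =>
      exact congrArg (fun t => pair t (app G y)) (map_lact F σ x)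
  app_ract z σ := by
    induction z using CompHom.ind with | _ k x y =>
      exact congrArg (fun t => pair (app F x) t) (map_ract G y σ)
  app_unit := congrArg₂ pair (map_unit F) (map_unit G)
  app_tensor z w := by
    induction z using CompHom.ind with | _ k x y => ?_
    induction w using CompHom.ind with | _ l x' y' =>
      exact congrArg₂ pair (map_tensor F x x') (map_tensor G y y')

@[simp] theorem compMap_pair {X X' Y Y' : PermBimod.{u}} (F : X ⟶ X') (G : Y ⟶ Y') {n k m : ℕ}
    (x : X.Hom n k) (y : Y.Hom k m) : app (compMap F G) (pair x y) = pair (app F x) (app G y) :=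
  rfl

/-- The associativity isomorphism `(X ; Y) ; Z ≅ X ; (Y ; Z)`. -/
def compAssoc (X Y Z : PermBimod.{u}) :
    compBimod (compBimod X Y) Z ≅ compBimod X (compBimod Y Z) where
  hom :=
    { app := CompHom.lift
        (fun _ w z => CompHom.lift (fun _ x y => pair x (pair y z : CompHom Y Z _ _))
          (by intros; exact pair_ract (Y := compBimod Y Z) ..) w)
        (by
          intro k k' w σ z
          induction w using CompHom.ind with | _ l x y =>
            exact congrArg (fun t => pair x t) (pair_ract y σ z))
      app_lact := fun σ w => by
        induction w using CompHom.ind with | _ k w z => ?_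
        induction w using CompHom.ind with | _ l x y => rfl
      app_ract := fun w σ => by
        induction w using CompHom.ind with | _ k w z => ?_
        induction w using CompHom.ind with | _ l x y => rfl
      app_unit := rfl
      app_tensor := fun w w' => by
        induction w using CompHom.ind with | _ k w z => ?_
        induction w using CompHom.ind with | _ l x y => ?_
        induction w' using CompHom.ind with | _ k' w' z' => ?_
        induction w' using CompHom.ind with | _ l' x' y' => rfl }
  inv :=
    { app := CompHom.lift
        (fun _ x w => CompHom.lift (fun _ y z => pair (pair x y : CompHom X Y _ _) z)
          (by intros; exact (pair_ract (X := compBimod X Y) (pair x _) _ _)) w)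
        (by
          intro k k' x σ w
          induction w using CompHom.ind with | _ l y z =>
            exact congrArg (fun t => pair t z) (pair_ract x σ y))
      app_lact := fun σ w => by
        induction w using CompHom.ind with | _ k x w => ?_
        induction w using CompHom.ind with | _ l y z => rfl
      app_ract := fun w σ => by
        induction w using CompHom.ind with | _ k x w => ?_
        induction w using CompHom.ind with | _ l y z => rfl
      app_unit := rfl
      app_tensor := fun w w' => by
        induction w using CompHom.ind with | _ k x w => ?_
        induction w using CompHom.ind with | _ l y z => ?_
        induction w' using CompHom.ind with | _ k' x' w' => ?_
        induction w' using CompHom.ind with | _ l' y' z' => rfl }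
  hom_inv_id := by
    ext n m w
    induction w using CompHom.ind with | _ k w z => ?_
    induction w using CompHom.ind with | _ l x y => rfl
  inv_hom_id := by
    ext n m w
    induction w using CompHom.ind with | _ k x w => ?_
    induction w using CompHom.ind with | _ l y z => rfl

@[simp] theorem compAssoc_hom_pair {X Y Z : PermBimod.{u}} {a b c d : ℕ} (x : X.Hom a b)
    (y : Y.Hom b c) (z : Z.Hom c d) :
    app (compAssoc X Y Z).hom (pair (X := compBimod X Y) (pair x y) z) =
      pair (Y := compBimod Y Z) x (pair y z) := rfl

@[simp] theorem compAssoc_inv_pair {X Y Z : PermBimod.{u}} {a b c d : ℕ} (x : X.Hom a b)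
    (y : Y.Hom b c) (z : Z.Hom c d) :
    app (compAssoc X Y Z).inv (pair (Y := compBimod Y Z) x (pair y z)) =
      pair (X := compBimod X Y) (pair x y) z := rfl

/-- The left unit isomorphism `P ; X ≅ X`. -/
def compLeftUnit (X : PermBimod.{u}) : compBimod permBimod X ≅ X where
  hom :=
    { app := CompHom.lift (fun _ σ x => X.lact σ.down x)
        (by intros; simp [permBimod, X.lact_trans])
      app_lact := fun σ w => by
        induction w using CompHom.ind with | _ k τ x => exact X.lact_trans ..
      app_ract := fun w σ => by
        induction w using CompHom.ind with | _ k τ x => exact X.lact_ract ..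
      app_unit := X.lact_refl _
      app_tensor := fun w w' => by
        induction w using CompHom.ind with | _ k τ x => ?_
        induction w' using CompHom.ind with | _ k' τ' x' => exact X.lact_tensor .. }
  inv :=
    { app := fun x => pair (X := permBimod) ⟨Equiv.refl _⟩ x
      app_lact := fun σ x => by
        exact (pair_ract (X := permBimod) (⟨Equiv.refl _⟩ : permBimod.Hom _ _) σ x).symm
      app_ract := fun x σ => rfl
      app_unit := rfl
      app_tensor := fun x y => by
        exact congrArg (fun t : permBimod.Hom _ _ => pair t (X.tensor x y))
          (congrArg ULift.up blockSum_refl.symm) }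
  hom_inv_id := by
    ext n m w
    induction w using CompHom.ind with | _ k σ x =>
      exact (pair_ract (X := permBimod) (⟨Equiv.refl _⟩ : permBimod.Hom _ _) σ.down x).symm
  inv_hom_id := by
    ext n m x
    exact X.lact_refl x

/-- The right unit isomorphism `X ; P ≅ X`. -/
def compRightUnit (X : PermBimod.{u}) : compBimod X permBimod ≅ X where
  hom :=
    { app := CompHom.lift (fun _ x σ => X.ract x σ.down)
        (by intros; simp [permBimod, X.ract_trans])
      app_lact := fun σ w => by
        induction w using CompHom.ind with | _ k x τ => exact (X.lact_ract ..).symm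
      app_ract := fun w σ => by
        induction w using CompHom.ind with | _ k x τ => exact X.ract_trans ..
      app_unit := X.ract_refl _
      app_tensor := fun w w' => by
        induction w using CompHom.ind with | _ k x τ => ?_
        induction w' using CompHom.ind with | _ k' x' τ' => exact X.ract_tensor .. }
  inv :=
    { app := fun x => pair (Y := permBimod) x ⟨Equiv.refl _⟩
      app_lact := fun σ x => rfl
      app_ract := fun x σ => by
        exact pair_ract (Y := permBimod) x σ (⟨Equiv.refl _⟩ : permBimod.Hom _ _)
      app_unit := rfl
      app_tensor := fun x y => by
        exact congrArg (fun t : permBimod.Hom _ _ => pair (X.tensor x y) t)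
          (congrArg ULift.up blockSum_refl.symm) }
  hom_inv_id := by
    ext n m w
    induction w using CompHom.ind with | _ k x σ =>
      exact pair_ract (Y := permBimod) x σ.down (⟨Equiv.refl _⟩ : permBimod.Hom _ _)
  inv_hom_id := by
    ext n m x
    exact X.ract_refl x

instance : MonoidalCategoryStruct PermBimod.{u} where
  tensorObj := compBimod
  whiskerLeft X _ _ F := compMap (𝟙 X) F
  whiskerRight F Y := compMap F (𝟙 Y)
  tensorHom := compMap
  tensorUnit := permBimod
  associator := compAssoc
  leftUnitor := compLeftUnit
  rightUnitor := compRightUnit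

/-- Bimodules over `P` form a monoidal category under composition `X ⊗ Y = X ; Y`. -/
instance : MonoidalCategory PermBimod.{u} where
  tensorHom_def F G := by
    ext n m w
    induction w using CompHom.ind with | _ k x y => rfl
  id_tensorHom_id X Y := by
    ext n m w
    induction w using CompHom.ind with | _ k x y => rfl
  tensorHom_comp_tensorHom F G F' G' := by
    ext n m w
    induction w using CompHom.ind with | _ k x y => rfl
  whiskerLeft_id X Y := by
    ext n m w
    induction w using CompHom.ind with | _ k x y => rfl
  id_whiskerRight X Y := by
    ext n m w
    induction w using CompHom.ind with | _ k x y => rfl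
  associator_naturality F G H := by
    ext n m w
    induction w using CompHom.ind with | _ k w z => ?_
    induction w using CompHom.ind with | _ l x y => rfl
  leftUnitor_naturality F := by
    ext n m w
    induction w using CompHom.ind with | _ k σ x => exact (F.app_lact ..).symm
  rightUnitor_naturality F := by
    ext n m w
    induction w using CompHom.ind with | _ k x σ => exact (F.app_ract ..).symm
  pentagon W X Y Z := by
    ext n m w
    induction w using CompHom.ind with | _ k w z => ?_
    induction w using CompHom.ind with | _ k' w y => ?_
    induction w using CompHom.ind with | _ k'' w x => rfl
  triangle X Y := by
    ext n m w
    induction w using CompHom.ind with | _ k w y => ?_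
    induction w using CompHom.ind with | _ k' x σ => exact (pair_ract ..).symm

end PermBimod

/-! ## PROPs -/

/-- A PROP in diagrammatic order: a strict symmetric monoidal category whose objects are the
natural numbers, with addition as tensor product.  The symmetry is given by the images `perm σ` of
the morphisms of `P`; `perm (Equiv.refl _)` is the identity, and strictness of the tensor product
is expressed with `perm (finCongr h)`, which is the identity along an equation `h : n = m`. -/
structure PROP where
  Hom : ℕ → ℕ → Type u
  perm {n m : ℕ} : (Fin n ≃ Fin m) → Hom n m
  comp {n m k : ℕ} : Hom n m → Hom m k → Hom n k
  tensor {a b c d : ℕ} : Hom a b → Hom c d → Hom (a + c) (b + d)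
  comp_assoc {a b c d : ℕ} (f : Hom a b) (g : Hom b c) (h : Hom c d) :
    comp (comp f g) h = comp f (comp g h)
  id_comp {a b : ℕ} (f : Hom a b) : comp (perm (Equiv.refl _)) f = f
  comp_id {a b : ℕ} (f : Hom a b) : comp f (perm (Equiv.refl _)) = f
  perm_trans {a b c : ℕ} (σ : Fin a ≃ Fin b) (τ : Fin b ≃ Fin c) :
    perm (σ.trans τ) = comp (perm σ) (perm τ)
  perm_blockSum {a b c d : ℕ} (σ : Fin a ≃ Fin b) (τ : Fin c ≃ Fin d) :
    perm (blockSum σ τ) = tensor (perm σ) (perm τ)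
  comp_tensor_comp {a b c a' b' c' : ℕ} (f : Hom a b) (g : Hom b c) (f' : Hom a' b')
    (g' : Hom b' c') : tensor (comp f g) (comp f' g') = comp (tensor f f') (tensor g g')
  tensor_assoc {a b c d e i : ℕ} (f : Hom a b) (g : Hom c d) (h : Hom e i) :
    comp (tensor (tensor f g) h) (perm (finCongr (Nat.add_assoc b d i))) =
      comp (perm (finCongr (Nat.add_assoc a c e))) (tensor f (tensor g h))
  id_tensor {a b : ℕ} (f : Hom a b) :
    comp (tensor (perm (Equiv.refl (Fin 0))) f) (perm (finCongr (Nat.zero_add b))) =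
      comp (perm (finCongr (Nat.zero_add a))) f
  tensor_id {a b : ℕ} (f : Hom a b) : tensor f (perm (Equiv.refl (Fin 0))) = f
  swap_natural {a b c d : ℕ} (f : Hom a b) (g : Hom c d) :
    comp (tensor f g) (perm (finAddFlip : Fin (b + d) ≃ Fin (d + b))) =
      comp (perm (finAddFlip : Fin (a + c) ≃ Fin (c + a))) (tensor g f)

namespace PROP

/-- The identity morphism of the object `n`. -/
def id (T : PROP.{u}) (n : ℕ) : T.Hom n n := T.perm (Equiv.refl _)

/-- Morphisms of PROPs: strict symmetric monoidal functors that are the identity on objects. -/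
@[ext] structure PropHom (T S : PROP.{u}) where
  map {n m : ℕ} : T.Hom n m → S.Hom n m
  map_perm {n m : ℕ} (σ : Fin n ≃ Fin m) : map (T.perm σ) = S.perm σ
  map_comp {n m k : ℕ} (f : T.Hom n m) (g : T.Hom m k) :
    map (T.comp f g) = S.comp (map f) (map g)
  map_tensor {a b c d : ℕ} (f : T.Hom a b) (g : T.Hom c d) :
    map (T.tensor f g) = S.tensor (map f) (map g)

attribute [simp] PropHom.map_perm PropHom.map_comp PropHom.map_tensor

instance : Category PROP.{u} where
  Hom := PropHom
  id T := { map := fun f => f, map_perm := fun _ => rfl, map_comp := fun _ _ => rfl,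
            map_tensor := fun _ _ => rfl }
  comp F G := { map := fun f => G.map (F.map f), map_perm := by intros; simp,
                map_comp := by intros; simp, map_tensor := by intros; simp }

/-- The map of hom-sets underlying a morphism of PROPs. -/
def map {T S : PROP.{u}} (F : T ⟶ S) {n m : ℕ} (f : T.Hom n m) : S.Hom n m := PropHom.map F f

/-- The opposite PROP. -/
def op (T : PROP.{u}) : PROP.{u} where
  Hom n m := T.Hom m n
  perm σ := T.perm σ.symm
  comp f g := T.comp g f
  tensor f g := T.tensor f g
  comp_assoc f g h := (T.comp_assoc h g f).symm
  id_comp f := T.comp_id f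
  comp_id f := T.id_comp f
  perm_trans σ τ := T.perm_trans τ.symm σ.symm
  perm_blockSum σ τ := by rw [blockSum_symm, T.perm_blockSum]
  comp_tensor_comp f g f' g' := T.comp_tensor_comp g f g' f'
  tensor_assoc {a b c d e i} f g h := by
    have key := T.tensor_assoc f g h
    have h₁ : ∀ {x y : ℕ} (h : x = y),
        T.comp (T.perm (finCongr h).symm) (T.perm (finCongr h)) = T.perm (Equiv.refl _) := by
      intro x y h; subst h; rw [← T.perm_trans]; rfl
    have h₂ : ∀ {x y : ℕ} (h : x = y),
        T.comp (T.perm (finCongr h)) (T.perm (finCongr h).symm) = T.perm (Equiv.refl _) := by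
      intro x y h; subst h; rw [← T.perm_trans]; rfl
    rw [← T.comp_id (T.comp (T.perm _) (T.tensor (T.tensor f g) h)), ← h₂ (Nat.add_assoc a c e),
      T.comp_assoc, ← T.comp_assoc (T.tensor (T.tensor f g) h), key, ← T.comp_assoc,
      ← T.comp_assoc, h₁, T.id_comp]
  id_tensor {a b} f := by
    have key := T.id_tensor f
    have h₁ : ∀ {x y : ℕ} (h : x = y),
        T.comp (T.perm (finCongr h).symm) (T.perm (finCongr h)) = T.perm (Equiv.refl _) := by
      intro x y h; subst h; rw [← T.perm_trans]; rfl
    have h₂ : ∀ {x y : ℕ} (h : x = y),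
        T.comp (T.perm (finCongr h)) (T.perm (finCongr h).symm) = T.perm (Equiv.refl _) := by
      intro x y h; subst h; rw [← T.perm_trans]; rfl
    change T.comp (T.perm _) (T.tensor (T.perm (Equiv.refl (Fin 0))) f) = T.comp f (T.perm _)
    rw [← T.comp_id (T.comp (T.perm _) (T.tensor (T.perm (Equiv.refl (Fin 0))) f)),
      ← h₂ (Nat.zero_add a),
      T.comp_assoc, ← T.comp_assoc (T.tensor (T.perm (Equiv.refl (Fin 0))) f), key,
      ← T.comp_assoc, ← T.comp_assoc, h₁, T.id_comp]
  tensor_id f := T.tensor_id f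
  swap_natural {a b c d} f g := by
    have h : ∀ x y : ℕ, (finAddFlip : Fin (x + y) ≃ Fin (y + x)).symm = finAddFlip := by
      intro x y; ext i; simp [finAddFlip]
    rw [h, h]
    exact (T.swap_natural g f).symm

/-- A morphism into an opposite PROP, read backwards. -/
def unop {T S : PROP.{u}} (F : T ⟶ S.op) : T.op ⟶ S where
  map {n m} f := map F (n := m) (m := n) f
  map_perm σ := PropHom.map_perm F σ.symm
  map_comp f g := PropHom.map_comp F g f
  map_tensor f g := PropHom.map_tensor F f g

/-- The action of `op` on morphisms. -/
def opMap {T S : PROP.{u}} (F : T ⟶ S) : T.op ⟶ S.op where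
  map {n m} f := map F (n := m) (m := n) f
  map_perm σ := PropHom.map_perm F σ.symm
  map_comp f g := PropHom.map_comp F g f
  map_tensor f g := PropHom.map_tensor F f g

/-- The composite of two contravariant morphisms. -/
def bothWays {T S R : PROP.{u}} (F : T ⟶ S.op) (F' : S ⟶ R.op) : T ⟶ R where
  map {n m} f := map F' (n := m) (m := n) (map F f)
  map_perm σ := (congrArg (fun t => map F' t) (PropHom.map_perm F σ)).trans
    (PropHom.map_perm F' σ.symm)
  map_comp f g := (congrArg (fun t => map F' t) (PropHom.map_comp F f g)).trans
    (PropHom.map_comp F' _ _)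
  map_tensor f g := (congrArg (fun t => map F' t) (PropHom.map_tensor F f g)).trans
    (PropHom.map_tensor F' _ _)

/-- The bimodule underlying a PROP. -/
def bimod (T : PROP.{u}) : PermBimod.{u} where
  Hom := T.Hom
  lact σ f := T.comp (T.perm σ) f
  ract f σ := T.comp f (T.perm σ)
  unit := T.id 0
  tensor := T.tensor
  lact_refl := T.id_comp
  lact_trans σ τ f := by rw [T.perm_trans, T.comp_assoc]
  ract_refl := T.comp_id
  ract_trans f σ τ := by rw [T.perm_trans, T.comp_assoc]
  lact_ract σ f τ := by rw [T.comp_assoc]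
  lact_tensor σ τ f g := by rw [T.perm_blockSum, T.comp_tensor_comp]
  ract_tensor f g σ τ := by rw [T.perm_blockSum, T.comp_tensor_comp]
  tensor_assoc := T.tensor_assoc
  unit_tensor := T.id_tensor
  tensor_unit := T.tensor_id

/-- A PROP is a monad on `P`: a monoid in the monoidal category of bimodules over `P`. -/
instance (T : PROP.{u}) : MonObj T.bimod where
  one :=
    { app := fun σ => T.perm σ.down
      app_lact := fun σ τ => T.perm_trans σ τ.down
      app_ract := fun σ τ => T.perm_trans σ.down τ
      app_unit := rfl
      app_tensor := fun σ τ => T.perm_blockSum σ.down τ.down }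
  mul :=
    { app := PermBimod.CompHom.lift (fun _ f g => T.comp f g)
        (fun _ _ f σ g => T.comp_assoc f (T.perm σ) g)
      app_lact := fun σ w => by
        induction w using PermBimod.CompHom.ind with | _ k f g =>
          exact T.comp_assoc (T.perm σ) f g
      app_ract := fun w σ => by
        induction w using PermBimod.CompHom.ind with | _ k f g =>
          exact (T.comp_assoc f g (T.perm σ)).symm
      app_unit := T.id_comp _
      app_tensor := fun w w' => by
        induction w using PermBimod.CompHom.ind with | _ k f g => ?_
        induction w' using PermBimod.CompHom.ind with | _ k' f' g' =>
          exact (T.comp_tensor_comp f g f' g').symm }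
  one_mul := by
    ext n m w
    induction w using PermBimod.CompHom.ind with | _ k σ f => rfl
  mul_one := by
    ext n m w
    induction w using PermBimod.CompHom.ind with | _ k f σ => rfl
  mul_assoc := by
    ext n m w
    induction w using PermBimod.CompHom.ind with | _ k w h => ?_
    induction w using PermBimod.CompHom.ind with | _ l f g => exact T.comp_assoc f g h

/-- The map of bimodules underlying a morphism of PROPs. -/
def bimodMap {T S : PROP.{u}} (F : T ⟶ S) : T.bimod ⟶ S.bimod where
  app f := map F f
  app_lact σ f := (PropHom.map_comp F _ f).trans
    (congrArg (fun t => S.comp t (map F f)) (PropHom.map_perm F σ))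
  app_ract f σ := (PropHom.map_comp F f _).trans
    (congrArg (fun t => S.comp (map F f) t) (PropHom.map_perm F σ))
  app_unit := PropHom.map_perm F _
  app_tensor f g := PropHom.map_tensor F f g

end PROP

/-! ## Presentations of PROPs by generators and equations -/

/-- Terms over a monoidal signature `Gen`, of given arity and coarity. -/
inductive PropTerm (Gen : ℕ → ℕ → Type u) : ℕ → ℕ → Type u
  | gen {n m : ℕ} (x : Gen n m) : PropTerm Gen n m
  | perm {n m : ℕ} (σ : Fin n ≃ Fin m) : PropTerm Gen n m
  | comp {n m k : ℕ} (s : PropTerm Gen n m) (t : PropTerm Gen m k) : PropTerm Gen n k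
  | tensor {a b c d : ℕ} (s : PropTerm Gen a b) (t : PropTerm Gen c d) :
      PropTerm Gen (a + c) (b + d)

namespace PropTerm

variable {Gen : ℕ → ℕ → Type u}

/-- The identity term. -/
abbrev id (n : ℕ) : PropTerm Gen n n := perm (Equiv.refl _)

/-- The term for the symmetry `1 + 1 ⟶ 1 + 1`. -/
abbrev swap : PropTerm Gen 2 2 := perm (finAddFlip (m := 1) (n := 1))

/-- The least congruence containing `R` and the equations of a strict symmetric monoidal
category. -/
inductive Cong (R : ∀ {n m : ℕ}, PropTerm Gen n m → PropTerm Gen n m → Prop) :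
    ∀ {n m : ℕ}, PropTerm Gen n m → PropTerm Gen n m → Prop
  | rel {n m : ℕ} {s t : PropTerm Gen n m} : R s t → Cong R s t
  | refl {n m : ℕ} (s : PropTerm Gen n m) : Cong R s s
  | symm {n m : ℕ} {s t : PropTerm Gen n m} : Cong R s t → Cong R t s
  | trans {n m : ℕ} {s t r : PropTerm Gen n m} : Cong R s t → Cong R t r → Cong R s r
  | comp {n m k : ℕ} {s s' : PropTerm Gen n m} {t t' : PropTerm Gen m k} :
      Cong R s s' → Cong R t t' → Cong R (s.comp t) (s'.comp t')
  | tensor {a b c d : ℕ} {s s' : PropTerm Gen a b} {t t' : PropTerm Gen c d} :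
      Cong R s s' → Cong R t t' → Cong R (s.tensor t) (s'.tensor t')
  | comp_assoc {a b c d : ℕ} (f : PropTerm Gen a b) (g : PropTerm Gen b c)
      (h : PropTerm Gen c d) : Cong R ((f.comp g).comp h) (f.comp (g.comp h))
  | id_comp {a b : ℕ} (f : PropTerm Gen a b) : Cong R ((id a).comp f) f
  | comp_id {a b : ℕ} (f : PropTerm Gen a b) : Cong R (f.comp (id b)) f
  | perm_trans {a b c : ℕ} (σ : Fin a ≃ Fin b) (τ : Fin b ≃ Fin c) :
      Cong R (perm (σ.trans τ)) ((perm σ).comp (perm τ))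
  | perm_blockSum {a b c d : ℕ} (σ : Fin a ≃ Fin b) (τ : Fin c ≃ Fin d) :
      Cong R (perm (blockSum σ τ)) ((perm σ).tensor (perm τ))
  | comp_tensor_comp {a b c a' b' c' : ℕ} (f : PropTerm Gen a b) (g : PropTerm Gen b c)
      (f' : PropTerm Gen a' b') (g' : PropTerm Gen b' c') :
      Cong R ((f.comp g).tensor (f'.comp g')) ((f.tensor f').comp (g.tensor g'))
  | tensor_assoc {a b c d e i : ℕ} (f : PropTerm Gen a b) (g : PropTerm Gen c d)
      (h : PropTerm Gen e i) :
      Cong R (((f.tensor g).tensor h).comp (perm (finCongr (Nat.add_assoc b d i))))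
        ((perm (finCongr (Nat.add_assoc a c e))).comp (f.tensor (g.tensor h)))
  | id_tensor {a b : ℕ} (f : PropTerm Gen a b) :
      Cong R (((id 0).tensor f).comp (perm (finCongr (Nat.zero_add b))))
        ((perm (finCongr (Nat.zero_add a))).comp f)
  | tensor_id {a b : ℕ} (f : PropTerm Gen a b) : Cong R (f.tensor (id 0)) f
  | swap_natural {a b c d : ℕ} (f : PropTerm Gen a b) (g : PropTerm Gen c d) :
      Cong R ((f.tensor g).comp (perm (finAddFlip : Fin (b + d) ≃ Fin (d + b))))
        ((perm (finAddFlip : Fin (a + c) ≃ Fin (c + a))).comp (g.tensor f))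

/-- The value of a term in a PROP. -/
def eval (T : PROP.{u}) (v : ∀ {n m : ℕ}, Gen n m → T.Hom n m) :
    ∀ {n m : ℕ}, PropTerm Gen n m → T.Hom n m
  | _, _, gen x => v x
  | _, _, perm σ => T.perm σ
  | _, _, comp s t => T.comp (eval T v s) (eval T v t)
  | _, _, tensor s t => T.tensor (eval T v s) (eval T v t)

end PropTerm

/-- A signature together with equations between its terms. -/
structure PropPresentation where
  Gen : ℕ → ℕ → Type u
  Rel : ∀ {n m : ℕ}, PropTerm Gen n m → PropTerm Gen n m → Prop

namespace PropPresentation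

variable (pres : PropPresentation.{u})

/-- Terms up to the congruence generated by the equations. -/
def setoid (n m : ℕ) : Setoid (PropTerm pres.Gen n m) where
  r := PropTerm.Cong pres.Rel
  iseqv := ⟨PropTerm.Cong.refl, PropTerm.Cong.symm, PropTerm.Cong.trans⟩

/-- The PROP presented by a signature and equations. -/
def prop : PROP.{u} where
  Hom n m := Quotient (pres.setoid n m)
  perm σ := Quotient.mk _ (PropTerm.perm σ)
  comp := Quotient.map₂ PropTerm.comp (fun _ _ h _ _ h' => PropTerm.Cong.comp h h')
  tensor := Quotient.map₂ PropTerm.tensor (fun _ _ h _ _ h' => PropTerm.Cong.tensor h h')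
  comp_assoc f g h := by
    induction f using Quotient.ind; induction g using Quotient.ind
    induction h using Quotient.ind
    exact Quotient.sound (PropTerm.Cong.comp_assoc _ _ _)
  id_comp f := by
    induction f using Quotient.ind
    exact Quotient.sound (PropTerm.Cong.id_comp _)
  comp_id f := by
    induction f using Quotient.ind
    exact Quotient.sound (PropTerm.Cong.comp_id _)
  perm_trans σ τ := Quotient.sound (PropTerm.Cong.perm_trans _ _)
  perm_blockSum σ τ := Quotient.sound (PropTerm.Cong.perm_blockSum _ _)
  comp_tensor_comp f g f' g' := by
    induction f using Quotient.ind; induction g using Quotient.ind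
    induction f' using Quotient.ind; induction g' using Quotient.ind
    exact Quotient.sound (PropTerm.Cong.comp_tensor_comp _ _ _ _)
  tensor_assoc f g h := by
    induction f using Quotient.ind; induction g using Quotient.ind
    induction h using Quotient.ind
    exact Quotient.sound (PropTerm.Cong.tensor_assoc _ _ _)
  id_tensor f := by
    induction f using Quotient.ind
    exact Quotient.sound (PropTerm.Cong.id_tensor _)
  tensor_id f := by
    induction f using Quotient.ind
    exact Quotient.sound (PropTerm.Cong.tensor_id _)
  swap_natural f g := by
    induction f using Quotient.ind; induction g using Quotient.ind
    exact Quotient.sound (PropTerm.Cong.swap_natural _ _)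

/-- The morphism denoted by a term. -/
def toHom {n m : ℕ} (t : PropTerm pres.Gen n m) : pres.prop.Hom n m := Quotient.mk (pres.setoid n m) t

/-- The morphism denoted by a generator. -/
def of {n m : ℕ} (x : pres.Gen n m) : pres.prop.Hom n m := pres.toHom (PropTerm.gen x)

variable {pres}

theorem toHom_eq {n m : ℕ} {s t : PropTerm pres.Gen n m} (h : pres.Rel s t) : pres.toHom s = pres.toHom t :=
  Quotient.sound (PropTerm.Cong.rel h)

/-- An interpretation of the generators that satisfies the equations extends to the presented
PROP. -/
def lift (T : PROP.{u}) (v : ∀ {n m : ℕ}, pres.Gen n m → T.Hom n m)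
    (hv : ∀ {n m : ℕ} (s t : PropTerm pres.Gen n m), pres.Rel s t →
      PropTerm.eval T v s = PropTerm.eval T v t) : pres.prop ⟶ T where
  map := Quotient.lift (PropTerm.eval T v) (by
    intro s t h
    change PropTerm.Cong pres.Rel s t at h
    induction h with
    | rel h => exact hv _ _ h
    | refl => rfl
    | symm _ ih => exact ih.symm
    | trans _ _ ih ih' => exact ih.trans ih'
    | comp _ _ ih ih' => exact congrArg₂ T.comp ih ih'
    | tensor _ _ ih ih' => exact congrArg₂ T.tensor ih ih'
    | comp_assoc => exact T.comp_assoc _ _ _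
    | id_comp => exact T.id_comp _
    | comp_id => exact T.comp_id _
    | perm_trans => exact T.perm_trans _ _
    | perm_blockSum => exact T.perm_blockSum _ _
    | comp_tensor_comp => exact T.comp_tensor_comp _ _ _ _
    | tensor_assoc => exact T.tensor_assoc _ _ _
    | id_tensor => exact T.id_tensor _
    | tensor_id => exact T.tensor_id _
    | swap_natural => exact T.swap_natural _ _)
  map_perm _ := rfl
  map_comp f g := by
    induction f using Quotient.ind; induction g using Quotient.ind
    rfl
  map_tensor f g := by
    induction f using Quotient.ind; induction g using Quotient.ind
    rfl

/-- Morphisms out of a presented PROP are determined by their values on the generators. -/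
theorem hom_ext {T : PROP.{u}} {F F' : pres.prop ⟶ T}
    (h : ∀ (n m : ℕ) (x : pres.Gen n m), PROP.map F (pres.of x) = PROP.map F' (pres.of x)) : F = F' := by
  apply PROP.PropHom.ext
  funext n m f
  induction f using Quotient.ind with | _ t => ?_
  induction t with
  | gen x => exact h _ _ x
  | perm σ => exact (F.map_perm σ).trans (F'.map_perm σ).symm
  | comp s t ih ih' =>
    exact (F.map_comp (pres.toHom s) (pres.toHom t)).trans
      ((congrArg₂ T.comp ih ih').trans (F'.map_comp (pres.toHom s) (pres.toHom t)).symm)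
  | tensor s t ih ih' =>
    exact (F.map_tensor (pres.toHom s) (pres.toHom t)).trans
      ((congrArg₂ T.tensor ih ih').trans (F'.map_tensor (pres.toHom s) (pres.toHom t)).symm)

end PropPresentation

/-! ## Dagger PROPs -/

/-- A PROP with an involutive, identity-on-objects, contravariant strict symmetric monoidal
endofunctor; in particular the permutations are unitary. -/
structure DagPROP extends PROP.{u} where
  dag {n m : ℕ} : Hom n m → Hom m n
  dag_dag {n m : ℕ} (f : Hom n m) : dag (dag f) = f
  dag_perm {n m : ℕ} (σ : Fin n ≃ Fin m) : dag (perm σ) = perm σ.symm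
  dag_comp {n m k : ℕ} (f : Hom n m) (g : Hom m k) : dag (comp f g) = comp (dag g) (dag f)
  dag_tensor {a b c d : ℕ} (f : Hom a b) (g : Hom c d) :
    dag (tensor f g) = tensor (dag f) (dag g)

namespace DagPROP

/-- Morphisms of dagger PROPs. -/
@[ext] structure DagHom (T S : DagPROP.{u}) where
  hom : T.toPROP ⟶ S.toPROP
  map_dag {n m : ℕ} (f : T.Hom n m) : PROP.map hom (T.dag f) = S.dag (PROP.map hom f)

instance : Category DagPROP.{u} where
  Hom := DagHom
  id T := { hom := 𝟙 T.toPROP, map_dag := fun _ => rfl }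
  comp F G :=
    { hom := F.hom ≫ G.hom
      map_dag := fun f => (congrArg (PROP.map G.hom) (F.map_dag f)).trans (G.map_dag _) }

/-- The morphism of PROPs underlying a morphism of dagger PROPs. -/
def homOf {T S : DagPROP.{u}} (F : T ⟶ S) : T.toPROP ⟶ S.toPROP := DagHom.hom F

end DagPROP

/-! ## The PROPs `M`, `C` and `PG` -/

/-- Generators of the PROP of commutative monoids. -/
inductive CMonGen : ℕ → ℕ → Type u
  | mu : CMonGen 2 1
  | eta : CMonGen 0 1

open PropTerm in
/-- The equations (M) of commutative monoids. -/
inductive CMonRel : ∀ {n m : ℕ}, PropTerm CMonGen.{u} n m → PropTerm CMonGen.{u} n m → Prop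
  | assoc : CMonRel (n := 3) (m := 1)
      (comp (tensor (gen CMonGen.mu) (id 1)) (gen CMonGen.mu))
      (comp (tensor (id 1) (gen CMonGen.mu)) (gen CMonGen.mu))
  | unit : CMonRel (n := 1) (m := 1)
      (comp (tensor (gen CMonGen.eta) (id 1)) (gen CMonGen.mu)) (id 1)
  | comm : CMonRel (n := 2) (m := 1) (comp swap (gen CMonGen.mu)) (gen CMonGen.mu)

/-- The presentation of the PROP of commutative monoids. -/
def cmonPresentation : PropPresentation.{u} := ⟨CMonGen, CMonRel⟩

/-- The PROP `M` of commutative monoids. -/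
def CMonPROP : PROP.{u} := cmonPresentation.prop

/-- The PROP `C` of cocommutative comonoids, the opposite of `M`. -/
def CComonPROP : PROP.{u} := CMonPROP.op

namespace CMonPROP

/-- The multiplication. -/
def mu : CMonPROP.{u}.Hom 2 1 := cmonPresentation.of CMonGen.mu

/-- The unit. -/
def eta : CMonPROP.{u}.Hom 0 1 := cmonPresentation.of CMonGen.eta

end CMonPROP

namespace CComonPROP

/-- The comultiplication. -/
def delta : CComonPROP.{u}.Hom 1 2 := CMonPROP.mu

/-- The counit. -/
def epsilon : CComonPROP.{u}.Hom 1 0 := CMonPROP.eta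

end CComonPROP

/-- Generators of the PROP `PG`: the elements of `G`, as maps `1 ⟶ 1`. -/
inductive PhaseGen (G : Type u) : ℕ → ℕ → Type u
  | phase (g : G) : PhaseGen G 1 1

open PropTerm in
/-- The equations of the group `G`. -/
inductive PhaseRel (G : Type u) [Group G] :
    ∀ {n m : ℕ}, PropTerm (PhaseGen G) n m → PropTerm (PhaseGen G) n m → Prop
  | phase_mul (g h : G) : PhaseRel G (n := 1) (m := 1)
      (comp (gen (PhaseGen.phase g)) (gen (PhaseGen.phase h))) (gen (PhaseGen.phase (g * h)))
  | phase_one : PhaseRel G (n := 1) (m := 1) (gen (PhaseGen.phase 1)) (id 1)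

/-- The presentation of the PROP `PG`. -/
def phasePresentation (G : Type u) [Group G] : PropPresentation.{u} := ⟨PhaseGen G, PhaseRel G⟩

/-- The PROP `PG`: permutations, together with elements of the group `G` as maps `1 ⟶ 1`.  (The
law moving permutations past group elements is naturality of the symmetry.) -/
def PhasePROP (G : Type u) [Group G] : PROP.{u} := (phasePresentation G).prop

namespace PhasePROP

variable {G : Type u} [Group G]

/-- The element `g` as a map `1 ⟶ 1`. -/
def phase (g : G) : (PhasePROP G).Hom 1 1 := (phasePresentation G).of (PhaseGen.phase g)

/-- The morphisms `m ⟶ m` of `G^×`: vectors `g₀ ⊗ ⋯ ⊗ gₘ₋₁` of elements of `G`. -/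
def diag : ∀ {m : ℕ}, (Fin m → G) → (PhasePROP G).Hom m m
  | 0, _ => (PhasePROP G).id 0
  | m + 1, g => (PhasePROP G).tensor (diag (fun i : Fin m => g i.castSucc)) (phase (g (Fin.last m)))

/-- Functoriality of `PG` in the group. -/
def map {H : Type u} [Group H] (φ : G →* H) : PhasePROP G ⟶ PhasePROP H :=
  PropPresentation.lift (pres := phasePresentation G) (PhasePROP H)
    (fun {_ _} x => match x with | .phase g => phase (φ g))
    (by
      intro n m s t h
      cases h with
      | phase_mul g h =>
        simp only [PropTerm.eval, map_mul]
        exact PropPresentation.toHom_eq (pres := phasePresentation H) (PhaseRel.phase_mul _ _)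
      | phase_one =>
        simp only [PropTerm.eval, map_one]
        exact PropPresentation.toHom_eq (pres := phasePresentation H) PhaseRel.phase_one)

end PhasePROP

/-! ## The PROP `FG` presented by `M + PG + C` and the equations (P1), (P2), (F) -/

/-- Generators: those of `M`, of `PG` and of `C`. -/
inductive FrobGen (G : Type u) : ℕ → ℕ → Type u
  | mu : FrobGen G 2 1
  | eta : FrobGen G 0 1
  | phase (g : G) : FrobGen G 1 1
  | delta : FrobGen G 1 2
  | epsilon : FrobGen G 1 0

open PropTerm FrobGen in
/-- Equations: those of `M`, of `PG` and of `C`, together with the phase equations (P1) and (P2)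
and the special Frobenius equations (F). -/
inductive FrobRel (G : Type u) [CommGroup G] :
    ∀ {n m : ℕ}, PropTerm (FrobGen G) n m → PropTerm (FrobGen G) n m → Prop
  | assoc : FrobRel G (n := 3) (m := 1)
      (comp (tensor (gen mu) (id 1)) (gen mu)) (comp (tensor (id 1) (gen mu)) (gen mu))
  | unit : FrobRel G (n := 1) (m := 1) (comp (tensor (gen eta) (id 1)) (gen mu)) (id 1)
  | comm : FrobRel G (n := 2) (m := 1) (comp swap (gen mu)) (gen mu)
  | phase_mul (g h : G) : FrobRel G (n := 1) (m := 1)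
      (comp (gen (phase g)) (gen (phase h))) (gen (phase (g * h)))
  | phase_one : FrobRel G (n := 1) (m := 1) (gen (phase 1)) (id 1)
  | coassoc : FrobRel G (n := 1) (m := 3)
      (comp (gen delta) (tensor (gen delta) (id 1))) (comp (gen delta) (tensor (id 1) (gen delta)))
  | counit : FrobRel G (n := 1) (m := 1) (comp (gen delta) (tensor (gen epsilon) (id 1))) (id 1)
  | cocomm : FrobRel G (n := 1) (m := 2) (comp (gen delta) swap) (gen delta)
  | phase_mu (g h : G) : FrobRel G (n := 2) (m := 1)
      (comp (tensor (gen (phase g)) (gen (phase h))) (gen mu)) (comp (gen mu) (gen (phase (g * h))))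
  | phase_delta (g h : G) : FrobRel G (n := 1) (m := 2)
      (comp (gen delta) (tensor (gen (phase g)) (gen (phase h))))
      (comp (gen (phase (g * h))) (gen delta))
  | frob_left : FrobRel G (n := 2) (m := 2)
      (comp (tensor (gen delta) (id 1)) (tensor (id 1) (gen mu))) (comp (gen mu) (gen delta))
  | frob_right : FrobRel G (n := 2) (m := 2)
      (comp (tensor (id 1) (gen delta)) (tensor (gen mu) (id 1))) (comp (gen mu) (gen delta))
  | special : FrobRel G (n := 1) (m := 1) (comp (gen delta) (gen mu)) (id 1)

/-- The presentation of `FG`. -/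
def frobPresentation (G : Type u) [CommGroup G] : PropPresentation.{u} := ⟨FrobGen G, FrobRel G⟩

/-- The presented PROP `FG`. -/
def FrobPROP (G : Type u) [CommGroup G] : PROP.{u} := (frobPresentation G).prop

namespace FrobPROP

variable (G : Type u) [CommGroup G]

/-- The inclusion of `M` in `FG`. -/
def inclM : CMonPROP.{u} ⟶ FrobPROP G :=
  PropPresentation.lift (pres := cmonPresentation) (FrobPROP G)
    (fun {_ _} x => match x with
      | .mu => (frobPresentation G).of FrobGen.mu
      | .eta => (frobPresentation G).of FrobGen.eta)
    (by
      intro n m s t h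
      cases h with
      | assoc => exact PropPresentation.toHom_eq (pres := frobPresentation G) FrobRel.assoc
      | unit => exact PropPresentation.toHom_eq (pres := frobPresentation G) FrobRel.unit
      | comm => exact PropPresentation.toHom_eq (pres := frobPresentation G) FrobRel.comm)

/-- The inclusion of `PG` in `FG`. -/
def inclP : PhasePROP G ⟶ FrobPROP G :=
  PropPresentation.lift (pres := phasePresentation G) (FrobPROP G)
    (fun {_ _} x => match x with
      | .phase g => (frobPresentation G).of (FrobGen.phase g))
    (by
      intro n m s t h
      cases h with
      | phase_mul g h =>
        exact PropPresentation.toHom_eq (pres := frobPresentation G) (FrobRel.phase_mul g h)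
      | phase_one => exact PropPresentation.toHom_eq (pres := frobPresentation G) FrobRel.phase_one)

theorem swap_symm : (finAddFlip (m := 1) (n := 1)).symm = finAddFlip (m := 1) (n := 1) := by
  ext i; simp [finAddFlip]

/-- The inclusion of `C` in `FG`. -/
def inclC : CComonPROP.{u} ⟶ FrobPROP G :=
  PROP.unop (PropPresentation.lift (pres := cmonPresentation) (FrobPROP G).op
    (fun {_ _} x => match x with
      | .mu => (frobPresentation G).of FrobGen.delta
      | .eta => (frobPresentation G).of FrobGen.epsilon)
    (by
      intro n m s t h
      cases h with
      | assoc => exact PropPresentation.toHom_eq (pres := frobPresentation G) FrobRel.coassoc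
      | unit => exact PropPresentation.toHom_eq (pres := frobPresentation G) FrobRel.counit
      | comm =>
        have h := PropPresentation.toHom_eq (pres := frobPresentation G) FrobRel.cocomm
        simp only [PropTerm.swap] at h
        rw [← swap_symm] at h
        exact h))

/-- The dagger of `FG`, as a morphism to the opposite PROP: it exchanges the monoid and the comonoid
and inverts the phases. -/
def dagger : FrobPROP G ⟶ (FrobPROP G).op :=
  PropPresentation.lift (pres := frobPresentation G) (FrobPROP G).op
    (fun {_ _} x => match x with
      | .mu => (frobPresentation G).of FrobGen.delta
      | .eta => (frobPresentation G).of FrobGen.epsilon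
      | .phase g => (frobPresentation G).of (FrobGen.phase g⁻¹)
      | .delta => (frobPresentation G).of FrobGen.mu
      | .epsilon => (frobPresentation G).of FrobGen.eta)
    (by
      have key : ∀ {n m : ℕ} {s t : PropTerm (FrobGen G) n m}, FrobRel G s t →
          (frobPresentation G).toHom s = (frobPresentation G).toHom t :=
        fun h => PropPresentation.toHom_eq (pres := frobPresentation G) h
      intro n m s t h
      cases h with
      | assoc => exact key FrobRel.coassoc
      | unit => exact key FrobRel.counit
      | comm =>
        have h := key FrobRel.cocomm
        simp only [PropTerm.swap] at h
        rw [← swap_symm] at h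
        exact h
      | phase_mul g h =>
        simp only [PropTerm.eval, mul_inv_rev]
        exact key (FrobRel.phase_mul h⁻¹ g⁻¹)
      | phase_one =>
        simp only [PropTerm.eval, inv_one]
        exact key FrobRel.phase_one
      | coassoc => exact key FrobRel.assoc
      | counit => exact key FrobRel.unit
      | cocomm =>
        have h := key FrobRel.comm
        simp only [PropTerm.swap] at h
        rw [← swap_symm] at h
        exact h
      | phase_mu g h =>
        simp only [PropTerm.eval, mul_inv]
        exact key (FrobRel.phase_delta g⁻¹ h⁻¹)
      | phase_delta g h =>
        simp only [PropTerm.eval, mul_inv]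
        exact key (FrobRel.phase_mu g⁻¹ h⁻¹)
      | frob_left => exact key FrobRel.frob_right
      | frob_right => exact key FrobRel.frob_left
      | special => exact key FrobRel.special)

theorem dagger_dagger {n m : ℕ} (f : (FrobPROP G).Hom n m) :
    PROP.map (dagger G) (n := m) (m := n) (PROP.map (dagger G) f) = f := by
  have h : PROP.bothWays (dagger G) (dagger G) = 𝟙 (FrobPROP G) := by
    refine PropPresentation.hom_ext (pres := frobPresentation G) (fun n m x => ?_)
    cases x with
    | phase g =>
      show (frobPresentation G).of (FrobGen.phase (g⁻¹)⁻¹) = _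
      rw [inv_inv]; rfl
    | _ => rfl
  exact congrArg (fun F : FrobPROP G ⟶ FrobPROP G => PROP.map F f) h

/-- `FG` as a dagger PROP: `μ† = δ`, `η† = ε` and `g† = g⁻¹`. -/
def dagPROP : DagPROP.{u} where
  toPROP := FrobPROP G
  dag f := PROP.map (dagger G) f
  dag_dag f := dagger_dagger G f
  dag_perm σ := PROP.PropHom.map_perm (dagger G) σ
  dag_comp f g := PROP.PropHom.map_comp (dagger G) f g
  dag_tensor f g := PROP.PropHom.map_tensor (dagger G) f g

variable {G}

/-- The action of a homomorphism of groups on the PROPs `FG`: it relabels the phases. -/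
def map {H : Type u} [CommGroup H] (φ : G →* H) : FrobPROP G ⟶ FrobPROP H :=
  PropPresentation.lift (pres := frobPresentation G) (FrobPROP H)
    (fun {_ _} x => match x with
      | .mu => (frobPresentation H).of FrobGen.mu
      | .eta => (frobPresentation H).of FrobGen.eta
      | .phase g => (frobPresentation H).of (FrobGen.phase (φ g))
      | .delta => (frobPresentation H).of FrobGen.delta
      | .epsilon => (frobPresentation H).of FrobGen.epsilon)
    (by
      have key : ∀ {n m : ℕ} {s t : PropTerm (FrobGen H) n m}, FrobRel H s t →
          (frobPresentation H).toHom s = (frobPresentation H).toHom t :=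
        fun h => PropPresentation.toHom_eq (pres := frobPresentation H) h
      intro n m s t h
      cases h with
      | assoc => exact key FrobRel.assoc
      | unit => exact key FrobRel.unit
      | comm => exact key FrobRel.comm
      | phase_mul g h =>
        simp only [PropTerm.eval, map_mul]
        exact key (FrobRel.phase_mul _ _)
      | phase_one =>
        simp only [PropTerm.eval, map_one]
        exact key FrobRel.phase_one
      | coassoc => exact key FrobRel.coassoc
      | counit => exact key FrobRel.counit
      | cocomm => exact key FrobRel.cocomm
      | phase_mu g h =>
        simp only [PropTerm.eval, map_mul]
        exact key (FrobRel.phase_mu _ _)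
      | phase_delta g h =>
        simp only [PropTerm.eval, map_mul]
        exact key (FrobRel.phase_delta _ _)
      | frob_left => exact key FrobRel.frob_left
      | frob_right => exact key FrobRel.frob_right
      | special => exact key FrobRel.special)

/-- The relabelling of phases is a morphism of dagger PROPs. -/
def dagMap {H : Type u} [CommGroup H] (φ : G →* H) : dagPROP G ⟶ dagPROP H where
  hom := map φ
  map_dag f := by
    have h : dagger G ≫ PROP.opMap (map φ) = map φ ≫ dagger H := by
      refine PropPresentation.hom_ext (pres := frobPresentation G) (fun n m x => ?_)
      cases x with
      | phase g =>
        show (frobPresentation H).of (FrobGen.phase (φ g⁻¹)) =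
          (frobPresentation H).of (FrobGen.phase (φ g)⁻¹)
        rw [map_inv]
      | _ => rfl
    exact congrArg (fun F : FrobPROP G ⟶ (FrobPROP H).op => PROP.map F f) h

end FrobPROP

/-- The functor `F` from abelian groups to dagger PROPs. -/
def frobFunctor : CommGrpCat.{u} ⥤ DagPROP.{u} where
  obj G := FrobPROP.dagPROP G
  map φ := FrobPROP.dagMap φ.hom
  map_id G := by
    apply DagPROP.DagHom.ext
    refine PropPresentation.hom_ext (pres := frobPresentation G) (fun n m x => ?_)
    cases x <;> rfl
  map_comp {G _ _} φ ψ := by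
    apply DagPROP.DagHom.ext
    refine PropPresentation.hom_ext (pres := frobPresentation G) (fun n m x => ?_)
    cases x <;> rfl

/-! ## Distributive series of monads -/

section Series

universe v w

variable {𝒱 : Type w} [Category.{v} 𝒱] [MonoidalCategory 𝒱]

/-- Beck's axioms for a distributive law `T ; S ⟶ S ; T` between monads. -/
structure IsDistributiveLaw (T S : 𝒱) [MonObj T] [MonObj S] (l : T ⊗ S ⟶ S ⊗ T) : Prop where
  unit_left : η[T] ▷ S ≫ l = (λ_ S).hom ≫ (ρ_ S).inv ≫ S ◁ η[T]
  unit_right : T ◁ η[S] ≫ l = (ρ_ T).hom ≫ (λ_ T).inv ≫ η[S] ▷ T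
  mul_left : μ[T] ▷ S ≫ l =
    (α_ T T S).hom ≫ T ◁ l ≫ (α_ T S T).inv ≫ l ▷ T ≫ (α_ S T T).hom ≫ S ◁ μ[T]
  mul_right : T ◁ μ[S] ≫ l =
    (α_ T S S).inv ≫ l ▷ S ≫ (α_ S T S).hom ≫ S ◁ l ≫ (α_ S S T).inv ≫ μ[S] ▷ T

/-- The Yang-Baxter diagram for three objects: the two ways of reversing `C ; B ; A`. -/
def YangBaxter (A B C : 𝒱) (ba : B ⊗ A ⟶ A ⊗ B) (ca : C ⊗ A ⟶ A ⊗ C) (cb : C ⊗ B ⟶ B ⊗ C) :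
    Prop :=
  cb ▷ A ≫ (α_ B C A).hom ≫ B ◁ ca ≫ (α_ B A C).inv ≫ ba ▷ C ≫ (α_ A B C).hom =
    (α_ C B A).hom ≫ C ◁ ba ≫ (α_ C A B).inv ≫ ca ▷ B ≫ (α_ A C B).hom ≫ A ◁ cb

/-- A distributive series of three monads `A`, `B`, `C`. -/
structure IsDistributiveSeries (A B C : 𝒱) [MonObj A] [MonObj B] [MonObj C]
    (ba : B ⊗ A ⟶ A ⊗ B) (ca : C ⊗ A ⟶ A ⊗ C) (cb : C ⊗ B ⟶ B ⊗ C) : Prop where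
  law_ba : IsDistributiveLaw B A ba
  law_ca : IsDistributiveLaw C A ca
  law_cb : IsDistributiveLaw C B cb
  yangBaxter : YangBaxter A B C ba ca cb

/-- The unit of a composite `S ; T`. -/
def compositeUnit {S T : 𝒱} (uS : 𝟙_ 𝒱 ⟶ S) (uT : 𝟙_ 𝒱 ⟶ T) : 𝟙_ 𝒱 ⟶ S ⊗ T :=
  (λ_ (𝟙_ 𝒱)).inv ≫ (uS ⊗ₘ uT)

/-- The multiplication `S ; T ; S ; T ⟶ S ; S ; T ; T ⟶ S ; T` given by `l : T ; S ⟶ S ; T`. -/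
def compositeMul {S T : 𝒱} (mS : S ⊗ S ⟶ S) (mT : T ⊗ T ⟶ T) (l : T ⊗ S ⟶ S ⊗ T) :
    (S ⊗ T) ⊗ (S ⊗ T) ⟶ S ⊗ T :=
  (α_ S T (S ⊗ T)).hom ≫ S ◁ ((α_ T S T).inv ≫ l ▷ T ≫ (α_ S T T).hom) ≫
    (α_ S S (T ⊗ T)).inv ≫ (mS ⊗ₘ mT)

/-- The law `(B ; C) ; A ⟶ A ; (B ; C)` built from `B ; A ⟶ A ; B` and `C ; A ⟶ A ; C`. -/
def iteratedLaw {A B C : 𝒱} (ba : B ⊗ A ⟶ A ⊗ B) (ca : C ⊗ A ⟶ A ⊗ C) :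
    (B ⊗ C) ⊗ A ⟶ A ⊗ (B ⊗ C) :=
  (α_ B C A).hom ≫ B ◁ ca ≫ (α_ B A C).inv ≫ ba ▷ C ≫ (α_ A B C).hom

/-- The unit of the composite `A ; (B ; C)`. -/
def seriesUnit (A B C : 𝒱) [MonObj A] [MonObj B] [MonObj C] : 𝟙_ 𝒱 ⟶ A ⊗ (B ⊗ C) :=
  compositeUnit η[A] (compositeUnit η[B] η[C])

/-- The multiplication of the composite `A ; (B ; C)` of three monads given by laws between them. -/
def seriesMul {A B C : 𝒱} [MonObj A] [MonObj B] [MonObj C]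
    (ba : B ⊗ A ⟶ A ⊗ B) (ca : C ⊗ A ⟶ A ⊗ C) (cb : C ⊗ B ⟶ B ⊗ C) :
    (A ⊗ (B ⊗ C)) ⊗ (A ⊗ (B ⊗ C)) ⟶ A ⊗ (B ⊗ C) :=
  compositeMul μ[A] (compositeMul μ[B] μ[C] cb) (iteratedLaw ba ca)

end Series

/-! ## The equations that specify the laws `σ`, `ρ` and `λ_F` -/

/-- Equation (P1), as a rule `(g ⊗ h, μ) ↦ (μ, gh)`. -/
def SatisfiesP1 (G : Type u) [CommGroup G]
    (s : (PhasePROP G).bimod ⊗ CMonPROP.{u}.bimod ⟶ CMonPROP.{u}.bimod ⊗ (PhasePROP G).bimod) :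
    Prop :=
  ∀ g h : G,
    PermBimod.app s (PermBimod.pair (X := (PhasePROP G).bimod) (Y := CMonPROP.{u}.bimod) (m := 1)
        ((PhasePROP G).tensor (PhasePROP.phase g) (PhasePROP.phase h)) CMonPROP.mu) =
      PermBimod.pair (X := CMonPROP.{u}.bimod) (Y := (PhasePROP G).bimod) (n := 2)
        CMonPROP.mu (PhasePROP.phase (g * h))

/-- Equation (P2), as a rule `(δ, g ⊗ h) ↦ (gh, δ)`. -/
def SatisfiesP2 (G : Type u) [CommGroup G]
    (r : CComonPROP.{u}.bimod ⊗ (PhasePROP G).bimod ⟶ (PhasePROP G).bimod ⊗ CComonPROP.{u}.bimod) :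
    Prop :=
  ∀ g h : G,
    PermBimod.app r (PermBimod.pair (X := CComonPROP.{u}.bimod) (Y := (PhasePROP G).bimod) (n := 1)
        CComonPROP.delta ((PhasePROP G).tensor (PhasePROP.phase g) (PhasePROP.phase h))) =
      PermBimod.pair (X := (PhasePROP G).bimod) (Y := CComonPROP.{u}.bimod) (m := 2)
        (PhasePROP.phase (g * h)) CComonPROP.delta

/-- Equations (F), as rules `(δ ⊗ 1, 1 ⊗ μ) ↦ (μ, δ)`, `(1 ⊗ δ, μ ⊗ 1) ↦ (μ, δ)` and
`(δ, μ) ↦ (1, 1)`. -/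
structure SatisfiesF
    (l : CComonPROP.{u}.bimod ⊗ CMonPROP.{u}.bimod ⟶ CMonPROP.{u}.bimod ⊗ CComonPROP.{u}.bimod) :
    Prop where
  frob_left :
    PermBimod.app l (PermBimod.pair (X := CComonPROP.{u}.bimod) (Y := CMonPROP.{u}.bimod)
        (n := 2) (k := 3) (m := 2)
        (CComonPROP.tensor CComonPROP.delta (CComonPROP.id 1))
        (CMonPROP.tensor (CMonPROP.id 1) CMonPROP.mu)) =
      PermBimod.pair (X := CMonPROP.{u}.bimod) (Y := CComonPROP.{u}.bimod)
        CMonPROP.mu CComonPROP.delta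
  frob_right :
    PermBimod.app l (PermBimod.pair (X := CComonPROP.{u}.bimod) (Y := CMonPROP.{u}.bimod)
        (n := 2) (k := 3) (m := 2)
        (CComonPROP.tensor (CComonPROP.id 1) CComonPROP.delta)
        (CMonPROP.tensor CMonPROP.mu (CMonPROP.id 1))) =
      PermBimod.pair (X := CMonPROP.{u}.bimod) (Y := CComonPROP.{u}.bimod)
        CMonPROP.mu CComonPROP.delta
  special :
    PermBimod.app l (PermBimod.pair (X := CComonPROP.{u}.bimod) (Y := CMonPROP.{u}.bimod)
        (n := 1) (m := 1) CComonPROP.delta CMonPROP.mu) =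
      PermBimod.pair (X := CMonPROP.{u}.bimod) (Y := CComonPROP.{u}.bimod)
        (CMonPROP.id 1) (CComonPROP.id 1)

/-- The canonical map `M ; PG ; C ⟶ FG` that composes the images in `FG` of a morphism of `M`, a
morphism of `PG` and a morphism of `C`. -/
def canonicalMap (G : Type u) [CommGroup G] :
    CMonPROP.{u}.bimod ⊗ ((PhasePROP G).bimod ⊗ CComonPROP.{u}.bimod) ⟶ (FrobPROP G).bimod :=
  (PROP.bimodMap (FrobPROP.inclM G) ⊗ₘ
      (PROP.bimodMap (FrobPROP.inclP G) ⊗ₘ PROP.bimodMap (FrobPROP.inclC G))) ≫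
    (FrobPROP G).bimod ◁ μ[(FrobPROP G).bimod] ≫ μ[(FrobPROP G).bimod]

/-!
The proof rests on a concrete model of `FG`: the PROP `LCospanPROP G` whose morphisms `n ⟶ m` are
isomorphism classes of cospans `Fin n → P ← Fin m` of finite sets with a label in `G` on each point
of the apex. Cospans compose by pushout, and labels are multiplied when points are identified. The
generators act as the cospans of the functions `2 → 1` and `0 → 1`, read in both directions, and as
labels on one point, so there is a morphism `FrobPROP.toLCospan` from `FG` to this model.

The three building blocks are computed first. A morphism of `M` is the same as a function between
finite ordinals (`CMonPROP.ofFun_toFun`, `CMonPROP.toFun_ofFun`), a morphism of `C` is a function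
backwards, and a morphism of `PG` is a permutation followed by a vector of phases
(`PhasePROP.exists_eq_perm_comp_diag`). Hence a class of composable triples in `M ; PG ; C` is a
function, a vector of labels and a function backwards, up to a permutation of the middle, and this is
exactly a labelled cospan. So the canonical map `M ; PG ; C ⟶ FG` is injective
(`FrobPROP.app_canonicalMap_injective`), already after composition with `FrobPROP.toLCospan`.

The same model yields the laws. If pairs in `S ; T` embed into a PROP and the products of `T` and `S`
in it decompose as such pairs, then rewriting is a distributive law (`PROP.exists_isDistributiveLaw`).

What is forced by the equations is treated uniformly: `PROP.LawStable` collects the closure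
properties shared by the relations "two given laws agree on this pair" and "the law is valid on this
pair in a PROP that receives both factors". Such a relation holds everywhere as soon as it holds for
the pairs in (F), (P1) or (P2) respectively (`PROP.LawStable.comonoid_monoid`,
`PROP.LawStable.phase_monoid`, `PROP.LawStable.comonoid_phase`). The first instance is uniqueness of
the laws; the second says that the laws hold in `FG`. From the latter the canonical map is
multiplicative, so its image is a sub-PROP that contains the generators, and it is bijective. Both
sides of the Yang-Baxter equation have the same composite in `FG`, so they agree by injectivity, and
the monoid axioms are transported along the isomorphism in the same way.
-/

/-! ### Permutations of finite ordinals -/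

theorem finAddFlip_symm (a b : ℕ) :
    (finAddFlip : Fin (a + b) ≃ Fin (b + a)).symm = finAddFlip := by
  ext i; simp [finAddFlip]

/-- A permutation that fixes every point of the last block is a block sum. -/
theorem exists_eq_blockSum_refl {a a' c : ℕ} (σ : Fin (a + c) ≃ Fin (a' + c))
    (h : ∀ i : Fin c, σ (Fin.natAdd a i) = Fin.natAdd a' i) :
    ∃ τ : Fin a ≃ Fin a', σ = blockSum τ (Equiv.refl (Fin c)) := by
  have h' : ∀ i : Fin c, σ.symm (Fin.natAdd a' i) = Fin.natAdd a i := fun i => by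
    rw [← h i, Equiv.symm_apply_apply]
  have key : ∀ {x y : ℕ} (ρ : Fin (x + c) ≃ Fin (y + c))
      (_ : ∀ i : Fin c, ρ.symm (Fin.natAdd y i) = Fin.natAdd x i) (i : Fin x),
      ∃ j : Fin y, ρ (Fin.castAdd c i) = Fin.castAdd c j := by
    intro x y ρ hρ i
    generalize hj : ρ (Fin.castAdd c i) = w
    induction w using Fin.addCases with
    | left j => exact ⟨j, rfl⟩
    | right j =>
      exfalso
      have := hρ j
      rw [← hj, Equiv.symm_apply_apply] at this
      have := congrArg Fin.val this
      simp at this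
      omega
  choose f hf using key σ h'
  choose g hg using key σ.symm (by simpa using h)
  have inj : ∀ (x : ℕ), Function.Injective (Fin.castAdd (n := x) c) := fun x =>
    Fin.castAdd_injective x c
  refine ⟨⟨f, g, fun i => inj _ ?_, fun i => inj _ ?_⟩, ?_⟩
  · rw [← hg, ← hf, Equiv.symm_apply_apply]
  · rw [← hf, ← hg, Equiv.apply_symm_apply]
  · ext i
    refine Fin.addCases (fun i => ?_) (fun i => ?_) i
    · simp [hf]
    · simp [h]

/-- Every permutation is built from the transpositions of the last two points and from
permutations that fix the last point. -/
theorem perm_blockSum_induction {P : ∀ {m : ℕ}, (Fin m ≃ Fin m) → Prop}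
    (refl : ∀ m, P (Equiv.refl (Fin m)))
    (trans : ∀ {m : ℕ} (σ τ : Fin m ≃ Fin m), P σ → P τ → P (σ.trans τ))
    (block : ∀ {m : ℕ} (σ : Fin m ≃ Fin m), P σ → P (blockSum σ (Equiv.refl (Fin 1))))
    (flip : ∀ k : ℕ, P (m := k + 2)
      (blockSum (Equiv.refl (Fin k)) (finAddFlip : Fin (1 + 1) ≃ Fin (1 + 1))))
    {m : ℕ} (σ : Fin m ≃ Fin m) : P σ := by
  have swapP : ∀ (n : ℕ) (i : Fin n), P (Equiv.swap i.castSucc i.succ) := by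
    intro n
    induction n with
    | zero => exact fun i => i.elim0
    | succ n ih =>
      intro i
      induction i using Fin.lastCases with
      | last =>
        have h : Equiv.swap (Fin.last n).castSucc (Fin.last n).succ =
            blockSum (Equiv.refl (Fin n)) (finAddFlip : Fin (1 + 1) ≃ Fin (1 + 1)) := by
          ext i
          refine Fin.addCases (m := n) (n := 1 + 1) (fun i => ?_) (fun i => ?_) i
          · rw [Equiv.swap_apply_of_ne_of_ne, blockSum_castAdd]
            · rfl
            · intro h; have := congrArg Fin.val h; simp at this; omega
            · intro h; have := congrArg Fin.val h; simp at this; omega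
          · rw [blockSum_natAdd]
            fin_cases i
            · exact congrArg Fin.val (Equiv.swap_apply_left (Fin.last n).castSucc (Fin.last n).succ)
            · exact congrArg Fin.val
                (Equiv.swap_apply_right (Fin.last n).castSucc (Fin.last n).succ)
        rw [h]
        exact flip n
      | cast i =>
        have h : Equiv.swap i.castSucc.castSucc i.castSucc.succ =
            blockSum (Equiv.swap i.castSucc i.succ) (Equiv.refl (Fin 1)) := by
          ext k
          refine Fin.addCases (fun k => ?_) (fun k => ?_) k
          · rw [blockSum_castAdd]
            simp only [Equiv.swap_apply_def, Fin.ext_iff, Fin.val_castAdd, Fin.val_castSucc,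
              Fin.val_succ]
            split_ifs <;> simp
          · rw [blockSum_natAdd, Equiv.swap_apply_of_ne_of_ne]
            · rfl
            · intro h; have := congrArg Fin.val h; simp at this; omega
            · intro h; have := congrArg Fin.val h; simp at this; omega
        rw [h]
        exact block _ (ih i)
  cases m with
  | zero => rw [Subsingleton.elim σ (Equiv.refl _)]; exact refl 0
  | succ n =>
    have hσ : σ ∈ Submonoid.closure
        (Set.range fun i : Fin n => Equiv.swap i.castSucc i.succ) := by
      rw [Equiv.Perm.mclosure_swap_castSucc_succ]; trivial
    refine Submonoid.closure_induction (motive := fun σ _ => P (m := n + 1) σ) ?_ (refl _) ?_ hσ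
    · rintro _ ⟨i, rfl⟩
      exact swapP n i
    · intro σ τ _ _ h h'
      exact trans τ σ h' h

/-- An injection into a finite ordinal is, up to a bijection, the inclusion of a last block. -/
theorem exists_equiv_natAdd {a m : ℕ} (f : Fin a → Fin m) (hf : Function.Injective f) :
    ∃ (p : ℕ) (ρ : Fin (p + a) ≃ Fin m), ∀ i, ρ (Fin.natAdd p i) = f i := by
  classical
  let s : Set (Fin m) := Set.range f
  let e : Fin (Fintype.card (sᶜ : Set (Fin m))) ≃ (sᶜ : Set (Fin m)) :=
    (Fintype.equivFin _).symm
  refine ⟨_, finSumFinEquiv.symm.trans ((e.sumCongr (Equiv.ofInjective f hf)).trans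
    ((Equiv.sumComm _ _).trans (Equiv.Set.sumCompl s))), fun i => ?_⟩
  simp [s]

/-! ### Calculus in a PROP -/

namespace PROP

variable (T : PROP.{u})

@[simp] theorem id_comp' {a b : ℕ} (f : T.Hom a b) : T.comp (T.id a) f = f := T.id_comp f

@[simp] theorem comp_id' {a b : ℕ} (f : T.Hom a b) : T.comp f (T.id b) = f := T.comp_id f

theorem perm_comp_perm {a b c : ℕ} (σ : Fin a ≃ Fin b) (τ : Fin b ≃ Fin c) :
    T.comp (T.perm σ) (T.perm τ) = T.perm (σ.trans τ) := (T.perm_trans σ τ).symm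

theorem perm_comp_perm_comp {a b c d : ℕ} (σ : Fin a ≃ Fin b) (τ : Fin b ≃ Fin c)
    (f : T.Hom c d) : T.comp (T.perm σ) (T.comp (T.perm τ) f) = T.comp (T.perm (σ.trans τ)) f := by
  rw [← T.comp_assoc, perm_comp_perm]

@[simp] theorem id_tensor_id (a b : ℕ) : T.tensor (T.id a) (T.id b) = T.id (a + b) := by
  rw [id, id, ← T.perm_blockSum, blockSum_refl, id]

theorem id_tensor_comp (n : ℕ) {a b c : ℕ} (f : T.Hom a b) (g : T.Hom b c) :
    T.tensor (T.id n) (T.comp f g) = T.comp (T.tensor (T.id n) f) (T.tensor (T.id n) g) := by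
  rw [← T.comp_tensor_comp, id_comp']

theorem comp_tensor_id (n : ℕ) {a b c : ℕ} (f : T.Hom a b) (g : T.Hom b c) :
    T.tensor (T.comp f g) (T.id n) = T.comp (T.tensor f (T.id n)) (T.tensor g (T.id n)) := by
  rw [← T.comp_tensor_comp, id_comp']

theorem tensor_id_comp_id_tensor {a b c d : ℕ} (f : T.Hom a b) (g : T.Hom c d) :
    T.comp (T.tensor f (T.id c)) (T.tensor (T.id b) g) = T.tensor f g := by
  rw [← T.comp_tensor_comp, id_comp', comp_id']

theorem id_tensor_comp_tensor_id {a b c d : ℕ} (f : T.Hom a b) (g : T.Hom c d) :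
    T.comp (T.tensor (T.id a) g) (T.tensor f (T.id d)) = T.tensor f g := by
  rw [← T.comp_tensor_comp, id_comp', comp_id']

theorem tensor_eq {a b c d : ℕ} (f : T.Hom a b) (g : T.Hom c d) :
    T.tensor f g = T.comp (T.perm finAddFlip) (T.comp (T.tensor g f) (T.perm finAddFlip)) := by
  rw [T.swap_natural, perm_comp_perm_comp, ← finAddFlip_symm c a, Equiv.symm_trans_self, T.id_comp]

theorem tensor_tensor {a b c d e i : ℕ} (f : T.Hom a b) (g : T.Hom c d) (h : T.Hom e i) :
    T.tensor f (T.tensor g h) = T.comp (T.perm (finCongr (Nat.add_assoc a c e)).symm)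
      (T.comp (T.tensor (T.tensor f g) h) (T.perm (finCongr (Nat.add_assoc b d i)))) := by
  rw [T.tensor_assoc, perm_comp_perm_comp, Equiv.symm_trans_self, T.id_comp]

variable {T}

@[simp] theorem map_id {S : PROP.{u}} (F : T ⟶ S) (n : ℕ) : map F (T.id n) = S.id n :=
  PropHom.map_perm F _

theorem map_perm {S : PROP.{u}} (F : T ⟶ S) {n m : ℕ} (σ : Fin n ≃ Fin m) :
    map F (T.perm σ) = S.perm σ := PropHom.map_perm F σ

theorem map_comp {S : PROP.{u}} (F : T ⟶ S) {n m k : ℕ} (f : T.Hom n m) (g : T.Hom m k) :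
    map F (T.comp f g) = S.comp (map F f) (map F g) := PropHom.map_comp F f g

theorem map_tensor {S : PROP.{u}} (F : T ⟶ S) {a b c d : ℕ} (f : T.Hom a b) (g : T.Hom c d) :
    map F (T.tensor f g) = S.tensor (map F f) (map F g) := PropHom.map_tensor F f g

end PROP

/-- Every morphism of a presented PROP is a composite of permutations and of generators placed
to the right of identities. -/
theorem PropPresentation.layer_induction (pres : PropPresentation.{u})
    {P : ∀ {n m : ℕ}, pres.prop.Hom n m → Prop}
    (perm : ∀ {n m : ℕ} (σ : Fin n ≃ Fin m), P (pres.prop.perm σ))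
    (gen : ∀ (b : ℕ) {n m : ℕ} (x : pres.Gen n m), P (pres.prop.tensor (pres.prop.id b) (pres.of x)))
    (comp : ∀ {n m k : ℕ} (f : pres.prop.Hom n m) (g : pres.prop.Hom m k),
      P f → P g → P (pres.prop.comp f g))
    {n m : ℕ} (f : pres.prop.Hom n m) : P f := by
  let T := pres.prop
  -- The statement is proved for `id b ⊗ f`, which is stable under all the term formers.
  suffices H : ∀ (b : ℕ), P (T.tensor (T.id b) f) by
    have h := H 0
    have e : f = T.comp (T.perm (finCongr (Nat.zero_add n)).symm)
        (T.comp (T.tensor (T.id 0) f) (T.perm (finCongr (Nat.zero_add m)))) := by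
      rw [PROP.id, T.id_tensor, T.perm_comp_perm_comp, Equiv.symm_trans_self, T.id_comp]
    rw [e]
    exact comp _ _ (perm _) (comp _ _ h (perm _))
  induction f using Quotient.ind with | _ t => ?_
  induction t with
  | gen x => exact fun b => gen b x
  | perm σ =>
    intro b
    have h : T.tensor (T.id b) (T.perm σ) = T.perm (blockSum (Equiv.refl _) σ) :=
      (T.perm_blockSum _ _).symm
    exact h ▸ perm _
  | comp s t ih ih' =>
    intro b
    have h := T.id_tensor_comp b (pres.toHom s) (pres.toHom t)
    exact h ▸ comp _ _ (ih b) (ih' b)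
  | @tensor a a' c c' s t ih ih' =>
    intro b
    have key : ∀ {x y : ℕ} (f : T.Hom x y) (z : ℕ), (∀ b, P (T.tensor (T.id b) f)) →
        P (T.tensor (T.id b) (T.tensor (T.id z) f)) := by
      intro x y f z hf
      rw [T.tensor_tensor, T.id_tensor_id]
      exact comp _ _ (perm _) (comp _ _ (hf _) (perm _))
    have perm' : ∀ {x y : ℕ} (σ : Fin x ≃ Fin y), P (T.tensor (T.id b) (T.perm σ)) := by
      intro x y σ
      have h : T.tensor (T.id b) (T.perm σ) = T.perm (blockSum (Equiv.refl _) σ) :=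
        (T.perm_blockSum _ _).symm
      exact h ▸ perm _
    change P (T.tensor (T.id b) (T.tensor (pres.toHom s) (pres.toHom t)))
    rw [← T.tensor_id_comp_id_tensor (pres.toHom s), T.tensor_eq (pres.toHom s), T.id_tensor_comp,
      T.id_tensor_comp, T.id_tensor_comp]
    exact comp _ _ (comp _ _ (perm' _) (comp _ _ (key _ _ ih) (perm' _))) (key _ _ ih')

namespace PROP

variable (T : PROP.{u})

/-- Associativity of the tensor product without a permutation: if the last factor is `1 ⟶ 1`, then
both sides have definitionally the same source and target. -/
theorem tensor_tensor_one {a b c d : ℕ} (f : T.Hom a b) (g : T.Hom c d) (h : T.Hom 1 1) :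
    T.tensor (T.tensor f g) h = T.tensor f (T.tensor g h) :=
  (T.comp_id _).symm.trans ((T.tensor_assoc f g h).trans (T.id_comp _))

theorem perm_tensor_id {a b c : ℕ} (σ : Fin a ≃ Fin b) :
    T.tensor (T.perm σ) (T.id c) = T.perm (blockSum σ (Equiv.refl _)) := (T.perm_blockSum _ _).symm

theorem id_tensor_perm {a b c : ℕ} (σ : Fin a ≃ Fin b) :
    T.tensor (T.id c) (T.perm σ) = T.perm (blockSum (Equiv.refl _) σ) := (T.perm_blockSum _ _).symm

theorem perm_trans_symm_comp {a b c d : ℕ} (σ : Fin a ≃ Fin b) (τ : Fin c ≃ Fin b)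
    (f : T.Hom b d) :
    T.comp (T.perm (σ.trans τ.symm)) (T.comp (T.perm τ) f) = T.comp (T.perm σ) f := by
  rw [perm_comp_perm_comp, Equiv.trans_assoc, Equiv.symm_trans_self, Equiv.trans_refl]

/-- A morphism in the last block commutes with permutations of the other wires. -/
theorem id_tensor_comp_perm {a a' n m : ℕ} (τ : Fin a ≃ Fin a') (x : T.Hom n m) :
    T.comp (T.tensor (T.id a) x) (T.perm (blockSum τ (Equiv.refl _))) =
      T.comp (T.perm (blockSum τ (Equiv.refl _))) (T.tensor (T.id a') x) := by
  rw [← perm_tensor_id, ← perm_tensor_id, id_tensor_comp_tensor_id, tensor_id_comp_id_tensor]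

end PROP

theorem blockSum_blockSum_one {a b : ℕ} (τ : Fin a ≃ Fin b) (c : ℕ) :
    blockSum (blockSum τ (Equiv.refl (Fin c))) (Equiv.refl (Fin 1)) =
      blockSum τ (Equiv.refl (Fin (c + 1))) := by
  have h := blockSum_assoc τ (Equiv.refl (Fin c)) (Equiv.refl (Fin 1))
  rw [blockSum_refl] at h
  exact h

/-! ### Functions between finite ordinals as a PROP -/

/-- The block sum of two functions. -/
def funSum {a b c d : ℕ} (f : Fin a → Fin b) (g : Fin c → Fin d) : Fin (a + c) → Fin (b + d) :=
  finSumFinEquiv ∘ Sum.map f g ∘ finSumFinEquiv.symm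

@[simp] theorem funSum_castAdd {a b c d : ℕ} (f : Fin a → Fin b) (g : Fin c → Fin d) (i : Fin a) :
    funSum f g (Fin.castAdd c i) = Fin.castAdd d (f i) := by simp [funSum]

@[simp] theorem funSum_natAdd {a b c d : ℕ} (f : Fin a → Fin b) (g : Fin c → Fin d) (i : Fin c) :
    funSum f g (Fin.natAdd a i) = Fin.natAdd b (g i) := by simp [funSum]

theorem funSum_comp {a b c a' b' c' : ℕ} (f : Fin a → Fin b) (g : Fin b → Fin c)
    (f' : Fin a' → Fin b') (g' : Fin b' → Fin c') :
    funSum (g ∘ f) (g' ∘ f') = funSum g g' ∘ funSum f f' := by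
  funext i
  refine Fin.addCases (fun i => ?_) (fun i => ?_) i <;> simp

/-- The PROP of functions between finite ordinals. -/
def FunPROP : PROP.{u} where
  Hom n m := ULift.{u} (Fin n → Fin m)
  perm σ := ⟨σ⟩
  comp f g := ⟨g.down ∘ f.down⟩
  tensor f g := ⟨funSum f.down g.down⟩
  comp_assoc _ _ _ := rfl
  id_comp _ := rfl
  comp_id _ := rfl
  perm_trans _ _ := rfl
  perm_blockSum _ _ := rfl
  comp_tensor_comp f g f' g' := congrArg ULift.up (funSum_comp f.down g.down f'.down g'.down)
  tensor_assoc {a b c d e i} f g h := by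
    refine congrArg ULift.up (funext fun k => ?_)
    induction k using Fin.addCases with
    | left k =>
      induction k using Fin.addCases with
      | left k =>
        have h : Fin.cast (Nat.add_assoc a c e) (Fin.castAdd e (Fin.castAdd c k)) =
          Fin.castAdd (c + e) k := by ext; simp
        ext; simp [h]
      | right k =>
        have h : Fin.cast (Nat.add_assoc a c e) (Fin.castAdd e (Fin.natAdd a k)) =
          Fin.natAdd a (Fin.castAdd e k) := by ext; simp
        ext; simp [h]
    | right k =>
      have h : Fin.cast (Nat.add_assoc a c e) (Fin.natAdd (a + c) k) =
        Fin.natAdd a (Fin.natAdd c k) := by ext; simp [Nat.add_assoc]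
      ext; simp [h, Nat.add_assoc]
  id_tensor {a b} f := by
    refine congrArg ULift.up (funext fun k => ?_)
    induction k using Fin.addCases with
    | left k => exact k.elim0
    | right k =>
      have h : Fin.cast (Nat.zero_add a) (Fin.natAdd 0 k) = k := by ext; simp
      change Fin.cast (Nat.zero_add b) (funSum _root_.id f.down (Fin.natAdd 0 k)) =
        f.down (Fin.cast (Nat.zero_add a) (Fin.natAdd 0 k))
      rw [h, funSum_natAdd]
      ext; simp
  tensor_id {a b} f := by
    refine congrArg ULift.up (funext fun k => ?_)
    exact funSum_castAdd (c := 0) (d := 0) f.down _ k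
  swap_natural {a b c d} f g := by
    refine congrArg ULift.up (funext fun k => ?_)
    induction k using Fin.addCases with
    | left k => simp
    | right k => simp

/-! ### `M` is the PROP of functions -/

namespace CMonPROP

/-- The interpretation of the PROP of commutative monoids by functions. -/
def toFunPROP : CMonPROP.{u} ⟶ FunPROP.{u} :=
  PropPresentation.lift (pres := cmonPresentation) FunPROP.{u}
    (fun {_ _} x => match x with
      | .mu => ⟨fun _ => 0⟩
      | .eta => ⟨Fin.elim0⟩)
    (by
      intro n m s t h
      cases h <;> exact congrArg ULift.up (funext fun _ => Subsingleton.elim _ _))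

/-- The function denoted by a morphism of the PROP of commutative monoids. -/
def toFun {n m : ℕ} (f : CMonPROP.{u}.Hom n m) : Fin n → Fin m := (PROP.map toFunPROP f).down

@[simp] theorem toFun_perm {n m : ℕ} (σ : Fin n ≃ Fin m) : toFun (CMonPROP.{u}.perm σ) = σ := rfl

@[simp] theorem toFun_id (n : ℕ) : toFun (CMonPROP.{u}.id n) = _root_.id := rfl

@[simp] theorem toFun_comp {n m k : ℕ} (f : CMonPROP.{u}.Hom n m) (g : CMonPROP.{u}.Hom m k) :
    toFun (CMonPROP.comp f g) = toFun g ∘ toFun f :=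
  congrArg ULift.down (PROP.map_comp toFunPROP f g)

@[simp] theorem toFun_tensor {a b c d : ℕ} (f : CMonPROP.{u}.Hom a b) (g : CMonPROP.{u}.Hom c d) :
    toFun (CMonPROP.tensor f g) = funSum (toFun f) (toFun g) :=
  congrArg ULift.down (PROP.map_tensor toFunPROP f g)

theorem assoc : CMonPROP.{u}.comp (CMonPROP.tensor mu (CMonPROP.id 1)) mu =
    CMonPROP.comp (CMonPROP.tensor (CMonPROP.id 1) mu) mu :=
  PropPresentation.toHom_eq (pres := cmonPresentation) CMonRel.assoc

theorem eta_tensor_mu :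
    CMonPROP.{u}.comp (n := 1) (CMonPROP.tensor eta (CMonPROP.id 1)) mu = CMonPROP.id 1 :=
  PropPresentation.toHom_eq (pres := cmonPresentation) CMonRel.unit

theorem swap_mu : CMonPROP.{u}.comp
    (CMonPROP.perm (finAddFlip : Fin (1 + 1) ≃ Fin (1 + 1))) mu = mu :=
  PropPresentation.toHom_eq (pres := cmonPresentation) CMonRel.comm

theorem tensor_eta_mu :
    CMonPROP.{u}.comp (n := 1) (CMonPROP.tensor (CMonPROP.id 1) eta) mu = CMonPROP.id 1 := by
  rw [PROP.tensor_eq, PROP.comp_assoc, PROP.comp_assoc, swap_mu]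
  have h : (finAddFlip : Fin (1 + 0) ≃ Fin (0 + 1)) = Equiv.refl (Fin 1) := by decide
  rw [h]
  exact (CMonPROP.id_comp _).trans eta_tensor_mu

/-- The multiplication of the last two of `b + 2` wires. -/
def muLast (b : ℕ) : CMonPROP.{u}.Hom (b + 2) (b + 1) := CMonPROP.tensor (CMonPROP.id b) mu

/-- The morphism that multiplies the last of `m + 1` wires into the wire `j`. -/
def ins : ∀ {m : ℕ}, Fin m → CMonPROP.{u}.Hom (m + 1) m
  | b + 1, j => CMonPROP.comp (m := b + 1 + 1) (CMonPROP.perm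
      (blockSum (Equiv.swap (Fin.last b) j).symm (Equiv.refl (Fin 1))))
      (CMonPROP.comp (muLast b)
        (CMonPROP.perm (Equiv.swap (Fin.last b) j)))

/-- The transposition in the definition of `ins` can be replaced by any bijection that sends the
last wire to `j`. -/
theorem ins_apply_last {b m : ℕ} (β : Fin (b + 1) ≃ Fin m) :
    ins (β (Fin.last b)) = CMonPROP.{u}.comp (m := b + 1 + 1)
      (CMonPROP.perm (blockSum β.symm (Equiv.refl (Fin 1))))
      (CMonPROP.comp (muLast b) (CMonPROP.perm β)) := by
  obtain rfl : b + 1 = m := by simpa using Fintype.card_congr β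
  obtain ⟨τ, hτ⟩ := exists_eq_blockSum_refl (a := b) (a' := b) (c := 1)
    (β.trans (Equiv.swap (Fin.last b) (β (Fin.last b)))) (fun i => by
      rw [Subsingleton.elim i 0]
      exact Equiv.swap_apply_right _ _)
  set s := Equiv.swap (Fin.last b) (β (Fin.last b)) with hs
  have hβ : β = (blockSum τ (Equiv.refl (Fin 1))).trans s := by
    rw [← hτ, Equiv.trans_assoc]
    ext i; simp [hs]
  have key : blockSum ((blockSum τ (Equiv.refl (Fin 1))).trans s).symm (Equiv.refl (Fin 1)) =
      (blockSum s.symm (Equiv.refl (Fin 1))).trans (blockSum τ (Equiv.refl (Fin 2))).symm := by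
    rw [← blockSum_blockSum_one τ 1, blockSum_symm _ (Equiv.refl (Fin 1)), ← blockSum_trans]
    rfl
  calc ins (β (Fin.last b))
      = CMonPROP.{u}.comp (m := b + 1 + 1) (CMonPROP.perm (blockSum s.symm (Equiv.refl (Fin 1))))
        (CMonPROP.comp (muLast b) (CMonPROP.perm s)) := rfl
    _ = CMonPROP.{u}.comp (m := b + 1 + 1) (CMonPROP.perm (blockSum
          ((blockSum τ (Equiv.refl (Fin 1))).trans s).symm (Equiv.refl (Fin 1))))
        (CMonPROP.comp (muLast b)
          (CMonPROP.perm ((blockSum τ (Equiv.refl (Fin 1))).trans s))) := by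
      have h := CMonPROP.{u}.id_tensor_comp_perm τ mu
      rw [key, CMonPROP.perm_trans (blockSum τ _) s, ← CMonPROP.comp_assoc (muLast b),
        show CMonPROP.comp (muLast b) _ = _ from h, CMonPROP.comp_assoc]
      exact (CMonPROP.perm_trans_symm_comp _ _ _).symm
    _ = _ := by rw [← hβ]

theorem ins_last (b : ℕ) : ins (Fin.last b) = muLast.{u} b := by
  have h := ins_apply_last.{u} (Equiv.refl (Fin (b + 1)))
  rw [Equiv.refl_symm, blockSum_refl, CMonPROP.comp_id] at h
  exact h.trans (CMonPROP.id_comp _)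

theorem ins_comp_perm {n m : ℕ} (j : Fin n) (σ : Fin n ≃ Fin m) :
    CMonPROP.{u}.comp (ins j) (CMonPROP.perm σ) =
      CMonPROP.comp (CMonPROP.perm (blockSum σ (Equiv.refl (Fin 1)))) (ins (σ j)) := by
  obtain _ | b := n
  · exact j.elim0
  have hj : j = Equiv.swap (Fin.last b) j (Fin.last b) := (Equiv.swap_apply_left _ _).symm
  generalize Equiv.swap (Fin.last b) j = β at hj
  subst hj
  have h := ins_apply_last.{u} (β.trans σ)
  rw [Equiv.trans_apply] at h
  rw [h, ins_apply_last, CMonPROP.comp_assoc, CMonPROP.comp_assoc, CMonPROP.perm_comp_perm,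
    CMonPROP.perm_comp_perm_comp, ← blockSum_trans]
  congr 3
  ext i; simp

/-- If `ins` at the last wire of `b + 1` can be moved past `id ⊗ x`, then so can `ins` at any wire
not touched by `x`. -/
theorem ins_castAdd_comp {a c d : ℕ} (x : CMonPROP.{u}.Hom a c) (j : Fin d)
    (h : ∀ b : ℕ, CMonPROP.comp (ins (Fin.castAdd a (Fin.last b)))
        (CMonPROP.tensor (CMonPROP.id (b + 1)) x) =
      CMonPROP.comp (CMonPROP.tensor (CMonPROP.tensor (CMonPROP.id (b + 1)) x) (CMonPROP.id 1))
        (ins (Fin.castAdd c (Fin.last b)))) :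
    CMonPROP.comp (ins (Fin.castAdd a j)) (CMonPROP.tensor (CMonPROP.id d) x) =
      CMonPROP.comp (CMonPROP.tensor (CMonPROP.tensor (CMonPROP.id d) x) (CMonPROP.id 1))
        (ins (Fin.castAdd c j)) := by
  obtain _ | b := d
  · exact j.elim0
  have hj : j = Equiv.swap (Fin.last b) j (Fin.last b) := (Equiv.swap_apply_left _ _).symm
  generalize Equiv.swap (Fin.last b) j = β at hj
  subst hj
  have e₁ := ins_comp_perm.{u} (Fin.castAdd a (Fin.last b)) (blockSum β (Equiv.refl (Fin a)))
  have e₂ := ins_comp_perm.{u} (Fin.castAdd c (Fin.last b)) (blockSum β (Equiv.refl (Fin c)))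
  rw [blockSum_castAdd] at e₁ e₂
  have e₃ : CMonPROP.{u}.comp (ins (Fin.castAdd a (β (Fin.last b))))
      (CMonPROP.tensor (CMonPROP.id (b + 1)) x) = CMonPROP.comp
      (CMonPROP.perm (blockSum (blockSum β (Equiv.refl (Fin a))) (Equiv.refl (Fin 1))).symm)
      (CMonPROP.comp (CMonPROP.comp (ins (Fin.castAdd a (Fin.last b)))
        (CMonPROP.perm (blockSum β (Equiv.refl (Fin a)))))
        (CMonPROP.tensor (CMonPROP.id (b + 1)) x)) := by
    rw [e₁, CMonPROP.comp_assoc, CMonPROP.perm_comp_perm_comp, Equiv.symm_trans_self,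
      CMonPROP.id_comp]
  rw [e₃, CMonPROP.comp_assoc, ← CMonPROP.id_tensor_comp_perm, ← CMonPROP.comp_assoc (ins _), h,
    CMonPROP.comp_assoc, e₂, ← CMonPROP.perm_tensor_id (blockSum β (Equiv.refl (Fin c))),
    ← CMonPROP.comp_assoc (CMonPROP.tensor _ _), ← CMonPROP.comp_tensor_id,
    CMonPROP.id_tensor_comp_perm, CMonPROP.comp_tensor_id, CMonPROP.perm_tensor_id,
    ← CMonPROP.comp_assoc, ← CMonPROP.comp_assoc, CMonPROP.perm_comp_perm,
    Equiv.symm_trans_self, CMonPROP.id_comp]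

end CMonPROP

theorem blockSum_refl_blockSum_one {a b : ℕ} (n : ℕ) (τ : Fin a ≃ Fin b) :
    blockSum (blockSum (Equiv.refl (Fin n)) τ) (Equiv.refl (Fin 1)) =
      blockSum (Equiv.refl (Fin n)) (blockSum τ (Equiv.refl (Fin 1))) :=
  blockSum_assoc (Equiv.refl (Fin n)) τ (Equiv.refl (Fin 1))

/-- The transposition of the last two of `b + 2` points. -/
def flipLast (b : ℕ) : Fin (b + 2) ≃ Fin (b + 2) :=
  blockSum (Equiv.refl (Fin b)) (finAddFlip : Fin (1 + 1) ≃ Fin (1 + 1))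

theorem flipLast_symm (b : ℕ) : (flipLast b).symm = flipLast b := by
  rw [flipLast, blockSum_symm, finAddFlip_symm, Equiv.refl_symm]

theorem flipLast_last (b : ℕ) : flipLast b (Fin.last (b + 1)) = Fin.natAdd b (0 : Fin 2) :=
  blockSum_natAdd (Equiv.refl (Fin b)) (finAddFlip : Fin (1 + 1) ≃ Fin (1 + 1)) 1

namespace CMonPROP

theorem muLast_succ (b : ℕ) :
    muLast.{u} (b + 1) = CMonPROP.tensor (CMonPROP.id b) (CMonPROP.tensor (CMonPROP.id 1) mu) := by
  rw [muLast, ← CMonPROP.id_tensor_id b 1]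
  exact (CMonPROP.comp_id _).symm.trans
    ((CMonPROP.tensor_assoc (CMonPROP.id b) (CMonPROP.id 1) mu).trans (CMonPROP.id_comp _))

/-- The unit of the last of `b + 1` wires. -/
def etaLast (b : ℕ) : CMonPROP.{u}.Hom b (b + 1) := CMonPROP.tensor (CMonPROP.id b) eta

theorem etaLast_succ (b : ℕ) :
    etaLast.{u} (b + 1) = CMonPROP.tensor (CMonPROP.id b) (CMonPROP.tensor (CMonPROP.id 1) eta) := by
  rw [etaLast, ← CMonPROP.id_tensor_id b 1]
  exact (CMonPROP.comp_id _).symm.trans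
    ((CMonPROP.tensor_assoc (CMonPROP.id b) (CMonPROP.id 1) eta).trans (CMonPROP.id_comp _))

/-- Multiplying a wire into the last one before a unit is added next to it. The case `b = 0` is
`small`; the general case is its tensor product with identities. -/
theorem ins_last_comp_eta (b : ℕ) :
    CMonPROP.{u}.comp (ins (Fin.castAdd 0 (Fin.last b))) (etaLast (b + 1)) =
      CMonPROP.comp (CMonPROP.tensor (etaLast (b + 1)) (CMonPROP.id 1))
        (ins (Fin.castAdd 1 (Fin.last b))) := by
  have small : CMonPROP.{u}.comp mu (CMonPROP.tensor (CMonPROP.id 1) eta) =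
      CMonPROP.comp (n := 2) (m := 3) (k := 2)
        (CMonPROP.tensor (CMonPROP.tensor (CMonPROP.id 1) eta) (CMonPROP.id 1))
        (CMonPROP.comp (n := 3) (m := 3) (k := 2)
          (CMonPROP.perm (blockSum (finAddFlip : Fin (1 + 1) ≃ Fin (1 + 1)) (Equiv.refl (Fin 1))))
          (CMonPROP.comp (CMonPROP.tensor (CMonPROP.id 1) mu)
            (CMonPROP.perm (finAddFlip : Fin (1 + 1) ≃ Fin (1 + 1))))) := by
    have e₁ : CMonPROP.{u}.comp (n := 2) (m := 3) (k := 3)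
        (CMonPROP.tensor (CMonPROP.tensor (CMonPROP.id 1) eta) (CMonPROP.id 1))
        (CMonPROP.perm (blockSum (finAddFlip : Fin (1 + 1) ≃ Fin (1 + 1)) (Equiv.refl (Fin 1)))) =
        CMonPROP.tensor eta (CMonPROP.id 2) := by
      rw [← CMonPROP.perm_tensor_id]
      refine (CMonPROP.comp_tensor_id 1 _ _).symm.trans ?_
      rw [CMonPROP.swap_natural, show (finAddFlip : Fin (1 + 0) ≃ Fin (0 + 1)) = Equiv.refl (Fin 1)
        by decide]
      refine (congrArg (fun t => CMonPROP.tensor t (CMonPROP.id 1)) (CMonPROP.id_comp _)).trans ?_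
      refine (CMonPROP.tensor_tensor_one _ _ _).trans ?_
      rw [CMonPROP.id_tensor_id]
    have e₂ : CMonPROP.{u}.comp (CMonPROP.tensor eta mu)
        (CMonPROP.perm (finAddFlip : Fin (1 + 1) ≃ Fin (1 + 1))) = CMonPROP.tensor mu eta := by
      rw [CMonPROP.swap_natural, show (finAddFlip : Fin (0 + 2) ≃ Fin (2 + 0)) = Equiv.refl (Fin 2)
        by decide]
      exact CMonPROP.id_comp _
    rw [← CMonPROP.comp_assoc, e₁, ← CMonPROP.comp_assoc, CMonPROP.tensor_id_comp_id_tensor, e₂,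
      ← CMonPROP.tensor_id_comp_id_tensor mu eta]
    exact congrArg (fun t => CMonPROP.comp t (CMonPROP.tensor (CMonPROP.id 1) eta)) (CMonPROP.tensor_id mu).symm
  have hβ : Fin.castAdd 1 (Fin.last b) =
      blockSum (Equiv.refl (Fin b)) (finAddFlip : Fin (1 + 1) ≃ Fin (1 + 1)) (Fin.last (b + 1)) :=
    (blockSum_natAdd (Equiv.refl (Fin b)) (finAddFlip : Fin (1 + 1) ≃ Fin (1 + 1)) 1).symm
  have h₁ := CMonPROP.{u}.id_tensor_comp b mu (CMonPROP.tensor (CMonPROP.id 1) eta)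
  rw [small, CMonPROP.id_tensor_comp, CMonPROP.id_tensor_comp, CMonPROP.id_tensor_comp] at h₁
  rw [hβ]
  erw [ins_apply_last]
  rw [muLast_succ, etaLast_succ, blockSum_symm, finAddFlip_symm, Equiv.refl_symm,
    blockSum_refl_blockSum_one, CMonPROP.tensor_tensor_one, ← CMonPROP.id_tensor_perm,
    ← CMonPROP.id_tensor_perm]
  exact (congrArg (fun t => CMonPROP.comp t _) (ins_last b)).trans h₁.symm

/-- Multiplying a wire into the last one before the product of two further wires is formed. The
case `b = 0` is `small`; the general case is its tensor product with identities. -/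
theorem ins_last_comp_mu (b : ℕ) :
    CMonPROP.{u}.comp (ins (Fin.castAdd 2 (Fin.last b))) (muLast (b + 1)) =
      CMonPROP.comp (CMonPROP.tensor (muLast (b + 1)) (CMonPROP.id 1))
        (ins (Fin.castAdd 1 (Fin.last b))) := by
  have small : CMonPROP.{u}.comp (n := 4) (m := 4) (k := 2)
        (CMonPROP.perm (blockSum (finAddFlip : Fin (1 + 2) ≃ Fin (2 + 1)) (Equiv.refl (Fin 1))))
        (CMonPROP.comp (n := 4) (m := 3) (k := 2)
          (CMonPROP.comp (n := 4) (m := 3) (k := 3)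
            (CMonPROP.tensor (CMonPROP.id 2) mu)
            (CMonPROP.perm (finAddFlip : Fin (2 + 1) ≃ Fin (1 + 2))))
          (CMonPROP.tensor (CMonPROP.id 1) mu)) =
      CMonPROP.comp (n := 4) (m := 3) (k := 2)
        (CMonPROP.tensor (CMonPROP.tensor (CMonPROP.id 1) mu) (CMonPROP.id 1))
        (CMonPROP.comp (n := 3) (m := 3) (k := 2)
          (CMonPROP.perm (blockSum (finAddFlip : Fin (1 + 1) ≃ Fin (1 + 1)) (Equiv.refl (Fin 1))))
          (CMonPROP.comp (CMonPROP.tensor (CMonPROP.id 1) mu)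
            (CMonPROP.perm (finAddFlip : Fin (1 + 1) ≃ Fin (1 + 1))))) := by
    -- Both sides are a permutation of the four wires followed by `μ ⊗ μ`.
    have e₁ : CMonPROP.{u}.comp (n := 4) (m := 3) (k := 3)
        (CMonPROP.tensor (CMonPROP.tensor (CMonPROP.id 1) mu) (CMonPROP.id 1))
        (CMonPROP.perm (blockSum (finAddFlip : Fin (1 + 1) ≃ Fin (1 + 1)) (Equiv.refl (Fin 1)))) =
        CMonPROP.comp (n := 4) (m := 4) (k := 3)
          (CMonPROP.perm (blockSum (finAddFlip : Fin (1 + 2) ≃ Fin (2 + 1)) (Equiv.refl (Fin 1))))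
          (CMonPROP.tensor mu (CMonPROP.id 2)) := by
      rw [← CMonPROP.perm_tensor_id, ← CMonPROP.perm_tensor_id]
      refine (CMonPROP.comp_tensor_id 1 _ _).symm.trans ?_
      rw [CMonPROP.swap_natural]
      refine (CMonPROP.comp_tensor_id 1 _ _).trans ?_
      rw [CMonPROP.tensor_tensor_one, CMonPROP.id_tensor_id]
    have e₂ : CMonPROP.{u}.comp (CMonPROP.tensor mu mu)
        (CMonPROP.perm (finAddFlip : Fin (1 + 1) ≃ Fin (1 + 1))) =
        CMonPROP.comp (CMonPROP.perm (finAddFlip : Fin (2 + 2) ≃ Fin (2 + 2)))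
          (CMonPROP.tensor mu mu) := CMonPROP.swap_natural _ _
    have e₃ : CMonPROP.{u}.comp (n := 4) (m := 3) (k := 2) (CMonPROP.tensor mu (CMonPROP.id 2))
        (CMonPROP.tensor (CMonPROP.id 1) mu) = CMonPROP.tensor mu mu :=
      CMonPROP.tensor_id_comp_id_tensor mu mu
    rw [← CMonPROP.comp_assoc (CMonPROP.tensor (CMonPROP.tensor _ _) _), e₁,
      CMonPROP.swap_natural, CMonPROP.comp_assoc, CMonPROP.comp_assoc,
      ← CMonPROP.comp_assoc (CMonPROP.tensor mu (CMonPROP.id 2)), e₃, e₂]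
  have hβ : Fin.castAdd 1 (Fin.last b) =
      blockSum (Equiv.refl (Fin b)) (finAddFlip : Fin (1 + 1) ≃ Fin (1 + 1)) (Fin.last (b + 1)) :=
    (blockSum_natAdd (Equiv.refl (Fin b)) (finAddFlip : Fin (1 + 1) ≃ Fin (1 + 1)) 1).symm
  have hγ : Fin.castAdd 2 (Fin.last b) =
      blockSum (Equiv.refl (Fin b)) (finAddFlip : Fin (2 + 1) ≃ Fin (1 + 2)) (Fin.last (b + 2)) :=
    (blockSum_natAdd (Equiv.refl (Fin b)) (finAddFlip : Fin (2 + 1) ≃ Fin (1 + 2)) 2).symm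
  have h₁ := congrArg (CMonPROP.{u}.tensor (CMonPROP.id b)) small
  rw [CMonPROP.id_tensor_comp, CMonPROP.id_tensor_comp, CMonPROP.id_tensor_comp,
    CMonPROP.id_tensor_comp, CMonPROP.id_tensor_comp, CMonPROP.id_tensor_comp] at h₁
  have hmu : muLast.{u} (b + 2) =
      CMonPROP.tensor (CMonPROP.id b) (CMonPROP.tensor (CMonPROP.id 2) mu) := by
    rw [muLast, ← CMonPROP.id_tensor_id b 2]
    exact (CMonPROP.comp_id _).symm.trans
      ((CMonPROP.tensor_assoc (CMonPROP.id b) (CMonPROP.id 2) mu).trans (CMonPROP.id_comp _))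
  rw [hβ, hγ]
  erw [ins_apply_last, ins_apply_last]
  rw [hmu, muLast_succ, blockSum_symm, blockSum_symm, finAddFlip_symm, finAddFlip_symm,
    Equiv.refl_symm,
    blockSum_refl_blockSum_one, CMonPROP.tensor_tensor_one, ← CMonPROP.id_tensor_perm,
    ← CMonPROP.id_tensor_perm, blockSum_refl_blockSum_one, ← CMonPROP.id_tensor_perm,
    ← CMonPROP.id_tensor_perm]
  exact (CMonPROP.comp_assoc _ _ _).trans h₁

theorem muLast_comp_muLast (b : ℕ) :
    CMonPROP.{u}.comp (muLast (b + 1)) (muLast b) =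
      CMonPROP.comp (CMonPROP.tensor (muLast b) (CMonPROP.id 1)) (muLast b) := by
  have h := congrArg (CMonPROP.{u}.tensor (CMonPROP.id b)) assoc
  rw [CMonPROP.id_tensor_comp, CMonPROP.id_tensor_comp] at h
  rw [muLast_succ, muLast, CMonPROP.tensor_tensor_one]
  exact h.symm

theorem flip_comp_muLast (b : ℕ) :
    CMonPROP.{u}.comp (CMonPROP.perm (flipLast b)) (muLast b) = muLast b := by
  have h := congrArg (CMonPROP.{u}.tensor (CMonPROP.id b)) swap_mu
  rw [CMonPROP.id_tensor_comp, CMonPROP.id_tensor_perm] at h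
  exact h

/-- By associativity and commutativity, a wire can be multiplied into a product instead of into
one of its factors. -/
theorem ins_natAdd_comp_mu (d : ℕ) (j : Fin 2) :
    CMonPROP.{u}.comp (ins (Fin.natAdd d j)) (muLast d) =
      CMonPROP.comp (CMonPROP.tensor (muLast d) (CMonPROP.id 1)) (ins (Fin.last d)) := by
  have h₁ : CMonPROP.{u}.comp (ins (Fin.last (d + 1))) (muLast d) =
      CMonPROP.comp (CMonPROP.tensor (muLast d) (CMonPROP.id 1)) (ins (Fin.last d)) := by
    rw [ins_last, ins_last, muLast_comp_muLast]
  fin_cases j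
  · have h₀ := ins_comp_perm.{u} (flipLast d (Fin.last (d + 1))) (flipLast d).symm
    rw [Equiv.symm_apply_apply, flipLast_symm, flipLast_last] at h₀
    calc CMonPROP.comp (ins (Fin.natAdd d (0 : Fin 2))) (muLast d)
        = CMonPROP.comp (CMonPROP.comp (ins (Fin.natAdd d (0 : Fin 2)))
            (CMonPROP.perm (flipLast d))) (muLast d) := by
          rw [CMonPROP.comp_assoc, flip_comp_muLast]
      _ = _ := by
          rw [h₀, CMonPROP.comp_assoc, h₁, ← CMonPROP.comp_assoc, ← CMonPROP.perm_tensor_id,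
            ← CMonPROP.comp_tensor_id, flip_comp_muLast]
  · exact h₁

/-- Every morphism of `M` is a composite of permutations, of products of the last two wires and of
units of the last wire. -/
theorem layer_induction {P : ∀ {n m : ℕ}, CMonPROP.{u}.Hom n m → Prop}
    (perm : ∀ {n m : ℕ} (σ : Fin n ≃ Fin m), P (CMonPROP.perm σ))
    (mu : ∀ b : ℕ, P (muLast b)) (eta : ∀ b : ℕ, P (etaLast b))
    (comp : ∀ {n m k : ℕ} (f : CMonPROP.Hom n m) (g : CMonPROP.Hom m k),
      P f → P g → P (CMonPROP.comp f g)) {n m : ℕ} (f : CMonPROP.{u}.Hom n m) : P f :=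
  PropPresentation.layer_induction cmonPresentation perm
    (fun b _ _ x => match x with
      | .mu => mu b
      | .eta => eta b) comp f

theorem toFun_muLast (b : ℕ) : toFun (muLast.{u} b) = funSum (_root_.id : Fin b → Fin b)
    (fun _ : Fin 2 => (0 : Fin 1)) :=
  (toFun_tensor _ _).trans rfl

theorem toFun_etaLast (b : ℕ) : toFun (etaLast.{u} b) = Fin.castSucc :=
  (toFun_tensor (CMonPROP.id b) eta).trans (funext fun i =>
    funSum_castAdd (a := b) (c := 0) (d := 1) _root_.id Fin.elim0 i)

/-- Multiplying a wire into the wire `j` before `g` is the same as multiplying it into the image of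
`j` after `g`. This makes the normal forms below stable under composition. -/
theorem ins_comp {n m : ℕ} (g : CMonPROP.{u}.Hom n m) (j : Fin n) :
    CMonPROP.comp (ins j) g =
      CMonPROP.comp (CMonPROP.tensor g (CMonPROP.id 1)) (ins (toFun g j)) := by
  revert j
  refine layer_induction (P := fun {n m} g => ∀ j : Fin n,
    CMonPROP.{u}.comp (ins j) g =
      CMonPROP.comp (CMonPROP.tensor g (CMonPROP.id 1)) (ins (toFun g j))) ?_ ?_ ?_ ?_ g
  · intro n m σ j
    rw [ins_comp_perm j σ, ← CMonPROP.perm_tensor_id]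
    rfl
  · intro d j
    rw [toFun_muLast]
    induction j using Fin.addCases with
    | left j =>
      rw [funSum_castAdd]
      exact ins_castAdd_comp mu j ins_last_comp_mu
    | right j =>
      rw [funSum_natAdd]
      exact ins_natAdd_comp_mu d j
  · intro d j
    rw [toFun_etaLast]
    exact ins_castAdd_comp eta j ins_last_comp_eta
  · intro n m k f g hf hg j
    rw [← CMonPROP.comp_assoc, hf, CMonPROP.comp_assoc, hg, ← CMonPROP.comp_assoc,
      ← CMonPROP.comp_tensor_id, toFun_comp]
    rfl

/-- The tensor power of the unit. -/
def etas : ∀ m : ℕ, CMonPROP.{u}.Hom 0 m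
  | 0 => CMonPROP.id 0
  | m + 1 => CMonPROP.tensor (etas m) eta

theorem etas_comp_etaLast (m : ℕ) : CMonPROP.{u}.comp (etas m) (etaLast m) = etas (m + 1) := by
  have h := CMonPROP.{u}.tensor_id_comp_id_tensor (etas m) eta
  exact (congrArg (fun t => CMonPROP.comp t (etaLast m)) (CMonPROP.tensor_id (etas m)).symm).trans h

theorem etas_add_two (m : ℕ) :
    etas.{u} (m + 2) = CMonPROP.tensor (etas m) (CMonPROP.tensor eta eta) :=
  (CMonPROP.comp_id _).symm.trans ((CMonPROP.tensor_assoc (etas m) eta eta).trans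
    (CMonPROP.id_comp _))

theorem etas_comp_perm {m : ℕ} (σ : Fin m ≃ Fin m) :
    CMonPROP.{u}.comp (etas m) (CMonPROP.perm σ) = etas m := by
  refine perm_blockSum_induction (P := fun {m} σ =>
    CMonPROP.{u}.comp (etas m) (CMonPROP.perm σ) = etas m) ?_ ?_ ?_ ?_ σ
  · exact fun m => CMonPROP.comp_id _
  · intro m σ τ hσ hτ
    rw [CMonPROP.perm_trans, ← CMonPROP.comp_assoc, hσ, hτ]
  · intro m σ hσ
    rw [← CMonPROP.perm_tensor_id]
    exact (CMonPROP.comp_tensor_comp _ _ _ _).symm.trans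
      (congrArg₂ CMonPROP.tensor hσ (CMonPROP.comp_id _))
  · intro k
    rw [etas_add_two, ← CMonPROP.id_tensor_perm]
    have h := CMonPROP.{u}.swap_natural eta eta
    rw [show (finAddFlip : Fin (0 + 0) ≃ Fin (0 + 0)) = Equiv.refl (Fin 0) by decide,
      CMonPROP.id_comp] at h
    exact (CMonPROP.comp_tensor_comp _ _ _ _).symm.trans
      (congrArg₂ CMonPROP.tensor (CMonPROP.comp_id _) h)

/-- All morphisms out of `0` in the PROP of commutative monoids are tensor powers of the unit. -/
theorem etas_comp {n m : ℕ} (g : CMonPROP.{u}.Hom n m) : CMonPROP.comp (etas n) g = etas m := by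
  refine layer_induction (P := fun {n m} g => CMonPROP.{u}.comp (etas n) g = etas m) ?_ ?_ ?_ ?_ g
  · intro n m σ
    obtain rfl : n = m := by simpa using Fintype.card_congr σ
    exact etas_comp_perm σ
  · intro d
    have h₁ : CMonPROP.{u}.comp (n := 0) (m := 2) (CMonPROP.tensor eta eta) mu = eta := by
      have h := CMonPROP.{u}.comp_assoc (a := 0) (b := 1) (c := 2) (CMonPROP.tensor eta (CMonPROP.id 0))
        (CMonPROP.tensor (CMonPROP.id 1) eta) mu
      rw [tensor_eta_mu, CMonPROP.comp_id'] at h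
      exact (congrArg (fun t => CMonPROP.comp t mu)
        (CMonPROP.tensor_id_comp_id_tensor eta eta).symm).trans (h.trans (CMonPROP.tensor_id eta))
    have h := CMonPROP.{u}.comp_tensor_comp (etas d) (CMonPROP.id d) (CMonPROP.tensor eta eta) mu
    rw [CMonPROP.comp_id'] at h
    rw [etas_add_two]
    exact h.symm.trans (congrArg (CMonPROP.tensor (etas d)) h₁)
  · exact fun d => etas_comp_etaLast d
  · intro n m k f g hf hg
    rw [← CMonPROP.comp_assoc, hf, hg]

/-- The normal form of a function: a morphism that denotes it, built one wire at a time. -/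
def ofFun : ∀ {n m : ℕ}, (Fin n → Fin m) → CMonPROP.{u}.Hom n m
  | 0, m, _ => etas m
  | _ + 1, _, f => CMonPROP.comp
      (CMonPROP.tensor (ofFun fun i => f i.castSucc) (CMonPROP.id 1)) (ins (f (Fin.last _)))

theorem ofFun_comp {n m k : ℕ} (f : Fin n → Fin m) (g : CMonPROP.{u}.Hom m k) :
    CMonPROP.comp (ofFun f) g = ofFun (toFun g ∘ f) := by
  induction n with
  | zero => exact etas_comp g
  | succ n ih =>
    rw [ofFun, CMonPROP.comp_assoc, ins_comp, ← CMonPROP.comp_assoc, ← CMonPROP.comp_tensor_id, ih]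
    rfl

theorem ofFun_id (n : ℕ) : ofFun (_root_.id : Fin n → Fin n) = CMonPROP.{u}.id n := by
  induction n with
  | zero => rfl
  | succ n ih =>
    have h : (ofFun fun i : Fin n => (_root_.id i.castSucc : Fin (n + 1))) = etaLast.{u} n := by
      have h := ofFun_comp.{u} (_root_.id : Fin n → Fin n) (etaLast n)
      rw [toFun_etaLast, ih, CMonPROP.id_comp'] at h
      exact h.symm
    have h₁ := congrArg (CMonPROP.{u}.tensor (CMonPROP.id n)) eta_tensor_mu
    rw [CMonPROP.id_tensor_comp, CMonPROP.id_tensor_id] at h₁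
    rw [ofFun, h]
    refine Eq.trans ?_ h₁
    exact congrArg₂ CMonPROP.comp (CMonPROP.tensor_tensor_one _ _ _) (ins_last n)

/-- A morphism of the PROP of commutative monoids is determined by the function it denotes. -/
@[simp] theorem ofFun_toFun {n m : ℕ} (f : CMonPROP.{u}.Hom n m) : ofFun (toFun f) = f := by
  have h := ofFun_comp (_root_.id : Fin n → Fin n) f
  rw [ofFun_id, CMonPROP.id_comp'] at h
  exact h.symm

theorem toFun_ins_castSucc {m : ℕ} (j i : Fin m) : toFun (ins.{u} j) i.castSucc = i := by
  obtain _ | b := m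
  · exact j.elim0
  rw [ins, toFun_comp, toFun_comp, toFun_perm, toFun_perm, toFun_muLast]
  have h : blockSum (Equiv.swap (Fin.last b) j).symm (Equiv.refl (Fin 1)) i.castSucc =
    Fin.castAdd 1 ((Equiv.swap (Fin.last b) j).symm i) := blockSum_castAdd _ _ i
  simp only [Function.comp_apply]
  rw [h]
  have h' : ∀ k : Fin (b + 1), funSum (_root_.id : Fin b → Fin b) (fun _ : Fin 2 => (0 : Fin 1))
      (Fin.castAdd 1 k) = k := by
    intro k
    induction k using Fin.addCases with
    | left k => exact funSum_castAdd _ _ k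
    | right k =>
      rw [Subsingleton.elim k 0]
      exact funSum_natAdd (_root_.id : Fin b → Fin b) (fun _ : Fin 2 => (0 : Fin 1)) 0
  erw [h']
  exact Equiv.apply_symm_apply _ _

theorem toFun_ins_last {m : ℕ} (j : Fin m) : toFun (ins.{u} j) (Fin.last m) = j := by
  obtain _ | b := m
  · exact j.elim0
  rw [ins, toFun_comp, toFun_comp, toFun_perm, toFun_perm, toFun_muLast]
  have h : blockSum (Equiv.swap (Fin.last b) j).symm (Equiv.refl (Fin 1)) (Fin.last (b + 1)) =
    Fin.natAdd (b + 1) 0 := blockSum_natAdd _ _ 0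
  have h' : funSum (_root_.id : Fin b → Fin b) (fun _ : Fin 2 => (0 : Fin 1))
      (Fin.natAdd b 1) = Fin.last b := funSum_natAdd _ _ _
  simp only [Function.comp_apply]
  rw [h]
  exact (congrArg (Equiv.swap (Fin.last b) j) h').trans (Equiv.swap_apply_left _ _)

@[simp] theorem toFun_ofFun {n m : ℕ} (f : Fin n → Fin m) : toFun (ofFun.{u} f) = f := by
  induction n with
  | zero => exact Subsingleton.elim _ _
  | succ n ih =>
    rw [ofFun, toFun_comp, toFun_tensor, ih]
    funext i
    refine Fin.addCases (fun i => ?_) (fun i => ?_) i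
    · rw [Function.comp_apply, funSum_castAdd]
      exact toFun_ins_castSucc _ _
    · rw [Function.comp_apply, funSum_natAdd, Subsingleton.elim i 0]
      exact toFun_ins_last _

theorem toFun_injective {n m : ℕ} : Function.Injective (toFun.{u} (n := n) (m := m)) :=
  fun f g h => by rw [← ofFun_toFun f, h, ofFun_toFun]

end CMonPROP

/-! ### Normal forms of the morphisms of `PG` -/

namespace PhasePROP

variable {G : Type u} [CommGroup G]

theorem phase_mul (g h : G) : (PhasePROP G).comp (phase g) (phase h) = phase (g * h) :=
  PropPresentation.toHom_eq (pres := phasePresentation G) (PhaseRel.phase_mul g h)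

theorem phase_one : phase (1 : G) = (PhasePROP G).id 1 :=
  PropPresentation.toHom_eq (pres := phasePresentation G) PhaseRel.phase_one

theorem diag_succ {m : ℕ} (g : Fin (m + 1) → G) :
    diag g = (PhasePROP G).tensor (diag fun i : Fin m => g i.castSucc) (phase (g (Fin.last m))) :=
  rfl

theorem diag_one (m : ℕ) : diag (fun _ : Fin m => (1 : G)) = (PhasePROP G).id m := by
  induction m with
  | zero => rfl
  | succ m ih =>
    rw [diag_succ, ih, phase_one]
    exact (PhasePROP G).id_tensor_id m 1

theorem diag_comp_diag {m : ℕ} (g h : Fin m → G) :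
    (PhasePROP G).comp (diag g) (diag h) = diag (fun i => g i * h i) := by
  induction m with
  | zero => exact (PhasePROP G).id_comp _
  | succ m ih =>
    rw [diag_succ, diag_succ, diag_succ, ← ih, ← phase_mul]
    exact ((PhasePROP G).comp_tensor_comp _ _ _ _).symm

theorem diag_comp_perm_self {m : ℕ} (σ : Fin m ≃ Fin m) (g : Fin m → G) :
    (PhasePROP G).comp (diag g) ((PhasePROP G).perm σ) =
      (PhasePROP G).comp ((PhasePROP G).perm σ) (diag (g ∘ σ.symm)) := by
  revert g
  refine perm_blockSum_induction (P := fun {m} σ => ∀ g : Fin m → G,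
    (PhasePROP G).comp (diag g) ((PhasePROP G).perm σ) =
      (PhasePROP G).comp ((PhasePROP G).perm σ) (diag (g ∘ σ.symm))) ?_ ?_ ?_ ?_ σ
  · intro m g
    rw [(PhasePROP G).comp_id, (PhasePROP G).id_comp]
    rfl
  · intro m σ τ hσ hτ g
    rw [(PhasePROP G).perm_trans, ← (PhasePROP G).comp_assoc, hσ, (PhasePROP G).comp_assoc, hτ,
      ← (PhasePROP G).comp_assoc]
    rfl
  · intro m σ hσ g
    have h : (PhasePROP G).perm (blockSum σ (Equiv.refl (Fin 1))) =
      (PhasePROP G).tensor ((PhasePROP G).perm σ) ((PhasePROP G).id 1) :=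
      (PhasePROP G).perm_blockSum _ _
    have e₁ : (fun i : Fin m => (g ∘ (blockSum σ (Equiv.refl (Fin 1))).symm) i.castSucc) =
        (fun i : Fin m => g i.castSucc) ∘ σ.symm := by
      funext i
      rw [blockSum_symm]
      exact congrArg g (blockSum_castAdd σ.symm (Equiv.refl (Fin 1)).symm i)
    have e₂ : (g ∘ (blockSum σ (Equiv.refl (Fin 1))).symm) (Fin.last m) = g (Fin.last m) := by
      rw [blockSum_symm]
      exact congrArg g (blockSum_natAdd σ.symm (Equiv.refl (Fin 1)).symm 0)
    rw [h, diag_succ, diag_succ, e₁, e₂]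
    refine ((PhasePROP G).comp_tensor_comp _ _ _ _).symm.trans
      (Eq.trans ?_ ((PhasePROP G).comp_tensor_comp _ _ _ _))
    rw [hσ, (PhasePROP G).comp_id', (PhasePROP G).id_comp']
  · intro k g
    have h := ((PhasePROP G).id_tensor_perm (c := k)
      (finAddFlip : Fin (1 + 1) ≃ Fin (1 + 1))).symm
    have two : ∀ g : Fin (k + 2) → G, diag g = (PhasePROP G).tensor
        (diag fun i : Fin k => g i.castSucc.castSucc)
        ((PhasePROP G).tensor (phase (g (Fin.last k).castSucc)) (phase (g (Fin.last (k + 1))))) :=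
      fun g => (PhasePROP G).tensor_tensor_one _ _ _
    have e₀ : (fun i : Fin k => (g ∘ (flipLast k).symm) i.castSucc.castSucc) =
        fun i : Fin k => g i.castSucc.castSucc := by
      funext i
      rw [flipLast_symm]
      exact congrArg g
        (blockSum_castAdd (Equiv.refl (Fin k)) (finAddFlip : Fin (1 + 1) ≃ Fin (1 + 1)) i)
    have e₁ : (g ∘ (flipLast k).symm) (Fin.last k).castSucc = g (Fin.last (k + 1)) := by
      rw [flipLast_symm]
      exact congrArg g
        (blockSum_natAdd (Equiv.refl (Fin k)) (finAddFlip : Fin (1 + 1) ≃ Fin (1 + 1)) 0)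
    have e₂ : (g ∘ (flipLast k).symm) (Fin.last (k + 1)) = g (Fin.last k).castSucc := by
      rw [flipLast_symm]
      exact congrArg g (flipLast_last k)
    rw [h, two, two]
    refine ((PhasePROP G).comp_tensor_comp _ _ _ _).symm.trans
      (Eq.trans ?_ ((PhasePROP G).comp_tensor_comp _ _ _ _))
    have sw := (PhasePROP G).swap_natural (phase (g (Fin.last k).castSucc))
      (phase (g (Fin.last (k + 1))))
    rw [(PhasePROP G).comp_id', (PhasePROP G).id_comp', sw]
    exact congrArg₂ (PhasePROP G).tensor (congrArg diag e₀.symm)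
      (congrArg ((PhasePROP G).comp _) (congrArg₂ (fun a b =>
        (PhasePROP G).tensor (phase a) (phase b)) e₁.symm e₂.symm))

/-- Naturality of the symmetry moves a vector of phases past a permutation. -/
theorem diag_comp_perm {n m : ℕ} (σ : Fin n ≃ Fin m) (g : Fin n → G) :
    (PhasePROP G).comp (diag g) ((PhasePROP G).perm σ) =
      (PhasePROP G).comp ((PhasePROP G).perm σ) (diag (g ∘ σ.symm)) := by
  obtain rfl : n = m := by simpa using Fintype.card_congr σ
  exact diag_comp_perm_self σ g

/-- The phase `g` on the last of `b + 1` wires. -/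
def phaseLast (b : ℕ) (g : G) : (PhasePROP G).Hom (b + 1) (b + 1) :=
  (PhasePROP G).tensor ((PhasePROP G).id b) (phase g)

theorem phaseLast_eq_diag (b : ℕ) (g : G) :
    phaseLast b g = diag (Fin.snoc (α := fun _ => G) (fun _ : Fin b => (1 : G)) g) := by
  rw [diag_succ]
  simp only [Fin.snoc_castSucc, Fin.snoc_last, diag_one]
  rfl

/-- Every morphism of `PG` is a composite of permutations and of phases on the last wire. -/
theorem layer_induction {P : ∀ {n m : ℕ}, (PhasePROP G).Hom n m → Prop}
    (perm : ∀ {n m : ℕ} (σ : Fin n ≃ Fin m), P ((PhasePROP G).perm σ))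
    (phase : ∀ (b : ℕ) (g : G), P (phaseLast b g))
    (comp : ∀ {n m k : ℕ} (f : (PhasePROP G).Hom n m) (g : (PhasePROP G).Hom m k),
      P f → P g → P ((PhasePROP G).comp f g)) {n m : ℕ} (f : (PhasePROP G).Hom n m) : P f :=
  PropPresentation.layer_induction (phasePresentation G) perm
    (fun b _ _ x => match x with
      | .phase g => phase b g) comp f

/-- Every morphism of `PG` is a permutation followed by a vector of phases. -/
theorem exists_eq_perm_comp_diag {n m : ℕ} (x : (PhasePROP G).Hom n m) :
    ∃ (σ : Fin n ≃ Fin m) (g : Fin m → G),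
      x = (PhasePROP G).comp ((PhasePROP G).perm σ) (diag g) := by
  refine layer_induction (P := fun {n m} x => ∃ (σ : Fin n ≃ Fin m) (g : Fin m → G),
      x = (PhasePROP G).comp ((PhasePROP G).perm σ) (diag g)) ?_ ?_ ?_ x
  · exact fun σ => ⟨σ, fun _ => 1, by rw [diag_one, (PhasePROP G).comp_id']⟩
  · exact fun b g => ⟨Equiv.refl _, _, by rw [phaseLast_eq_diag, (PhasePROP G).id_comp]⟩
  · rintro n m k _ _ ⟨σ, g, rfl⟩ ⟨τ, h, rfl⟩
    refine ⟨σ.trans τ, fun i => (g ∘ τ.symm) i * h i, ?_⟩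
    rw [(PhasePROP G).comp_assoc, ← (PhasePROP G).comp_assoc (diag g), diag_comp_perm,
      ← diag_comp_diag, (PhasePROP G).perm_trans, (PhasePROP G).comp_assoc,
      (PhasePROP G).comp_assoc]

end PhasePROP

/-! ### Pushouts of types -/

/-- The square `i ∘ b = j ∘ c` is a pushout of types. It is enough to test against types in the
lowest universe, where all apices of cospans live; uniqueness of the induced map is joint
surjectivity of `i` and `j`. -/
structure IsPO {M P Q R : Type} (b : M → P) (c : M → Q) (i : P → R) (j : Q → R) : Prop where
  comm : ∀ k, i (b k) = j (c k)
  surj : ∀ r, (∃ p, i p = r) ∨ ∃ q, j q = r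
  desc : ∀ {X : Type} (u : P → X) (v : Q → X), (∀ k, u (b k) = v (c k)) →
    ∃ w : R → X, (∀ p, w (i p) = u p) ∧ ∀ q, w (j q) = v q

namespace IsPO

variable {M P Q R M' P' Q' R' S : Type}

theorem hom_ext {b : M → P} {c : M → Q} {i : P → R} {j : Q → R} (h : IsPO b c i j) {X : Type}
    {u v : R → X} (h₁ : ∀ p, u (i p) = v (i p)) (h₂ : ∀ q, u (j q) = v (j q)) (r : R) :
    u r = v r := by
  obtain ⟨p, rfl⟩ | ⟨q, rfl⟩ := h.surj r
  · exact h₁ p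
  · exact h₂ q

/-- The pushout is unique up to bijection. -/
theorem exists_equiv {b : M → P} {c : M → Q} {i : P → R} {j : Q → R} {i' : P → R'} {j' : Q → R'}
    (h : IsPO b c i j) (h' : IsPO b c i' j') :
    ∃ e : R ≃ R', (∀ p, e (i p) = i' p) ∧ ∀ q, e (j q) = j' q := by
  obtain ⟨f, f₁, f₂⟩ := h.desc i' j' h'.comm
  obtain ⟨g, g₁, g₂⟩ := h'.desc i j h.comm
  refine ⟨⟨f, g, ?_, ?_⟩, f₁, f₂⟩
  · exact h.hom_ext (u := g ∘ f) (v := _root_.id) (by simp [f₁, g₁]) (by simp [f₂, g₂])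
  · exact h'.hom_ext (u := f ∘ g) (v := _root_.id) (by simp [f₁, g₁]) (by simp [f₂, g₂])

theorem symm {b : M → P} {c : M → Q} {i : P → R} {j : Q → R} (h : IsPO b c i j) :
    IsPO c b j i where
  comm k := (h.comm k).symm
  surj r := (h.surj r).symm
  desc u v huv := by
    obtain ⟨w, h₁, h₂⟩ := h.desc v u (fun k => (huv k).symm)
    exact ⟨w, h₂, h₁⟩

theorem id_left (c : M → Q) : IsPO _root_.id c c _root_.id where
  comm _ := rfl
  surj r := .inr ⟨r, rfl⟩
  desc _ v h := ⟨v, fun p => (h p).symm, fun _ => rfl⟩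

theorem id_right (b : M → P) : IsPO b _root_.id _root_.id b := (id_left b).symm

theorem congr_legs {b : M → P} {c : M → Q} {i : P → R} {j : Q → R} (h : IsPO b c i j)
    (e : P ≃ P') (f : Q ≃ Q') : IsPO (e ∘ b) (f ∘ c) (i ∘ e.symm) (j ∘ f.symm) where
  comm k := by simpa using h.comm k
  surj r := by
    obtain ⟨p, rfl⟩ | ⟨q, rfl⟩ := h.surj r
    · exact .inl ⟨e p, by simp⟩
    · exact .inr ⟨f q, by simp⟩
  desc u v huv := by
    obtain ⟨w, h₁, h₂⟩ := h.desc (u ∘ e) (v ∘ f) huv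
    exact ⟨w, fun p => by simp [h₁], fun q => by simp [h₂]⟩

theorem paste {b : M → P} {c : M → Q} {i : P → R} {j : Q → R} {k : R → S}
    {T : Type} {f : Q → T} {l : T → S} (h : IsPO b c i j) (h' : IsPO j f k l) :
    IsPO b (f ∘ c) (k ∘ i) l where
  comm x := by simp [h.comm, h'.comm]
  surj s := by
    obtain ⟨r, rfl⟩ | ⟨t, rfl⟩ := h'.surj s
    · obtain ⟨p, rfl⟩ | ⟨q, rfl⟩ := h.surj r
      · exact .inl ⟨p, rfl⟩
      · exact .inr ⟨f q, (h'.comm q).symm⟩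
    · exact .inr ⟨t, rfl⟩
  desc u v huv := by
    obtain ⟨w, h₁, h₂⟩ := h.desc u (v ∘ f) huv
    obtain ⟨w', h₃, h₄⟩ := h'.desc w v h₂
    exact ⟨w', fun p => by simp [h₃, h₁], h₄⟩

theorem sum {b : M → P} {c : M → Q} {i : P → R} {j : Q → R} (h : IsPO b c i j)
    {b' : M' → P'} {c' : M' → Q'} {i' : P' → R'} {j' : Q' → R'} (h' : IsPO b' c' i' j') :
    IsPO (Sum.map b b') (Sum.map c c') (Sum.map i i') (Sum.map j j') where
  comm := by rintro (k | k) <;> simp [h.comm, h'.comm]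
  surj := by
    rintro (r | r)
    · obtain ⟨p, rfl⟩ | ⟨q, rfl⟩ := h.surj r
      · exact .inl ⟨.inl p, rfl⟩
      · exact .inr ⟨.inl q, rfl⟩
    · obtain ⟨p, rfl⟩ | ⟨q, rfl⟩ := h'.surj r
      · exact .inl ⟨.inr p, rfl⟩
      · exact .inr ⟨.inr q, rfl⟩
  desc u v huv := by
    obtain ⟨w, h₁, h₂⟩ := h.desc (u ∘ Sum.inl) (v ∘ Sum.inl) (fun k => huv (.inl k))
    obtain ⟨w', h₁', h₂'⟩ := h'.desc (u ∘ Sum.inr) (v ∘ Sum.inr) (fun k => huv (.inr k))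
    exact ⟨Sum.elim w w', by rintro (p | p) <;> simp [h₁, h₁'],
      by rintro (p | p) <;> simp [h₂, h₂']⟩

theorem precomp_equiv {b : M → P} {c : M → Q} {i : P → R} {j : Q → R} (h : IsPO b c i j)
    (e : M' ≃ M) : IsPO (b ∘ e) (c ∘ e) i j where
  comm k := h.comm (e k)
  surj := h.surj
  desc u v huv := h.desc u v (fun k => by simpa using huv (e.symm k))

end IsPO

/-- The standard pushout of two maps of types. -/
def PO {M P Q : Type} (b : M → P) (c : M → Q) : Type :=
  Quot fun x y : P ⊕ Q => ∃ k, x = .inl (b k) ∧ y = .inr (c k)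

namespace PO

variable {M P Q : Type} (b : M → P) (c : M → Q)

/-- The first map into the pushout. -/
def inl (p : P) : PO b c := Quot.mk _ (.inl p)

/-- The second map into the pushout. -/
def inr (q : Q) : PO b c := Quot.mk _ (.inr q)

instance [Finite P] [Finite Q] : Finite (PO b c) := inferInstanceAs (Finite (Quot _))

theorem isPO : IsPO b c (inl b c) (inr b c) where
  comm k := Quot.sound ⟨k, rfl, rfl⟩
  surj r := by
    induction r using Quot.ind with | _ x => ?_
    obtain p | q := x
    · exact .inl ⟨p, rfl⟩
    · exact .inr ⟨q, rfl⟩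
  desc u v huv := by
    refine ⟨Quot.lift (Sum.elim u v) ?_, fun _ => rfl, fun _ => rfl⟩
    rintro _ _ ⟨k, rfl, rfl⟩
    exact huv k

end PO

/-! ### Labelled cospans -/

namespace LCospan

variable (G : Type u) [CommGroup G]

/-- Cospans `Fin n → Fin p ← Fin m` whose apex carries labels in `G`. -/
abbrev Rep (n m : ℕ) : Type u :=
  Σ p : ℕ, (Fin n → Fin p) × (Fin p →₀ Additive G) × (Fin m → Fin p)

/-- Isomorphism of labelled cospans. -/
def setoid (n m : ℕ) : Setoid (Rep G n m) where
  r A B := ∃ e : Fin A.1 ≃ Fin B.1, e ∘ A.2.1 = B.2.1 ∧ A.2.2.1.mapDomain e = B.2.2.1 ∧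
    e ∘ A.2.2.2 = B.2.2.2
  iseqv :=
    { refl := fun A => ⟨Equiv.refl _, rfl, Finsupp.mapDomain_id, rfl⟩
      symm := by
        rintro ⟨p, a, g, b⟩ ⟨p', a', g', b'⟩ h
        obtain ⟨e, rfl, rfl, rfl⟩ : ∃ e : Fin p ≃ Fin p', e ∘ a = a' ∧ g.mapDomain e = g' ∧ e ∘ b = b' := h
        refine ⟨e.symm, ?_, ?_, ?_⟩
        · funext i; simp
        · rw [← Finsupp.mapDomain_comp, Equiv.symm_comp_self, Finsupp.mapDomain_id]
        · funext i; simp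
      trans := by
        rintro ⟨p, a, g, b⟩ ⟨p', a', g', b'⟩ ⟨p'', a'', g'', b''⟩ h h'
        obtain ⟨e, rfl, rfl, rfl⟩ : ∃ e : Fin p ≃ Fin p', e ∘ a = a' ∧ g.mapDomain e = g' ∧ e ∘ b = b' := h
        obtain ⟨f, rfl, rfl, rfl⟩ : ∃ f : Fin p' ≃ Fin p'', f ∘ e ∘ a = a'' ∧
          (g.mapDomain e).mapDomain f = g'' ∧ f ∘ e ∘ b = b'' := h'
        exact ⟨e.trans f, rfl, by rw [← Finsupp.mapDomain_comp]; rfl, rfl⟩ }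

/-- Isomorphism classes of labelled cospans. -/
def Hom (n m : ℕ) : Type u := Quotient (setoid G n m)

variable {G}

/-- The class of a labelled cospan whose apex is an arbitrary finite type. -/
noncomputable def mk {n m : ℕ} (P : Type) [Finite P] (a : Fin n → P) (g : P →₀ Additive G)
    (b : Fin m → P) : Hom G n m :=
  Quotient.mk (setoid G n m)
    ⟨Nat.card P, Finite.equivFin P ∘ a, g.mapDomain (Finite.equivFin P), Finite.equivFin P ∘ b⟩

theorem mk_eq_mk_iff {n m : ℕ} {P P' : Type} [Finite P] [Finite P'] {a : Fin n → P}
    {g : P →₀ Additive G} {b : Fin m → P} {a' : Fin n → P'} {g' : P' →₀ Additive G}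
    {b' : Fin m → P'} : mk P a g b = mk P' a' g' b' ↔
      ∃ e : P ≃ P', (∀ i, e (a i) = a' i) ∧ g.mapDomain e = g' ∧ ∀ i, e (b i) = b' i := by
  constructor
  · intro h
    obtain ⟨e, h₁, h₂, h₃⟩ := Quotient.exact h
    dsimp only at e h₁ h₂ h₃
    refine ⟨(Finite.equivFin P).trans (e.trans (Finite.equivFin P').symm), fun i => ?_, ?_,
      fun i => ?_⟩
    · have := congrFun h₁ i
      simp only [Function.comp_apply] at this
      simp [this]
    · have := congrArg (Finsupp.mapDomain (Finite.equivFin P').symm) h₂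
      rw [← Finsupp.mapDomain_comp, ← Finsupp.mapDomain_comp, ← Finsupp.mapDomain_comp,
        Equiv.symm_comp_self, Finsupp.mapDomain_id] at this
      exact this
    · have := congrFun h₃ i
      simp only [Function.comp_apply] at this
      simp [this]
  · rintro ⟨e, h₁, h₂, h₃⟩
    subst h₂
    refine Quotient.sound ⟨(Finite.equivFin P).symm.trans (e.trans (Finite.equivFin P')), ?_, ?_, ?_⟩
    · funext i; simp [h₁]
    · dsimp only
      rw [← Finsupp.mapDomain_comp, ← Finsupp.mapDomain_comp]
      congr 1
      funext i; simp
    · funext i; simp [h₃]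

theorem mk_congr {n m : ℕ} {P P' : Type} [Finite P] [Finite P'] {a : Fin n → P}
    {g : P →₀ Additive G} {b : Fin m → P} {a' : Fin n → P'} {g' : P' →₀ Additive G}
    {b' : Fin m → P'} (e : P ≃ P') (h₁ : ∀ i, e (a i) = a' i) (h₂ : g.mapDomain e = g')
    (h₃ : ∀ i, e (b i) = b' i) : mk P a g b = mk P' a' g' b' :=
  mk_eq_mk_iff.2 ⟨e, h₁, h₂, h₃⟩

/-- Every labelled cospan has an apex of the form `Fin q`. -/
theorem ind {n m : ℕ} {p : Hom G n m → Prop}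
    (h : ∀ (q : ℕ) (a : Fin n → Fin q) (g : Fin q →₀ Additive G) (b : Fin m → Fin q),
      p (mk (Fin q) a g b)) (x : Hom G n m) : p x := by
  induction x using Quotient.ind with | _ x => ?_
  obtain ⟨q, a, g, b⟩ := x
  have e : (Quotient.mk (setoid G n m) ⟨q, a, g, b⟩ : Hom G n m) = mk (Fin q) a g b :=
    Quotient.sound ⟨Finite.equivFin (Fin q), rfl, rfl, rfl⟩
  exact e ▸ h q a g b

theorem mk_eq_of_isPO {n m k : ℕ} {P Q R R' : Type} [Finite P] [Finite Q] [Finite R] [Finite R']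
    {b : Fin m → P} {c : Fin m → Q} {i : P → R} {j : Q → R} {i' : P → R'} {j' : Q → R'}
    (h : IsPO b c i j) (h' : IsPO b c i' j') (a : Fin n → P) (g : P →₀ Additive G)
    (l : Q →₀ Additive G) (d : Fin k → Q) :
    mk R (i ∘ a) (g.mapDomain i + l.mapDomain j) (j ∘ d) =
      mk R' (i' ∘ a) (g.mapDomain i' + l.mapDomain j') (j' ∘ d) := by
  obtain ⟨e, h₁, h₂⟩ := h.exists_equiv h'
  refine mk_congr e (fun x => h₁ _) ?_ (fun x => h₂ _)
  rw [Finsupp.mapDomain_add, ← Finsupp.mapDomain_comp, ← Finsupp.mapDomain_comp]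
  congr 2
  · funext p; exact h₁ p
  · funext q; exact h₂ q

/-- Composition of labelled cospans by pushout; the labels that meet are multiplied. -/
noncomputable def comp {n m k : ℕ} : Hom G n m → Hom G m k → Hom G n k :=
  Quotient.lift₂ (fun A B => mk (PO A.2.2.2 B.2.1) (PO.inl A.2.2.2 B.2.1 ∘ A.2.1)
    (A.2.2.1.mapDomain (PO.inl _ _) + B.2.2.1.mapDomain (PO.inr _ _)) (PO.inr _ _ ∘ B.2.2.2)) (by
    rintro ⟨p, a, g, b⟩ ⟨q, c, l, d⟩ ⟨p', a', g', b'⟩ ⟨q', c', l', d'⟩ h h'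
    obtain ⟨e, rfl, rfl, rfl⟩ : ∃ e : Fin p ≃ Fin p', e ∘ a = a' ∧ g.mapDomain e = g' ∧ e ∘ b = b' := h
    obtain ⟨f, rfl, rfl, rfl⟩ :
      ∃ f : Fin q ≃ Fin q', f ∘ c = c' ∧ l.mapDomain f = l' ∧ f ∘ d = d' := h'
    dsimp only
    have h := mk_eq_of_isPO ((PO.isPO b c).congr_legs e f) (PO.isPO (e ∘ b) (f ∘ c)) (e ∘ a)
      (g.mapDomain e) (l.mapDomain f) (f ∘ d)
    rw [← h, ← Finsupp.mapDomain_comp, ← Finsupp.mapDomain_comp]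
    refine mk_congr (Equiv.refl _) (fun i => by simp) ?_ (fun i => by simp)
    simp [Function.comp_assoc, Finsupp.mapDomain_id])

/-- The composite can be computed with any pushout. -/
theorem comp_mk {n m k : ℕ} {P Q R : Type} [Finite P] [Finite Q] [Finite R]
    {b : Fin m → P} {c : Fin m → Q} {i : P → R} {j : Q → R} (h : IsPO b c i j)
    (a : Fin n → P) (g : P →₀ Additive G) (l : Q →₀ Additive G) (d : Fin k → Q) :
    comp (mk P a g b) (mk Q c l d) = mk R (i ∘ a) (g.mapDomain i + l.mapDomain j) (j ∘ d) := by
  let e := Finite.equivFin P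
  let f := Finite.equivFin Q
  refine (mk_eq_of_isPO (PO.isPO (e ∘ b) (f ∘ c)) (h.congr_legs e f) (e ∘ a)
      (g.mapDomain e) (l.mapDomain f) (f ∘ d)).trans ?_
  rw [← Finsupp.mapDomain_comp, ← Finsupp.mapDomain_comp]
  refine mk_congr (Equiv.refl _) (fun i => by simp) ?_ (fun i => by simp)
  simp [Function.comp_assoc, Finsupp.mapDomain_id]

/-- Juxtaposition of labelled cospans. -/
noncomputable def tensor {a b c d : ℕ} : Hom G a b → Hom G c d → Hom G (a + c) (b + d) :=
  Quotient.lift₂ (fun A B => mk (Fin A.1 ⊕ Fin B.1) (Sum.map A.2.1 B.2.1 ∘ finSumFinEquiv.symm)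
    (A.2.2.1.mapDomain Sum.inl + B.2.2.1.mapDomain Sum.inr)
    (Sum.map A.2.2.2 B.2.2.2 ∘ finSumFinEquiv.symm)) (by
    rintro ⟨p, a, g, b⟩ ⟨q, c, l, d⟩ ⟨p', a', g', b'⟩ ⟨q', c', l', d'⟩ h h'
    obtain ⟨e, rfl, rfl, rfl⟩ : ∃ e : Fin p ≃ Fin p', e ∘ a = a' ∧ g.mapDomain e = g' ∧ e ∘ b = b' := h
    obtain ⟨f, rfl, rfl, rfl⟩ :
      ∃ f : Fin q ≃ Fin q', f ∘ c = c' ∧ l.mapDomain f = l' ∧ f ∘ d = d' := h'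
    dsimp only
    refine mk_congr (e.sumCongr f) (fun i => by simp [Sum.map_map]) ?_
      (fun i => by simp [Sum.map_map])
    rw [Finsupp.mapDomain_add, ← Finsupp.mapDomain_comp, ← Finsupp.mapDomain_comp,
      ← Finsupp.mapDomain_comp, ← Finsupp.mapDomain_comp]
    rfl)

theorem tensor_mk {a b c d : ℕ} {P Q : Type} [Finite P] [Finite Q] (x : Fin a → P)
    (g : P →₀ Additive G) (y : Fin b → P) (z : Fin c → Q) (l : Q →₀ Additive G) (w : Fin d → Q) :
    tensor (mk P x g y) (mk Q z l w) = mk (P ⊕ Q) (Sum.map x z ∘ finSumFinEquiv.symm)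
      (g.mapDomain Sum.inl + l.mapDomain Sum.inr) (Sum.map y w ∘ finSumFinEquiv.symm) := by
  refine (mk_congr ((Finite.equivFin P).sumCongr (Finite.equivFin Q)) (fun i => ?_) ?_
    (fun i => ?_)).symm
  · simp [Sum.map_map]
  · rw [Finsupp.mapDomain_add, ← Finsupp.mapDomain_comp, ← Finsupp.mapDomain_comp,
      ← Finsupp.mapDomain_comp, ← Finsupp.mapDomain_comp]
    rfl
  · simp [Sum.map_map]

/-- The cospan of a bijection. -/
noncomputable def perm {n m : ℕ} (σ : Fin n ≃ Fin m) : Hom G n m := mk (Fin m) σ 0 _root_.id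

theorem perm_comp_mk {n m k : ℕ} (σ : Fin n ≃ Fin m) {P : Type} [Finite P] (a : Fin m → P)
    (g : P →₀ Additive G) (b : Fin k → P) : comp (perm σ) (mk P a g b) = mk P (a ∘ σ) g b := by
  rw [perm, comp_mk (IsPO.id_left a), Finsupp.mapDomain_zero, zero_add, Finsupp.mapDomain_id]
  rfl

theorem mk_comp_perm {n m k : ℕ} (σ : Fin m ≃ Fin k) {P : Type} [Finite P] (a : Fin n → P)
    (g : P →₀ Additive G) (b : Fin m → P) :
    comp (mk P a g b) (perm σ) = mk P a g (b ∘ σ.symm) := by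
  have h : (perm σ : Hom G m k) = mk (Fin m) _root_.id 0 σ.symm :=
    mk_congr σ.symm (by simp) (by simp) (by simp)
  rw [h, comp_mk (IsPO.id_right b), Finsupp.mapDomain_zero, add_zero, Finsupp.mapDomain_id]
  rfl

theorem sumAssoc_leg {n n' n'' : ℕ} {P P' P'' : Type} (x : Fin n → P) (x' : Fin n' → P')
    (x'' : Fin n'' → P'') (k : Fin (n + n' + n'')) :
    Equiv.sumAssoc P P' P'' ((Sum.map (Sum.map x x' ∘ finSumFinEquiv.symm) x'' ∘
        finSumFinEquiv.symm) k) =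
      ((Sum.map x (Sum.map x' x'' ∘ finSumFinEquiv.symm) ∘ finSumFinEquiv.symm) ∘
        finCongr (Nat.add_assoc n n' n'')) k := by
  induction k using Fin.addCases with
  | left k =>
    induction k using Fin.addCases with
    | left k =>
      have h : Fin.cast (Nat.add_assoc n n' n'') (Fin.castAdd n'' (Fin.castAdd n' k)) =
        Fin.castAdd (n' + n'') k := by ext; simp
      simp [h]
    | right k =>
      have h : Fin.cast (Nat.add_assoc n n' n'') (Fin.castAdd n'' (Fin.natAdd n k)) =
        Fin.natAdd n (Fin.castAdd n'' k) := by ext; simp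
      simp [h]
  | right k =>
    have h : Fin.cast (Nat.add_assoc n n' n'') (Fin.natAdd (n + n') k) =
      Fin.natAdd n (Fin.natAdd n' k) := by ext; simp [Nat.add_assoc]
    simp only [Function.comp_apply, finCongr_apply]
    rw [h]
    simp

theorem emptySum_leg {n : ℕ} {P : Type} (x : Fin n → P) (k : Fin (0 + n)) :
    Equiv.emptySum (Fin 0) P
        ((Sum.map (_root_.id : Fin 0 → Fin 0) x ∘ finSumFinEquiv.symm) k) =
      (x ∘ finCongr (Nat.zero_add n)) k := by
  induction k using Fin.addCases with
  | left k => exact k.elim0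
  | right k =>
    have h : finCongr (Nat.zero_add n) (Fin.natAdd 0 k) = k := by ext; simp
    rw [Function.comp_apply, Function.comp_apply, h, finSumFinEquiv_symm_apply_natAdd]
    simp

end LCospan

open LCospan in
/-- The PROP of labelled cospans. -/
noncomputable def LCospanPROP (G : Type u) [CommGroup G] : PROP.{u} where
  Hom := LCospan.Hom G
  perm := LCospan.perm
  comp := LCospan.comp
  tensor := LCospan.tensor
  comp_assoc x y z := by
    induction x using LCospan.ind with | _ p a g b => ?_
    induction y using LCospan.ind with | _ q c l d => ?_
    induction z using LCospan.ind with | _ r e t f => ?_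
    have h₁ := PO.isPO b c
    have h₂ := PO.isPO d e
    have h := PO.isPO (PO.inr b c) (PO.inl d e)
    rw [comp_mk h₁, comp_mk h₂, comp_mk (h₂.symm.paste h.symm).symm, comp_mk (h₁.paste h)]
    refine mk_congr (Equiv.refl _) (fun _ => rfl) ?_ (fun _ => rfl)
    simp only [Equiv.coe_refl, Finsupp.mapDomain_add,
      ← Finsupp.mapDomain_comp, add_assoc]
    rw [show PO.inl (PO.inr b c) (PO.inl d e) ∘ PO.inr b c =
      PO.inr (PO.inr b c) (PO.inl d e) ∘ PO.inl d e from funext h.comm]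
    rfl
  id_comp x := by
    induction x using LCospan.ind with | _ p a g b => exact perm_comp_mk _ _ _ _
  comp_id x := by
    induction x using LCospan.ind with | _ p a g b => exact mk_comp_perm _ _ _ _
  perm_trans σ τ := (perm_comp_mk σ τ 0 _root_.id).symm
  perm_blockSum σ τ := by
    rw [LCospan.perm, LCospan.perm, LCospan.perm, tensor_mk]
    refine mk_congr finSumFinEquiv.symm (fun i => ?_) (by simp) (fun i => ?_)
    · simp [blockSum]
    · simp
  comp_tensor_comp x y x' y' := by
    induction x using LCospan.ind with | _ p a g b => ?_
    induction y using LCospan.ind with | _ q c l d => ?_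
    induction x' using LCospan.ind with | _ p' a' g' b' => ?_
    induction y' using LCospan.ind with | _ q' c' l' d' => ?_
    have h := PO.isPO b c
    have h' := PO.isPO b' c'
    rw [comp_mk h, comp_mk h', tensor_mk, tensor_mk, tensor_mk,
      comp_mk ((h.sum h').precomp_equiv finSumFinEquiv.symm)]
    refine mk_congr (Equiv.refl _) (fun i => ?_) ?_ (fun i => ?_)
    · simp [Sum.map_map]
    · simp only [Equiv.coe_refl, Finsupp.mapDomain_add,
        ← Finsupp.mapDomain_comp]
      exact add_add_add_comm _ _ _ _
    · simp [Sum.map_map]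
  tensor_assoc {a b c d e i} f g h := by
    induction f using LCospan.ind with | _ p x f y => ?_
    induction g using LCospan.ind with | _ p' x' g y' => ?_
    induction h using LCospan.ind with | _ p'' x'' h y'' => ?_
    rw [tensor_mk, tensor_mk, tensor_mk, tensor_mk, mk_comp_perm, perm_comp_mk]
    refine mk_congr (Equiv.sumAssoc _ _ _) (fun k => ?_) ?_ (fun k => ?_)
    · exact LCospan.sumAssoc_leg x x' x'' k
    · simp only [Finsupp.mapDomain_add, ← Finsupp.mapDomain_comp, add_assoc]
      rfl
    · have h := LCospan.sumAssoc_leg y y' y'' ((finCongr (Nat.add_assoc b d i)).symm k)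
      rwa [Function.comp_apply (g := finCongr (Nat.add_assoc b d i)),
        Equiv.apply_symm_apply] at h
  id_tensor {a b} f := by
    induction f using LCospan.ind with | _ p x f y => ?_
    rw [LCospan.perm, tensor_mk, mk_comp_perm, perm_comp_mk]
    refine mk_congr (Equiv.emptySum _ _) (fun k => ?_) ?_ (fun k => ?_)
    · exact LCospan.emptySum_leg x k
    · rw [Finsupp.mapDomain_zero, zero_add, ← Finsupp.mapDomain_comp]
      exact Finsupp.mapDomain_id
    · have h := LCospan.emptySum_leg y ((finCongr (Nat.zero_add b)).symm k)
      rwa [Function.comp_apply (g := finCongr (Nat.zero_add b)), Equiv.apply_symm_apply] at h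
  tensor_id {a b} f := by
    induction f using LCospan.ind with | _ p x f y => ?_
    rw [LCospan.perm, tensor_mk]
    have leg : ∀ {n : ℕ} (x : Fin n → Fin p) (k : Fin n), Equiv.sumEmpty (Fin p) (Fin 0)
        (Sum.map x (_root_.id : Fin 0 → Fin 0) (finSumFinEquiv.symm (Fin.castAdd 0 k))) = x k := by
      intro n x k
      rw [finSumFinEquiv_symm_apply_castAdd]
      rfl
    refine mk_congr (Equiv.sumEmpty _ _) (fun k => leg x k) ?_ (fun k => leg y k)
    rw [Finsupp.mapDomain_zero, add_zero, ← Finsupp.mapDomain_comp]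
    exact Finsupp.mapDomain_id
  swap_natural {a b c d} f g := by
    induction f using LCospan.ind with | _ p x f y => ?_
    induction g using LCospan.ind with | _ p' x' g y' => ?_
    rw [tensor_mk, tensor_mk, mk_comp_perm, perm_comp_mk]
    have leg : ∀ {n m : ℕ} (x : Fin n → Fin p) (y : Fin m → Fin p') (k : Fin (n + m)),
        Equiv.sumComm _ _ (Sum.map x y (finSumFinEquiv.symm k)) =
          Sum.map y x (finSumFinEquiv.symm (finAddFlip k)) := by
      intro n m x y k
      refine Fin.addCases (fun k => ?_) (fun k => ?_) k <;> simp
    refine mk_congr (Equiv.sumComm _ _) (fun k => leg x x' k) ?_ (fun k => ?_)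
    · rw [Finsupp.mapDomain_add, ← Finsupp.mapDomain_comp, ← Finsupp.mapDomain_comp, add_comm]
      rfl
    · have h := leg y y' (finAddFlip.symm k)
      rwa [Equiv.apply_symm_apply] at h

/-! ### Functions and labels as labelled cospans -/

namespace LCospan

variable {G : Type u} [CommGroup G]

/-- The cospan `Fin n → Fin m = Fin m` of a function. -/
noncomputable def fwd {n m : ℕ} (f : Fin n → Fin m) : Hom G n m := mk (Fin m) f 0 _root_.id

/-- The cospan `Fin m = Fin m ← Fin n` of a function. -/
noncomputable def bwd {n m : ℕ} (f : Fin n → Fin m) : Hom G m n := mk (Fin m) _root_.id 0 f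

/-- The identity cospan with labels. -/
noncomputable def labels {m : ℕ} (g : Fin m →₀ Additive G) : Hom G m m :=
  mk (Fin m) _root_.id g _root_.id

theorem fwd_comp_mk {n m k : ℕ} (f : Fin n → Fin m) {P : Type} [Finite P] (a : Fin m → P)
    (g : P →₀ Additive G) (b : Fin k → P) : comp (fwd f) (mk P a g b) = mk P (a ∘ f) g b := by
  rw [fwd, comp_mk (IsPO.id_left a), Finsupp.mapDomain_zero, zero_add, Finsupp.mapDomain_id]
  rfl

theorem mk_comp_bwd {n m k : ℕ} (f : Fin k → Fin m) {P : Type} [Finite P] (a : Fin n → P)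
    (g : P →₀ Additive G) (b : Fin m → P) : comp (mk P a g b) (bwd f) = mk P a g (b ∘ f) := by
  rw [bwd, comp_mk (IsPO.id_right b), Finsupp.mapDomain_zero, add_zero, Finsupp.mapDomain_id]
  rfl

theorem labels_comp_mk {n m : ℕ} {P : Type} [Finite P] (l : Fin n →₀ Additive G) (a : Fin n → P)
    (g : P →₀ Additive G) (b : Fin m → P) :
    comp (labels l) (mk P a g b) = mk P a (l.mapDomain a + g) b := by
  rw [labels, comp_mk (IsPO.id_left a), Finsupp.mapDomain_id]
  rfl

theorem mk_comp_labels {n m : ℕ} {P : Type} [Finite P] (l : Fin m →₀ Additive G) (a : Fin n → P)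
    (g : P →₀ Additive G) (b : Fin m → P) :
    comp (mk P a g b) (labels l) = mk P a (g + l.mapDomain b) b := by
  rw [labels, comp_mk (IsPO.id_right b), Finsupp.mapDomain_id]
  rfl

/-- A function backwards followed by a function forwards is the pushout of the two. -/
theorem bwd_comp_fwd {n m k : ℕ} {R : Type} [Finite R] {f : Fin k → Fin n} {f' : Fin k → Fin m}
    {i : Fin n → R} {j : Fin m → R} (h : IsPO f f' i j) :
    comp (bwd f) (fwd f') = (mk R i 0 j : Hom G n m) := by
  rw [bwd, fwd, comp_mk h, Finsupp.mapDomain_zero, Finsupp.mapDomain_zero, add_zero]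
  rfl

theorem fwd_comp_bwd {n m k : ℕ} (f : Fin n → Fin k) (f' : Fin m → Fin k) :
    comp (fwd f) (bwd f') = (mk (Fin k) f 0 f' : Hom G n m) := by
  rw [bwd, fwd_comp_mk]
  rfl

theorem tensor_mk_fin {a b c d p q : ℕ} (x : Fin a → Fin p) (g : Fin p →₀ Additive G)
    (y : Fin b → Fin p) (z : Fin c → Fin q) (l : Fin q →₀ Additive G) (w : Fin d → Fin q) :
    tensor (mk (Fin p) x g y) (mk (Fin q) z l w) = mk (Fin (p + q)) (funSum x z)
      (g.mapDomain (Fin.castAdd q) + l.mapDomain (Fin.natAdd p)) (funSum y w) := by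
  rw [tensor_mk]
  refine mk_congr finSumFinEquiv (fun _ => rfl) ?_ (fun _ => rfl)
  rw [Finsupp.mapDomain_add, ← Finsupp.mapDomain_comp, ← Finsupp.mapDomain_comp]
  rfl

theorem funSum_id (a b : ℕ) : funSum (_root_.id : Fin a → Fin a) (_root_.id : Fin b → Fin b) =
    _root_.id := by
  funext i
  refine Fin.addCases (fun i => ?_) (fun i => ?_) i <;> simp

theorem tensor_labels {a b : ℕ} (l : Fin a →₀ Additive G) (l' : Fin b →₀ Additive G) :
    tensor (labels l) (labels l') =
      labels (l.mapDomain (Fin.castAdd b) + l'.mapDomain (Fin.natAdd a)) := by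
  rw [labels, labels, tensor_mk_fin, funSum_id]
  rfl

theorem mapDomain_fin_one (f : Fin 1 → Fin 1) (l : Fin 1 →₀ Additive G) : l.mapDomain f = l := by
  rw [Subsingleton.elim f _root_.id, Finsupp.mapDomain_id]

theorem labels_tensor_labels_comp_fwd (l l' : Fin 1 →₀ Additive G) :
    comp (tensor (labels l) (labels l')) (fwd fun _ : Fin (1 + 1) => (0 : Fin 1)) =
      comp (fwd fun _ => 0) (labels (l + l')) := by
  rw [tensor_labels, fwd, labels_comp_mk, mk_comp_labels, Finsupp.mapDomain_add,
    ← Finsupp.mapDomain_comp, ← Finsupp.mapDomain_comp, mapDomain_fin_one, mapDomain_fin_one,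
    Finsupp.mapDomain_id, add_comm 0]

theorem bwd_comp_labels_tensor_labels (l l' : Fin 1 →₀ Additive G) :
    comp (bwd fun _ : Fin (1 + 1) => (0 : Fin 1)) (tensor (labels l) (labels l')) =
      comp (labels (l + l')) (bwd fun _ => 0) := by
  rw [tensor_labels, bwd, labels_comp_mk, mk_comp_labels, Finsupp.mapDomain_add,
    ← Finsupp.mapDomain_comp, ← Finsupp.mapDomain_comp, mapDomain_fin_one, mapDomain_fin_one,
    Finsupp.mapDomain_id, add_comm 0]

theorem funSum_zero_id : funSum (fun _ : Fin 2 => (0 : Fin 1)) (_root_.id : Fin 1 → Fin 1) =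
    ![0, 0, 1] := by decide

theorem funSum_id_zero : funSum (_root_.id : Fin 1 → Fin 1) (fun _ : Fin 2 => (0 : Fin 1)) =
    ![0, 1, 1] := by decide

/-- The pushout behind the Frobenius equations. -/
theorem isPO_frob : IsPO (![0, 0, 1] : Fin 3 → Fin 2) (![0, 1, 1] : Fin 3 → Fin 2)
    (fun _ => (0 : Fin 1)) (fun _ => (0 : Fin 1)) where
  comm _ := rfl
  surj r := .inl ⟨0, Subsingleton.elim _ _⟩
  desc u v huv := by
    have h₀ : u 0 = v 0 := huv 0
    have h₁ : u 0 = v 1 := huv 1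
    have h₂ : u 1 = v 1 := huv 2
    refine ⟨fun _ => u 0, fun p => ?_, fun p => ?_⟩
    · fin_cases p
      · rfl
      · exact h₁.trans h₂.symm
    · fin_cases p
      · exact h₀
      · exact h₁

end LCospan

open LCospan

/-- Functions as labelled cospans. -/
noncomputable def FunPROP.fwd (G : Type u) [CommGroup G] : FunPROP.{u} ⟶ LCospanPROP G where
  map f := LCospan.fwd f.down
  map_perm _ := rfl
  map_comp f g := (fwd_comp_mk f.down g.down 0 _root_.id).symm
  map_tensor f g := by
    refine Eq.trans ?_ (tensor_mk_fin f.down 0 _root_.id g.down 0 _root_.id).symm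
    rw [Finsupp.mapDomain_zero, Finsupp.mapDomain_zero, add_zero, funSum_id]
    rfl

/-- Functions as labelled cospans in the opposite direction. -/
noncomputable def FunPROP.bwd (G : Type u) [CommGroup G] : FunPROP.{u} ⟶ (LCospanPROP G).op where
  map f := LCospan.bwd f.down
  map_perm σ := mk_congr σ.symm (fun _ => rfl) Finsupp.mapDomain_zero (fun i => σ.symm_apply_apply i)
  map_comp f g := (mk_comp_bwd f.down _root_.id 0 g.down).symm
  map_tensor f g := by
    refine Eq.trans ?_ (tensor_mk_fin _root_.id 0 f.down _root_.id 0 g.down).symm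
    rw [Finsupp.mapDomain_zero, Finsupp.mapDomain_zero, add_zero, funSum_id]
    rfl

namespace FrobPROP

variable (G : Type u) [CommGroup G]

/-- The interpretation of `FG` by labelled cospans. -/
noncomputable def toLCospan : FrobPROP G ⟶ LCospanPROP G :=
  PropPresentation.lift (pres := frobPresentation G) (LCospanPROP G)
    (fun {_ _} x => match x with
      | .mu => LCospan.fwd (fun _ => 0)
      | .eta => LCospan.fwd Fin.elim0
      | .phase g => labels (Finsupp.single 0 (Additive.ofMul g))
      | .delta => LCospan.bwd (fun _ => 0)
      | .epsilon => LCospan.bwd Fin.elim0)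
    (by
      let mu : FunPROP.{u}.Hom 2 1 := ⟨fun _ => 0⟩
      let eta : FunPROP.{u}.Hom 0 1 := ⟨Fin.elim0⟩
      -- An equation between functions holds for the cospans in both directions.
      have fwd_eq : ∀ {n m : ℕ} {f g : FunPROP.{u}.Hom n m}, f = g →
          PROP.map (FunPROP.fwd G) f = PROP.map (FunPROP.fwd G) g := fun h => h ▸ rfl
      have bwd_eq : ∀ {n m : ℕ} {f g : FunPROP.{u}.Hom n m}, f = g →
          PROP.map (FunPROP.bwd G) f = PROP.map (FunPROP.bwd G) g := fun h => h ▸ rfl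
      have one : ∀ {n : ℕ} (f g : FunPROP.{u}.Hom n 1), f = g := fun f g =>
        congrArg ULift.up (funext fun _ => Subsingleton.elim _ _)
      intro n m s t h
      cases h with
      | assoc =>
        have h := fwd_eq (one (FunPROP.comp (n := 3) (m := 2) (FunPROP.tensor mu (FunPROP.id 1)) mu)
          (FunPROP.comp (n := 3) (m := 2)
            (FunPROP.tensor (a := 1) (b := 1) (c := 2) (d := 1) (FunPROP.id 1) mu) mu))
        rw [PROP.map_comp, PROP.map_comp, PROP.map_tensor, PROP.map_tensor, PROP.map_id] at h
        exact h
      | unit =>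
        have h := fwd_eq (one (FunPROP.comp (n := 1) (FunPROP.tensor eta (FunPROP.id 1)) mu)
          (FunPROP.id 1))
        rw [PROP.map_comp, PROP.map_tensor, PROP.map_id] at h
        exact h
      | comm =>
        have h := fwd_eq (one (FunPROP.comp (n := 2) (FunPROP.perm (finAddFlip (m := 1) (n := 1))) mu) mu)
        rw [PROP.map_comp, PROP.map_perm] at h
        exact h
      | coassoc =>
        have h := bwd_eq (one (FunPROP.comp (n := 3) (m := 2) (FunPROP.tensor mu (FunPROP.id 1)) mu)
          (FunPROP.comp (n := 3) (m := 2)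
            (FunPROP.tensor (a := 1) (b := 1) (c := 2) (d := 1) (FunPROP.id 1) mu) mu))
        rw [PROP.map_comp, PROP.map_comp, PROP.map_tensor, PROP.map_tensor, PROP.map_id] at h
        exact h
      | counit =>
        have h := bwd_eq (one (FunPROP.comp (n := 1) (FunPROP.tensor eta (FunPROP.id 1)) mu)
          (FunPROP.id 1))
        rw [PROP.map_comp, PROP.map_tensor, PROP.map_id] at h
        exact h
      | cocomm =>
        exact mk_comp_perm (finAddFlip (m := 1) (n := 1)) (_root_.id : Fin 1 → Fin 1) 0 fun _ => 0
      | phase_mul g h =>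
        refine (labels_comp_mk _ _ _ _).trans ?_
        rw [Finsupp.mapDomain_id, ← Finsupp.single_add]
        rfl
      | phase_one => exact congrArg labels (Finsupp.single_zero _)
      | phase_mu g h =>
        exact (labels_tensor_labels_comp_fwd _ _).trans (congrArg (fun t => comp _ (labels t))
          (Finsupp.single_add 0 (Additive.ofMul g) (Additive.ofMul h)).symm)
      | phase_delta g h =>
        exact (bwd_comp_labels_tensor_labels _ _).trans (congrArg (fun t => comp (labels t) _)
          (Finsupp.single_add 0 (Additive.ofMul g) (Additive.ofMul h)).symm)
      | frob_left =>
        have e₁ := PROP.map_tensor (FunPROP.bwd G) mu (FunPROP.id 1)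
        have e₂ := PROP.map_tensor (FunPROP.fwd G) (FunPROP.id 1) mu
        rw [PROP.map_id] at e₁ e₂
        refine (congrArg₂ (comp (n := 2) (m := 3) (k := 2))
          (e₁.symm.trans (congrArg bwd funSum_zero_id))
          (e₂.symm.trans (congrArg fwd funSum_id_zero))).trans
          ((bwd_comp_fwd isPO_frob).trans (fwd_comp_bwd _ _).symm)
      | frob_right =>
        have e₁ := PROP.map_tensor (FunPROP.bwd G) (FunPROP.id 1) mu
        have e₂ := PROP.map_tensor (FunPROP.fwd G) mu (FunPROP.id 1)
        rw [PROP.map_id] at e₁ e₂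
        refine (congrArg₂ (comp (n := 2) (m := 3) (k := 2))
          (e₁.symm.trans (congrArg bwd funSum_id_zero))
          (e₂.symm.trans (congrArg fwd funSum_zero_id))).trans
          ((bwd_comp_fwd isPO_frob.symm).trans (fwd_comp_bwd _ _).symm)
      | special =>
        refine (bwd_comp_fwd (R := Fin 1) (i := _root_.id) (j := _root_.id) ?_)
        exact { comm := fun _ => rfl
                surj := fun r => .inl ⟨r, rfl⟩
                desc := fun u v huv => ⟨u, fun _ => rfl, fun q => by
                  rw [Subsingleton.elim q 0]; exact huv 0⟩ })

end FrobPROP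

/-! ### Distributive laws in terms of composable pairs -/

namespace PROP

variable {T S R : PROP.{u}}

/-- The class of a composable pair of morphisms of two PROPs. -/
def pair {n k m : ℕ} (x : T.Hom n k) (y : S.Hom k m) : (T.bimod ⊗ S.bimod).Hom n m :=
  PermBimod.pair (X := T.bimod) (Y := S.bimod) x y

theorem pair_ind {n m : ℕ} {p : (T.bimod ⊗ S.bimod).Hom n m → Prop}
    (h : ∀ (k : ℕ) (x : T.Hom n k) (y : S.Hom k m), p (pair x y))
    (z : (T.bimod ⊗ S.bimod).Hom n m) : p z :=
  PermBimod.CompHom.ind (X := T.bimod) (Y := S.bimod) h z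

theorem exists_pair {n m : ℕ} (z : (T.bimod ⊗ S.bimod).Hom n m) :
    ∃ (k : ℕ) (x : T.Hom n k) (y : S.Hom k m), z = pair x y :=
  pair_ind (p := fun z => ∃ (k : ℕ) (x : T.Hom n k) (y : S.Hom k m), z = pair x y)
    (fun k x y => ⟨k, x, y, rfl⟩) z

theorem pair_comp_perm {n k k' m : ℕ} (x : T.Hom n k) (σ : Fin k ≃ Fin k') (y : S.Hom k' m) :
    pair (T.comp x (T.perm σ)) y = pair x (S.comp (S.perm σ) y) :=
  PermBimod.pair_ract (X := T.bimod) (Y := S.bimod) x σ y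

/-- Beck's axioms, evaluated on composable pairs: the law exchanges with identities, and a
composite is moved past a morphism one factor at a time. -/
theorem isDistributiveLaw_iff (l : T.bimod ⊗ S.bimod ⟶ S.bimod ⊗ T.bimod) :
    IsDistributiveLaw T.bimod S.bimod l ↔
      (∀ {n m : ℕ} (s : S.Hom n m), PermBimod.app l (pair (T.id n) s) = pair s (T.id m)) ∧
      (∀ {n m : ℕ} (t : T.Hom n m), PermBimod.app l (pair t (S.id m)) = pair (S.id n) t) ∧
      (∀ {n a b c d m : ℕ} (t₁ : T.Hom n a) (t₂ : T.Hom a b) (s : S.Hom b m) (s' : S.Hom a c)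
        (t₂' : T.Hom c m) (s'' : S.Hom n d) (t₁' : T.Hom d c),
        PermBimod.app l (pair t₂ s) = pair s' t₂' → PermBimod.app l (pair t₁ s') = pair s'' t₁' →
        PermBimod.app l (pair (T.comp t₁ t₂) s) = pair s'' (T.comp t₁' t₂')) ∧
      (∀ {n a b c d m : ℕ} (t : T.Hom n a) (s₁ : S.Hom a b) (s₂ : S.Hom b m) (s₁' : S.Hom n c)
        (t' : T.Hom c b) (s₂' : S.Hom c d) (t'' : T.Hom d m),
        PermBimod.app l (pair t s₁) = pair s₁' t' → PermBimod.app l (pair t' s₂) = pair s₂' t'' →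
        PermBimod.app l (pair t (S.comp s₁ s₂)) = pair (S.comp s₁' s₂') t'') := by
  constructor
  · intro h
    refine ⟨?_, ?_, ?_, ?_⟩
    · intro n m s
      have e := congrArg (fun F => PermBimod.app F (PermBimod.pair (X := PermBimod.permBimod)
        (Y := S.bimod) (⟨Equiv.refl (Fin n)⟩ : PermBimod.permBimod.Hom n n) s)) h.unit_left
      refine Eq.trans e ?_
      change pair (S.comp (S.perm (Equiv.refl _)) s) (T.perm (Equiv.refl _)) = _
      rw [S.id_comp]
      rfl
    · intro n m t
      have e := congrArg (fun F => PermBimod.app F (PermBimod.pair (X := T.bimod)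
        (Y := PermBimod.permBimod) t (⟨Equiv.refl (Fin m)⟩ : PermBimod.permBimod.Hom m m)))
        h.unit_right
      refine Eq.trans e ?_
      change pair (S.perm (Equiv.refl _)) (T.comp t (T.perm (Equiv.refl _))) = _
      rw [T.comp_id]
      rfl
    · intro n a b c d m t₁ t₂ s s' t₂' s'' t₁' h₁ h₂
      have e := congrArg (fun F => PermBimod.app F (PermBimod.pair (X := T.bimod ⊗ T.bimod)
        (Y := S.bimod) (pair t₁ t₂) s)) h.mul_left
      refine Eq.trans e ?_
      change PermBimod.app ((α_ T.bimod S.bimod T.bimod).inv ≫ l ▷ T.bimod ≫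
        (α_ S.bimod T.bimod T.bimod).hom ≫ S.bimod ◁ μ[T.bimod])
          (PermBimod.pair (X := T.bimod) (Y := S.bimod ⊗ T.bimod) t₁
            (PermBimod.app l (pair t₂ s))) = _
      rw [h₁]
      change PermBimod.app ((α_ S.bimod T.bimod T.bimod).hom ≫ S.bimod ◁ μ[T.bimod])
          (PermBimod.pair (X := S.bimod ⊗ T.bimod) (Y := T.bimod)
            (PermBimod.app l (pair t₁ s')) t₂') = _
      rw [h₂]
      rfl
    · intro n a b c d m t s₁ s₂ s₁' t' s₂' t'' h₁ h₂
      have e := congrArg (fun F => PermBimod.app F (PermBimod.pair (X := T.bimod)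
        (Y := S.bimod ⊗ S.bimod) t (pair s₁ s₂))) h.mul_right
      refine Eq.trans e ?_
      change PermBimod.app ((α_ S.bimod T.bimod S.bimod).hom ≫ S.bimod ◁ l ≫
        (α_ S.bimod S.bimod T.bimod).inv ≫ μ[S.bimod] ▷ T.bimod)
          (PermBimod.pair (X := S.bimod ⊗ T.bimod) (Y := S.bimod)
            (PermBimod.app l (pair t s₁)) s₂) = _
      rw [h₁]
      change PermBimod.app ((α_ S.bimod S.bimod T.bimod).inv ≫ μ[S.bimod] ▷ T.bimod)
          (PermBimod.pair (X := S.bimod) (Y := S.bimod ⊗ T.bimod)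
            s₁' (PermBimod.app l (pair t' s₂))) = _
      rw [h₂]
      rfl
  · rintro ⟨h₁, h₂, h₃, h₄⟩
    refine ⟨?_, ?_, ?_, ?_⟩
    · ext n m z
      induction z using PermBimod.CompHom.ind with | _ k σ s => ?_
      have e := h₁ (S.comp (S.perm σ.down) s)
      refine Eq.trans (congrArg (PermBimod.app l) ?_) e
      exact (congrArg (fun t => pair t s) (T.id_comp' (T.perm σ.down))).symm.trans
        (pair_comp_perm (T.id _) σ.down s)
    · ext n m z
      induction z using PermBimod.CompHom.ind with | _ k t σ => ?_
      have e := h₂ (T.comp t (T.perm σ.down))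
      refine Eq.trans (congrArg (PermBimod.app l) ?_) e
      exact (congrArg (pair t) (S.comp_id' (S.perm σ.down))).symm.trans
        (pair_comp_perm t σ.down (S.id _)).symm
    · ext n m z
      induction z using PermBimod.CompHom.ind with | _ k w s => ?_
      induction w using PermBimod.CompHom.ind with | _ k' t₁ t₂ => ?_
      obtain ⟨c, s', t₂', e₁⟩ := exists_pair (PermBimod.app l (pair t₂ s))
      obtain ⟨d, s'', t₁', e₂⟩ := exists_pair (PermBimod.app l (pair t₁ s'))
      refine Eq.trans (h₃ t₁ t₂ s s' t₂' s'' t₁' e₁ e₂) ?_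
      change _ = PermBimod.app ((α_ T.bimod S.bimod T.bimod).inv ≫ l ▷ T.bimod ≫
        (α_ S.bimod T.bimod T.bimod).hom ≫ S.bimod ◁ μ[T.bimod])
          (PermBimod.pair (X := T.bimod) (Y := S.bimod ⊗ T.bimod) t₁
            (PermBimod.app l (pair t₂ s)))
      rw [e₁]
      change _ = PermBimod.app ((α_ S.bimod T.bimod T.bimod).hom ≫ S.bimod ◁ μ[T.bimod])
          (PermBimod.pair (X := S.bimod ⊗ T.bimod) (Y := T.bimod)
            (PermBimod.app l (pair t₁ s')) t₂')
      rw [e₂]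
      rfl
    · ext n m z
      induction z using PermBimod.CompHom.ind with | _ k t w => ?_
      induction w using PermBimod.CompHom.ind with | _ k' s₁ s₂ => ?_
      obtain ⟨c, s₁', t', e₁⟩ := exists_pair (PermBimod.app l (pair t s₁))
      obtain ⟨d, s₂', t'', e₂⟩ := exists_pair (PermBimod.app l (pair t' s₂))
      refine Eq.trans (h₄ t s₁ s₂ s₁' t' s₂' t'' e₁ e₂) ?_
      change _ = PermBimod.app ((α_ S.bimod T.bimod S.bimod).hom ≫ S.bimod ◁ l ≫
        (α_ S.bimod S.bimod T.bimod).inv ≫ μ[S.bimod] ▷ T.bimod)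
          (PermBimod.pair (X := S.bimod ⊗ T.bimod) (Y := S.bimod)
            (PermBimod.app l (pair t s₁)) s₂)
      rw [e₁]
      change _ = PermBimod.app ((α_ S.bimod S.bimod T.bimod).inv ≫ μ[S.bimod] ▷ T.bimod)
          (PermBimod.pair (X := S.bimod) (Y := S.bimod ⊗ T.bimod)
            s₁' (PermBimod.app l (pair t' s₂)))
      rw [e₂]
      rfl

/-- The map `S ; T ⟶ R` that composes the images in `R` of a morphism of `S` and one of `T`. -/
def compositeMap (j : S ⟶ R) (i : T ⟶ R) : S.bimod ⊗ T.bimod ⟶ R.bimod :=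
  (bimodMap j ⊗ₘ bimodMap i) ≫ μ[R.bimod]

@[simp] theorem compositeMap_pair (j : S ⟶ R) (i : T ⟶ R) {n k m : ℕ} (s : S.Hom n k)
    (t : T.Hom k m) :
    PermBimod.app (compositeMap j i) (pair s t) = R.comp (map j s) (map i t) := rfl

/-- If the morphisms of `R` of the form `S` followed by `T` decompose uniquely, and those of the
form `T` followed by `S` can be rewritten in that form, then the rewriting is a distributive
law. -/
theorem exists_isDistributiveLaw (i : T ⟶ R) (j : S ⟶ R)
    (inj : ∀ {n m : ℕ} (z w : (S.bimod ⊗ T.bimod).Hom n m),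
      PermBimod.app (compositeMap j i) z = PermBimod.app (compositeMap j i) w → z = w)
    (ex : ∀ {n k m : ℕ} (t : T.Hom n k) (s : S.Hom k m), ∃ z : (S.bimod ⊗ T.bimod).Hom n m,
      PermBimod.app (compositeMap j i) z = R.comp (map i t) (map j s)) :
    ∃ l : T.bimod ⊗ S.bimod ⟶ S.bimod ⊗ T.bimod, IsDistributiveLaw T.bimod S.bimod l ∧
      l ≫ compositeMap j i = compositeMap i j := by
  have ex' : ∀ {n m : ℕ} (w : (T.bimod ⊗ S.bimod).Hom n m), ∃ z : (S.bimod ⊗ T.bimod).Hom n m,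
      PermBimod.app (compositeMap j i) z = PermBimod.app (compositeMap i j) w := by
    intro n m w
    obtain ⟨k, t, s, rfl⟩ := exists_pair w
    exact ex t s
  choose f hf using @ex'
  let l : T.bimod ⊗ S.bimod ⟶ S.bimod ⊗ T.bimod :=
    { app := fun w => f w
      app_lact := fun σ w => inj _ _ (by
        rw [PermBimod.map_lact, hf, hf, PermBimod.map_lact])
      app_ract := fun w σ => inj _ _ (by
        rw [PermBimod.map_ract, hf, hf, PermBimod.map_ract])
      app_unit := inj _ _ (by rw [PermBimod.map_unit, hf, PermBimod.map_unit])
      app_tensor := fun w w' => inj _ _ (by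
        rw [PermBimod.map_tensor, hf, hf, hf, PermBimod.map_tensor]) }
  have hl : ∀ {n m : ℕ} (w : (T.bimod ⊗ S.bimod).Hom n m),
      PermBimod.app (compositeMap j i) (PermBimod.app l w) =
        PermBimod.app (compositeMap i j) w := fun w => hf w
  refine ⟨l, (isDistributiveLaw_iff l).2 ⟨?_, ?_, ?_, ?_⟩, ?_⟩
  · intro n m s
    refine inj _ _ ((hl _).trans ?_)
    rw [compositeMap_pair, compositeMap_pair, map_id, map_id, R.id_comp', R.comp_id']
  · intro n m t
    refine inj _ _ ((hl _).trans ?_)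
    rw [compositeMap_pair, compositeMap_pair, map_id, map_id, R.id_comp', R.comp_id']
  · intro n a b c d m t₁ t₂ s s' t₂' s'' t₁' h₁ h₂
    refine inj _ _ ((hl _).trans ?_)
    have e₁ := hl (pair t₂ s)
    have e₂ := hl (pair t₁ s')
    rw [h₁, compositeMap_pair, compositeMap_pair] at e₁
    rw [h₂, compositeMap_pair, compositeMap_pair] at e₂
    rw [compositeMap_pair, compositeMap_pair, map_comp, map_comp, R.comp_assoc, ← e₁,
      ← R.comp_assoc, ← e₂, R.comp_assoc]
  · intro n a b c d m t s₁ s₂ s₁' t' s₂' t'' h₁ h₂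
    refine inj _ _ ((hl _).trans ?_)
    have e₁ := hl (pair t s₁)
    have e₂ := hl (pair t' s₂)
    rw [h₁, compositeMap_pair, compositeMap_pair] at e₁
    rw [h₂, compositeMap_pair, compositeMap_pair] at e₂
    rw [compositeMap_pair, compositeMap_pair, map_comp, map_comp, ← R.comp_assoc, ← e₁,
      R.comp_assoc, ← e₂, ← R.comp_assoc]
  · ext n m w
    exact hl w

/-- A property of composable pairs `(t, s)` that can be established along the axioms of a
distributive law `l`. -/
structure LawStable (l : T.bimod ⊗ S.bimod ⟶ S.bimod ⊗ T.bimod)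
    (E : ∀ {n k m : ℕ}, T.Hom n k → S.Hom k m → Prop) : Prop where
  id_left {n m : ℕ} (s : S.Hom n m) : E (T.id n) s
  id_right {n m : ℕ} (t : T.Hom n m) : E t (S.id m)
  middle {n k k' m : ℕ} (t : T.Hom n k) (σ : Fin k ≃ Fin k') (s : S.Hom k' m) :
    E (T.comp t (T.perm σ)) s ↔ E t (S.comp (S.perm σ) s)
  tensor {a b c a' b' c' : ℕ} {t : T.Hom a b} {s : S.Hom b c} {t' : T.Hom a' b'}
    {s' : S.Hom b' c'} : E t s → E t' s' → E (T.tensor t t') (S.tensor s s')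
  mul_left {n a b c m : ℕ} {t₁ : T.Hom n a} {t₂ : T.Hom a b} {s : S.Hom b m} {s' : S.Hom a c}
    {t₂' : T.Hom c m} : E t₂ s → PermBimod.app l (pair t₂ s) = pair s' t₂' → E t₁ s' →
    E (T.comp t₁ t₂) s
  mul_right {n a b c m : ℕ} {t : T.Hom n a} {s₁ : S.Hom a b} {s₂ : S.Hom b m} {s₁' : S.Hom n c}
    {t' : T.Hom c b} : E t s₁ → PermBimod.app l (pair t s₁) = pair s₁' t' → E t' s₂ →
    E t (S.comp s₁ s₂)

namespace LawStable

variable {l : T.bimod ⊗ S.bimod ⟶ S.bimod ⊗ T.bimod}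
  {E : ∀ {n k m : ℕ}, T.Hom n k → S.Hom k m → Prop}

theorem perm_left (h : LawStable l E) {n k m : ℕ} (σ : Fin n ≃ Fin k) (s : S.Hom k m) :
    E (T.perm σ) s := by
  have := (h.middle (T.id n) σ s).2 (h.id_left _)
  rwa [T.id_comp'] at this

theorem perm_right (h : LawStable l E) {n k m : ℕ} (t : T.Hom n k) (σ : Fin k ≃ Fin m) :
    E t (S.perm σ) := by
  have := (h.middle t σ (S.id m)).1 (h.id_right _)
  rwa [S.comp_id'] at this

theorem perm_comp (h : LawStable l E) {n k k' m : ℕ} (σ : Fin n ≃ Fin k) {t : T.Hom k k'}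
    {s : S.Hom k' m} (hE : E t s) : E (T.comp (T.perm σ) t) s := by
  obtain ⟨c, s', t', e⟩ := exists_pair (PermBimod.app l (pair t s))
  exact h.mul_left hE e (h.perm_left _ _)

theorem comp_perm (h : LawStable l E) {n k k' m : ℕ} {t : T.Hom n k} {s : S.Hom k k'}
    (σ : Fin k' ≃ Fin m) (hE : E t s) : E t (S.comp s (S.perm σ)) := by
  obtain ⟨c, s', t', e⟩ := exists_pair (PermBimod.app l (pair t s))
  exact h.mul_right hE e (h.perm_right _ _)

/-- Agreement with another distributive law. -/
theorem of_isDistributiveLaw {l' : T.bimod ⊗ S.bimod ⟶ S.bimod ⊗ T.bimod}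
    (hl : IsDistributiveLaw T.bimod S.bimod l) (hl' : IsDistributiveLaw T.bimod S.bimod l') :
    LawStable l fun t s => PermBimod.app l' (pair t s) = PermBimod.app l (pair t s) := by
  rw [isDistributiveLaw_iff] at hl hl'
  obtain ⟨h₁, h₂, h₃, h₄⟩ := hl
  obtain ⟨h₁', h₂', h₃', h₄'⟩ := hl'
  refine ⟨?_, ?_, ?_, ?_, ?_, ?_⟩
  · intro n m s; rw [h₁, h₁']
  · intro n m t; rw [h₂, h₂']
  · intro n k k' m t σ s; rw [pair_comp_perm]
  · intro a b c a' b' c' t s t' s' e e'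
    have h := PermBimod.map_tensor l (pair t s) (pair t' s')
    rw [← e, ← e', ← PermBimod.map_tensor] at h
    exact h.symm
  · intro n a b c m t₁ t₂ s s' t₂' e e₁ e'
    obtain ⟨d, s'', t₁', e₂⟩ := exists_pair (PermBimod.app l (pair t₁ s'))
    rw [h₃ _ _ _ _ _ _ _ e₁ e₂, h₃' _ _ _ _ _ _ _ (e.trans e₁) (e'.trans e₂)]
  · intro n a b c m t s₁ s₂ s₁' t' e e₁ e'
    obtain ⟨d, s₂', t'', e₂⟩ := exists_pair (PermBimod.app l (pair t' s₂))
    rw [h₄ _ _ _ _ _ _ _ e₁ e₂, h₄' _ _ _ _ _ _ _ (e.trans e₁) (e'.trans e₂)]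

/-- Validity of the law in a PROP that receives both PROPs. -/
theorem of_map (hl : IsDistributiveLaw T.bimod S.bimod l) (i : T ⟶ R) (j : S ⟶ R) :
    LawStable l fun t s => PermBimod.app (compositeMap j i) (PermBimod.app l (pair t s)) =
      R.comp (map i t) (map j s) := by
  rw [isDistributiveLaw_iff] at hl
  obtain ⟨h₁, h₂, h₃, h₄⟩ := hl
  refine ⟨?_, ?_, ?_, ?_, ?_, ?_⟩
  · intro n m s; rw [h₁, compositeMap_pair, map_id, map_id, R.id_comp', R.comp_id']
  · intro n m t; rw [h₂, compositeMap_pair, map_id, map_id, R.id_comp', R.comp_id']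
  · intro n k k' m t σ s
    rw [pair_comp_perm, map_comp, map_comp, map_perm, map_perm, R.comp_assoc]
  · intro a b c a' b' c' t s t' s' e e'
    have h := PermBimod.map_tensor (l ≫ compositeMap j i) (pair t s) (pair t' s')
    refine h.trans ((congrArg₂ R.tensor e e').trans ?_)
    rw [map_tensor, map_tensor, R.comp_tensor_comp]
  · intro n a b c m t₁ t₂ s s' t₂' e e₁ e'
    obtain ⟨d, s'', t₁', e₂⟩ := exists_pair (PermBimod.app l (pair t₁ s'))
    rw [e₁, compositeMap_pair] at e
    rw [e₂, compositeMap_pair] at e'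
    rw [h₃ _ _ _ _ _ _ _ e₁ e₂, compositeMap_pair, map_comp, map_comp, R.comp_assoc, ← e,
      ← R.comp_assoc, e', R.comp_assoc]
  · intro n a b c m t s₁ s₂ s₁' t' e e₁ e'
    obtain ⟨d, s₂', t'', e₂⟩ := exists_pair (PermBimod.app l (pair t' s₂))
    rw [e₁, compositeMap_pair] at e
    rw [e₂, compositeMap_pair] at e'
    rw [h₄ _ _ _ _ _ _ _ e₁ e₂, compositeMap_pair, map_comp, map_comp, ← R.comp_assoc, ← e,
      R.comp_assoc, e', R.comp_assoc]

end LawStable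

end PROP

/-! ### The labelled cospans of morphisms of `M`, `PG` and `C` -/

namespace FrobPROP

open LCospan

variable (G : Type u) [CommGroup G]

/-- The interpretation of `M` by labelled cospans. -/
noncomputable def cospanM : CMonPROP.{u} ⟶ LCospanPROP G := inclM G ≫ toLCospan G

/-- The interpretation of `PG` by labelled cospans. -/
noncomputable def cospanP : PhasePROP G ⟶ LCospanPROP G := inclP G ≫ toLCospan G

/-- The interpretation of `C` by labelled cospans. -/
noncomputable def cospanC : CComonPROP.{u} ⟶ LCospanPROP G := inclC G ≫ toLCospan G

theorem map_cospanM {n m : ℕ} (f : CMonPROP.{u}.Hom n m) :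
    PROP.map (cospanM G) f = fwd (CMonPROP.toFun f) := by
  have h : cospanM G = CMonPROP.toFunPROP ≫ FunPROP.fwd G := by
    refine PropPresentation.hom_ext (pres := cmonPresentation) fun n m x => ?_
    cases x <;> rfl
  exact congrArg (fun F : CMonPROP.{u} ⟶ LCospanPROP G => PROP.map F f) h

theorem map_cospanC {n m : ℕ} (f : CMonPROP.{u}.Hom m n) :
    PROP.map (cospanC G) (n := n) (m := m) f = bwd (CMonPROP.toFun f) := by
  let F : CMonPROP.{u} ⟶ (LCospanPROP G).op :=
    { map := fun {n m} f => PROP.map (cospanC G) (n := m) (m := n) f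
      map_perm := fun σ => PROP.map_perm (cospanC G) σ.symm
      map_comp := fun f g => PROP.map_comp (cospanC G) (T := CComonPROP.{u}) g f
      map_tensor := fun f g => PROP.map_tensor (cospanC G) (T := CComonPROP.{u}) f g }
  have h : F = CMonPROP.toFunPROP ≫ FunPROP.bwd G := by
    refine PropPresentation.hom_ext (pres := cmonPresentation) fun n m x => ?_
    cases x <;> rfl
  exact congrArg (fun F : CMonPROP.{u} ⟶ (LCospanPROP G).op => PROP.map F f) h

variable {G}

/-- A vector of group elements as a finitely supported family of labels. -/
noncomputable def labelling {m : ℕ} (g : Fin m → G) : Fin m →₀ Additive G :=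
  Finsupp.equivFunOnFinite.symm fun i => Additive.ofMul (g i)

theorem labelling_injective {m : ℕ} : Function.Injective (labelling (G := G) (m := m)) :=
  fun _ _ h => funext fun i => congrArg Additive.toMul (DFunLike.congr_fun h i)

theorem exists_labelling {m : ℕ} (l : Fin m →₀ Additive G) : ∃ g : Fin m → G, labelling g = l :=
  ⟨fun i => (l i).toMul, by ext i; rfl⟩

theorem labelling_comp {n m : ℕ} (e : Fin n ≃ Fin m) (g : Fin m → G) :
    (labelling (g ∘ e)).mapDomain e = labelling g := by
  ext i
  obtain ⟨j, rfl⟩ := e.surjective i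
  rw [Finsupp.mapDomain_apply e.injective]
  rfl

theorem map_cospanP {m : ℕ} (g : Fin m → G) :
    PROP.map (cospanP G) (PhasePROP.diag g) = labels (labelling g) := by
  induction m with
  | zero =>
    refine (PROP.map_id (cospanP G) 0).trans ?_
    exact congrArg labels (Subsingleton.elim _ _)
  | succ m ih =>
    rw [PhasePROP.diag_succ, PROP.map_tensor, ih]
    refine (tensor_labels (labelling fun i : Fin m => g i.castSucc)
      (Finsupp.single (0 : Fin 1) (Additive.ofMul (g (Fin.last m))))).trans ?_
    congr 1
    ext i
    refine Fin.lastCases ?_ (fun i => ?_) i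
    · rw [Finsupp.add_apply, Finsupp.mapDomain_of_notMem_range, Finsupp.mapDomain_single]
      · rw [zero_add]
        exact congrArg Additive.toMul (Finsupp.single_eq_same (a := Fin.last m)
          (b := Additive.ofMul (g (Fin.last m))))
      · rintro ⟨j, hj⟩
        exact (Fin.castSucc_lt_last j).ne hj
    · rw [Finsupp.add_apply, Finsupp.mapDomain_single]
      have h₁ : (Finsupp.single (Fin.natAdd m (0 : Fin 1)) (Additive.ofMul (g (Fin.last m))))
          i.castSucc = 0 := Finsupp.single_eq_of_ne (Fin.castSucc_lt_last i).ne
      have h₂ := Finsupp.mapDomain_apply (Fin.castAdd_injective m 1)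
        (labelling fun i : Fin m => g i.castSucc) i
      rw [h₁, add_zero]
      exact h₂

end FrobPROP

/-! ### Normal forms of composable pairs and triples -/

namespace CMonPROP

theorem ofFun_comp_perm {n m k : ℕ} (a : Fin n → Fin m) (e : Fin m ≃ Fin k) :
    CMonPROP.comp (ofFun a) (CMonPROP.perm e) = ofFun.{u} (e ∘ a) := ofFun_comp _ _

end CMonPROP

/-- The morphism of `C` given by a function in the opposite direction. -/
def CComonPROP.ofFun {n m : ℕ} (b : Fin m → Fin n) : CComonPROP.{u}.Hom n m := CMonPROP.ofFun b

namespace CComonPROP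

theorem perm_comp_ofFun {n m k : ℕ} (e : Fin n ≃ Fin m) (b : Fin k → Fin m) :
    CComonPROP.comp (CComonPROP.perm e) (ofFun b) = ofFun.{u} (e.symm ∘ b) :=
  CMonPROP.ofFun_comp_perm b e.symm

theorem exists_eq_ofFun {n m : ℕ} (c : CComonPROP.{u}.Hom n m) :
    ∃ b : Fin m → Fin n, c = ofFun b :=
  ⟨CMonPROP.toFun c, (CMonPROP.ofFun_toFun (n := m) (m := n) c).symm⟩

end CComonPROP

namespace CMonPROP

theorem exists_eq_ofFun {n m : ℕ} (c : CMonPROP.{u}.Hom n m) :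
    ∃ b : Fin n → Fin m, c = ofFun b := ⟨toFun c, (ofFun_toFun c).symm⟩

end CMonPROP

namespace PhasePROP

variable {G : Type u} [CommGroup G]

theorem exists_eq_diag_comp_perm {n m : ℕ} (x : (PhasePROP G).Hom n m) :
    ∃ (σ : Fin n ≃ Fin m) (g : Fin n → G),
      x = (PhasePROP G).comp (diag g) ((PhasePROP G).perm σ) := by
  obtain ⟨σ, g, rfl⟩ := exists_eq_perm_comp_diag x
  refine ⟨σ, g ∘ σ, ?_⟩
  rw [diag_comp_perm]
  congr 2
  funext i
  simp

end PhasePROP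

namespace FrobPROP

open LCospan PROP

variable {G : Type u} [CommGroup G]

theorem map_cospanM_ofFun {n m : ℕ} (a : Fin n → Fin m) :
    PROP.map (cospanM G) (CMonPROP.ofFun a) = fwd a := by
  rw [map_cospanM, CMonPROP.toFun_ofFun]

theorem map_cospanC_ofFun {n m : ℕ} (b : Fin m → Fin n) :
    PROP.map (cospanC G) (CComonPROP.ofFun b) = bwd b :=
  (map_cospanC G (CMonPROP.ofFun b)).trans (by rw [CMonPROP.toFun_ofFun])

/-- A pair in `M ; C` amounts to a cospan of finite ordinals up to permutation of the apex. -/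
theorem compositeMap_cospan_injective_MC {n m : ℕ}
    (z w : (CMonPROP.{u}.bimod ⊗ CComonPROP.{u}.bimod).Hom n m)
    (h : PermBimod.app (compositeMap (cospanM G) (cospanC G)) z =
      PermBimod.app (compositeMap (cospanM G) (cospanC G)) w) : z = w := by
  obtain ⟨k, x, c, rfl⟩ := exists_pair z
  obtain ⟨k', x', c', rfl⟩ := exists_pair w
  obtain ⟨a, rfl⟩ := CMonPROP.exists_eq_ofFun x
  obtain ⟨a', rfl⟩ := CMonPROP.exists_eq_ofFun x'
  obtain ⟨b, rfl⟩ := CComonPROP.exists_eq_ofFun c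
  obtain ⟨b', rfl⟩ := CComonPROP.exists_eq_ofFun c'
  rw [compositeMap_pair, compositeMap_pair, map_cospanM_ofFun, map_cospanM_ofFun,
    map_cospanC_ofFun, map_cospanC_ofFun] at h
  obtain ⟨e, h₁, -, h₂⟩ := mk_eq_mk_iff.1
    ((fwd_comp_bwd a b).symm.trans (h.trans (fwd_comp_bwd a' b')))
  obtain rfl : e ∘ a = a' := funext h₁
  obtain rfl : e ∘ b = b' := funext h₂
  rw [← CMonPROP.ofFun_comp_perm, pair_comp_perm, CComonPROP.perm_comp_ofFun]
  congr 2
  funext i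
  simp

/-- The labelled cospan of a pair in `M ; PG` has an identity as its second leg, so it determines
the function and the vector of phases. -/
theorem compositeMap_cospan_injective_MP {n m : ℕ}
    (z w : (CMonPROP.{u}.bimod ⊗ (PhasePROP G).bimod).Hom n m)
    (h : PermBimod.app (compositeMap (cospanM G) (cospanP G)) z =
      PermBimod.app (compositeMap (cospanM G) (cospanP G)) w) : z = w := by
  have nf : ∀ z : (CMonPROP.{u}.bimod ⊗ (PhasePROP G).bimod).Hom n m,
      ∃ (a : Fin n → Fin m) (g : Fin m → G), z = pair (CMonPROP.ofFun a) (PhasePROP.diag g) := by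
    intro z
    obtain ⟨k, x, p, rfl⟩ := exists_pair z
    obtain ⟨a, rfl⟩ := CMonPROP.exists_eq_ofFun x
    obtain ⟨σ, g, rfl⟩ := PhasePROP.exists_eq_perm_comp_diag p
    exact ⟨σ ∘ a, g, by rw [← pair_comp_perm, CMonPROP.ofFun_comp_perm]⟩
  obtain ⟨a, g, rfl⟩ := nf z
  obtain ⟨a', g', rfl⟩ := nf w
  rw [compositeMap_pair, compositeMap_pair, map_cospanM_ofFun, map_cospanM_ofFun,
    map_cospanP, map_cospanP] at h
  obtain ⟨e, h₁, h₂, h₃⟩ := mk_eq_mk_iff.1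
    ((fwd_comp_mk a _ _ _).symm.trans (h.trans (fwd_comp_mk a' _ _ _)))
  obtain rfl : e = Equiv.refl _ := Equiv.ext h₃
  obtain rfl : a = a' := funext h₁
  obtain rfl : g = g' := labelling_injective (Finsupp.mapDomain_id.symm.trans h₂)
  rfl

theorem compositeMap_cospan_injective_PC {n m : ℕ}
    (z w : ((PhasePROP G).bimod ⊗ CComonPROP.{u}.bimod).Hom n m)
    (h : PermBimod.app (compositeMap (cospanP G) (cospanC G)) z =
      PermBimod.app (compositeMap (cospanP G) (cospanC G)) w) : z = w := by
  have nf : ∀ z : ((PhasePROP G).bimod ⊗ CComonPROP.{u}.bimod).Hom n m,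
      ∃ (g : Fin n → G) (b : Fin m → Fin n), z = pair (PhasePROP.diag g) (CComonPROP.ofFun b) := by
    intro z
    obtain ⟨k, p, c, rfl⟩ := exists_pair z
    obtain ⟨b, rfl⟩ := CComonPROP.exists_eq_ofFun c
    obtain ⟨σ, g, rfl⟩ := PhasePROP.exists_eq_diag_comp_perm p
    exact ⟨g, σ.symm ∘ b, by rw [pair_comp_perm, CComonPROP.perm_comp_ofFun]⟩
  obtain ⟨g, b, rfl⟩ := nf z
  obtain ⟨g', b', rfl⟩ := nf w
  rw [compositeMap_pair, compositeMap_pair, map_cospanC_ofFun, map_cospanC_ofFun,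
    map_cospanP, map_cospanP] at h
  obtain ⟨e, h₁, h₂, h₃⟩ := mk_eq_mk_iff.1
    ((mk_comp_bwd b _ _ _).symm.trans (h.trans (mk_comp_bwd b' _ _ _)))
  obtain rfl : e = Equiv.refl _ := Equiv.ext h₁
  obtain rfl : b = b' := funext h₃
  obtain rfl : g = g' := labelling_injective (Finsupp.mapDomain_id.symm.trans h₂)
  rfl

/-- The pushout of two functions between finite ordinals can be taken to be a finite ordinal. -/
theorem exists_compositeMap_cospan_MC {n k m : ℕ} (c : CComonPROP.{u}.Hom n k)
    (x : CMonPROP.{u}.Hom k m) : ∃ z : (CMonPROP.{u}.bimod ⊗ CComonPROP.{u}.bimod).Hom n m,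
      PermBimod.app (compositeMap (cospanM G) (cospanC G)) z =
        (LCospanPROP G).comp (PROP.map (cospanC G) c) (PROP.map (cospanM G) x) := by
  obtain ⟨a, rfl⟩ := CMonPROP.exists_eq_ofFun x
  obtain ⟨b, rfl⟩ := CComonPROP.exists_eq_ofFun c
  let e := Finite.equivFin (PO b a)
  refine ⟨pair (CMonPROP.ofFun (e ∘ PO.inl b a)) (CComonPROP.ofFun (e ∘ PO.inr b a)), ?_⟩
  rw [compositeMap_pair, map_cospanM_ofFun, map_cospanC_ofFun, map_cospanM_ofFun,
    map_cospanC_ofFun]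
  refine (fwd_comp_bwd _ _).trans (Eq.trans ?_ (bwd_comp_fwd (PO.isPO b a)).symm)
  exact (mk_congr e (fun _ => rfl) Finsupp.mapDomain_zero (fun _ => rfl)).symm

/-- Phases are moved past a function by multiplying the phases in each fibre. -/
theorem exists_compositeMap_cospan_MP {n k m : ℕ} (p : (PhasePROP G).Hom n k)
    (x : CMonPROP.{u}.Hom k m) : ∃ z : (CMonPROP.{u}.bimod ⊗ (PhasePROP G).bimod).Hom n m,
      PermBimod.app (compositeMap (cospanM G) (cospanP G)) z =
        (LCospanPROP G).comp (PROP.map (cospanP G) p) (PROP.map (cospanM G) x) := by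
  obtain ⟨a, rfl⟩ := CMonPROP.exists_eq_ofFun x
  obtain ⟨σ, g, rfl⟩ := PhasePROP.exists_eq_perm_comp_diag p
  obtain ⟨g', hg'⟩ := exists_labelling ((labelling g).mapDomain a)
  refine ⟨pair (CMonPROP.ofFun (a ∘ σ)) (PhasePROP.diag g'), ?_⟩
  rw [compositeMap_pair, PROP.map_comp, PROP.comp_assoc, map_cospanP, map_cospanP,
    map_cospanM_ofFun, map_cospanM_ofFun, PROP.map_perm, hg']
  refine (fwd_comp_mk _ _ _ _).trans (Eq.symm ?_)
  refine (congrArg (LCospan.comp (LCospan.perm σ)) (labels_comp_mk _ _ _ _)).trans ?_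
  refine (perm_comp_mk _ _ _ _).trans ?_
  rw [add_zero]
  rfl

theorem exists_compositeMap_cospan_PC {n k m : ℕ} (c : CComonPROP.{u}.Hom n k)
    (p : (PhasePROP G).Hom k m) : ∃ z : ((PhasePROP G).bimod ⊗ CComonPROP.{u}.bimod).Hom n m,
      PermBimod.app (compositeMap (cospanP G) (cospanC G)) z =
        (LCospanPROP G).comp (PROP.map (cospanC G) c) (PROP.map (cospanP G) p) := by
  obtain ⟨b, rfl⟩ := CComonPROP.exists_eq_ofFun c
  obtain ⟨σ, g, rfl⟩ := PhasePROP.exists_eq_diag_comp_perm p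
  obtain ⟨g', hg'⟩ := exists_labelling ((labelling g).mapDomain b)
  refine ⟨pair (PhasePROP.diag g') (CComonPROP.ofFun (b ∘ σ.symm)), ?_⟩
  rw [compositeMap_pair, PROP.map_comp, ← PROP.comp_assoc, map_cospanP, map_cospanP,
    map_cospanC_ofFun, map_cospanC_ofFun, PROP.map_perm, hg']
  refine (mk_comp_bwd _ _ _ _).trans (Eq.symm ?_)
  refine (congrArg (fun t => LCospan.comp t (LCospan.perm σ)) (mk_comp_labels _ _ _ _)).trans ?_
  refine (mk_comp_perm _ _ _ _).trans ?_
  rw [zero_add]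
  rfl

/-- The class of a composable triple. -/
def triple {n k k' m : ℕ} (x : CMonPROP.{u}.Hom n k) (p : (PhasePROP G).Hom k k')
    (c : CComonPROP.{u}.Hom k' m) :
    (CMonPROP.{u}.bimod ⊗ ((PhasePROP G).bimod ⊗ CComonPROP.{u}.bimod)).Hom n m :=
  PermBimod.pair (X := CMonPROP.{u}.bimod)
    (Y := (PhasePROP G).bimod ⊗ CComonPROP.{u}.bimod) x (pair p c)

theorem triple_comp_perm {n k l k' m : ℕ} (x : CMonPROP.{u}.Hom n k) (σ : Fin k ≃ Fin l)
    (p : (PhasePROP G).Hom l k') (c : CComonPROP.{u}.Hom k' m) :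
    triple (CMonPROP.comp x (CMonPROP.perm σ)) p c =
      triple x ((PhasePROP G).comp ((PhasePROP G).perm σ) p) c :=
  PermBimod.pair_ract (X := CMonPROP.{u}.bimod)
    (Y := (PhasePROP G).bimod ⊗ CComonPROP.{u}.bimod) x σ (pair p c)

theorem triple_comp_perm_right {n k l k' m : ℕ} (x : CMonPROP.{u}.Hom n k)
    (p : (PhasePROP G).Hom k k') (σ : Fin k' ≃ Fin l) (c : CComonPROP.{u}.Hom l m) :
    triple x ((PhasePROP G).comp p ((PhasePROP G).perm σ)) c =
      triple x p (CComonPROP.comp (CComonPROP.perm σ) c) :=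
  congrArg (fun w => PermBimod.pair (X := CMonPROP.{u}.bimod)
    (Y := (PhasePROP G).bimod ⊗ CComonPROP.{u}.bimod) x w) (pair_comp_perm p σ c)

theorem exists_triple {n m : ℕ}
    (z : (CMonPROP.{u}.bimod ⊗ ((PhasePROP G).bimod ⊗ CComonPROP.{u}.bimod)).Hom n m) :
    ∃ (k k' : ℕ) (x : CMonPROP.{u}.Hom n k) (p : (PhasePROP G).Hom k k')
      (c : CComonPROP.{u}.Hom k' m), z = triple x p c := by
  induction z using PermBimod.CompHom.ind with | _ k x w => ?_
  induction w using PermBimod.CompHom.ind with | _ k' p c => exact ⟨k, k', x, p, c, rfl⟩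

/-- Every composable triple has the form of a function, followed by a vector of group elements,
followed by a function in the opposite direction. -/
theorem exists_triple_diag {n m : ℕ}
    (z : (CMonPROP.{u}.bimod ⊗ ((PhasePROP G).bimod ⊗ CComonPROP.{u}.bimod)).Hom n m) :
    ∃ (k : ℕ) (a : Fin n → Fin k) (g : Fin k → G) (b : Fin m → Fin k),
      z = triple (CMonPROP.ofFun a) (PhasePROP.diag g) (CComonPROP.ofFun b) := by
  obtain ⟨k, k', x, p, c, rfl⟩ := exists_triple z
  obtain ⟨a, rfl⟩ := CMonPROP.exists_eq_ofFun x
  obtain ⟨b, rfl⟩ := CComonPROP.exists_eq_ofFun c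
  obtain ⟨σ, g, rfl⟩ := PhasePROP.exists_eq_perm_comp_diag p
  exact ⟨k', σ ∘ a, g, b, by rw [← triple_comp_perm, CMonPROP.ofFun_comp_perm]⟩

theorem app_canonicalMap_triple {n k k' m : ℕ} (x : CMonPROP.{u}.Hom n k)
    (p : (PhasePROP G).Hom k k') (c : CComonPROP.{u}.Hom k' m) :
    PermBimod.app (canonicalMap G) (triple x p c) =
      (FrobPROP G).comp (PROP.map (inclM G) x)
        ((FrobPROP G).comp (PROP.map (inclP G) p) (PROP.map (inclC G) c)) := rfl

/-- The labelled cospan of a normal form determines the normal form up to a permutation of the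
apex, which is what is identified in the composite over `P`. -/
theorem app_canonicalMap_injective {n m : ℕ}
    (z w : (CMonPROP.{u}.bimod ⊗ ((PhasePROP G).bimod ⊗ CComonPROP.{u}.bimod)).Hom n m)
    (h : PermBimod.app (canonicalMap G) z = PermBimod.app (canonicalMap G) w) : z = w := by
  have img : ∀ {k : ℕ} (a : Fin n → Fin k) (g : Fin k → G) (b : Fin m → Fin k),
      PROP.map (toLCospan G) (PermBimod.app (canonicalMap G)
        (triple (CMonPROP.ofFun a) (PhasePROP.diag g) (CComonPROP.ofFun b))) =
      mk (Fin k) a (labelling g) b := by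
    intro k a g b
    rw [app_canonicalMap_triple, PROP.map_comp, PROP.map_comp]
    refine (congrArg₂ LCospan.comp (map_cospanM_ofFun a) (congrArg₂ LCospan.comp (map_cospanP g)
      (map_cospanC_ofFun b))).trans ?_
    refine (congrArg (LCospan.comp (fwd a)) (mk_comp_bwd _ _ _ _)).trans ?_
    exact fwd_comp_mk _ _ _ _
  obtain ⟨k, a, g, b, rfl⟩ := exists_triple_diag z
  obtain ⟨k', a', g', b', rfl⟩ := exists_triple_diag w
  have h := congrArg (fun t => PROP.map (toLCospan G) t) h
  obtain ⟨e, h₁, h₂, h₃⟩ := mk_eq_mk_iff.1 ((img a g b).symm.trans (h.trans (img a' g' b')))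
  obtain rfl : e ∘ a = a' := funext h₁
  obtain rfl : e ∘ b = b' := funext h₃
  obtain rfl : g = g' ∘ e := labelling_injective
    (Finsupp.mapDomain_injective e.injective (h₂.trans (labelling_comp e g').symm))
  have hd : (PhasePROP G).comp ((PhasePROP G).perm e) (PhasePROP.diag g') =
      (PhasePROP G).comp (PhasePROP.diag (g' ∘ e)) ((PhasePROP G).perm e) := by
    rw [PhasePROP.diag_comp_perm]
    congr 2
    funext i
    simp
  rw [← CMonPROP.ofFun_comp_perm, triple_comp_perm, hd, triple_comp_perm_right,
    CComonPROP.perm_comp_ofFun]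
  congr 2
  funext i
  simp

end FrobPROP

/-! ### Distributive laws are determined by their values on generators -/

namespace CMonPROP

/-- If the last wire of the first block has the same image as an earlier one, then `f` first
multiplies these two wires. -/
theorem exists_eq_tensor_ins_comp {n c m : ℕ} (f : CMonPROP.{u}.Hom (n + 1 + c) m) (j : Fin n)
    (h : toFun f (Fin.castAdd c j.castSucc) = toFun f (Fin.castAdd c (Fin.last n))) :
    ∃ f' : CMonPROP.{u}.Hom (n + c) m,
      f = CMonPROP.comp (CMonPROP.tensor (ins j) (CMonPROP.id c)) f' := by
  refine ⟨ofFun (Fin.append (fun i : Fin n => toFun f (Fin.castAdd c i.castSucc))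
    (fun i : Fin c => toFun f (Fin.natAdd (n + 1) i))), toFun_injective ?_⟩
  rw [toFun_comp, toFun_tensor, toFun_ofFun, toFun_id]
  funext i
  refine Fin.addCases (fun i => ?_) (fun i => ?_) i
  · rw [Function.comp_apply, funSum_castAdd, Fin.append_left]
    refine Fin.lastCases ?_ (fun i => ?_) i
    · rw [toFun_ins_last, h]
    · rw [toFun_ins_castSucc]
  · rw [Function.comp_apply, funSum_natAdd, Fin.append_right]
    rfl

/-- If the last wires have distinct images, different from those of the other wires, then up to a
permutation of the target they are identity wires. -/
theorem exists_eq_tensor_id_comp_perm {d a m : ℕ} (f : CMonPROP.{u}.Hom (d + a) m)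
    (inj : Function.Injective fun i : Fin a => toFun f (Fin.natAdd d i))
    (disj : ∀ (i : Fin d) (j : Fin a), toFun f (Fin.castAdd a i) ≠ toFun f (Fin.natAdd d j)) :
    ∃ (p : ℕ) (f' : CMonPROP.{u}.Hom d p) (σ : Fin (p + a) ≃ Fin m),
      f = CMonPROP.comp (CMonPROP.tensor f' (CMonPROP.id a)) (CMonPROP.perm σ) := by
  obtain ⟨p, σ, hσ⟩ := exists_equiv_natAdd _ inj
  have key : ∀ i : Fin d, ∃ k : Fin p, σ (Fin.castAdd a k) = toFun f (Fin.castAdd a i) := by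
    intro i
    obtain ⟨k, hk⟩ := σ.surjective (toFun f (Fin.castAdd a i))
    revert hk
    refine Fin.addCases (fun k hk => ⟨k, hk⟩) (fun k hk => ?_) k
    exact absurd (hk.symm.trans (hσ k)) (disj i k)
  choose g hg using key
  refine ⟨p, ofFun g, σ, toFun_injective ?_⟩
  rw [toFun_comp, toFun_tensor, toFun_ofFun, toFun_id, toFun_perm]
  funext i
  refine Fin.addCases (fun i => ?_) (fun i => ?_) i
  · rw [Function.comp_apply, funSum_castAdd, hg]
  · rw [Function.comp_apply, funSum_natAdd]
    exact (hσ i).symm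

end CMonPROP

namespace PROP

variable {T S : PROP.{u}} {l : T.bimod ⊗ S.bimod ⟶ S.bimod ⊗ T.bimod}

theorem app_pair_id_left (hl : IsDistributiveLaw T.bimod S.bimod l) {n m : ℕ} (s : S.Hom n m) :
    PermBimod.app l (pair (T.id n) s) = pair s (T.id m) := ((isDistributiveLaw_iff l).1 hl).1 s

theorem app_pair_tensor {a b c a' b' c' d d' : ℕ} {t : T.Hom a b} {s : S.Hom b c}
    {t₂ : T.Hom a' b'} {s₂ : S.Hom b' c'} {s' : S.Hom a d} {t' : T.Hom d c} {s₂' : S.Hom a' d'}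
    {t₂' : T.Hom d' c'} (h : PermBimod.app l (pair t s) = pair s' t')
    (h₂ : PermBimod.app l (pair t₂ s₂) = pair s₂' t₂') :
    PermBimod.app l (pair (T.tensor t t₂) (S.tensor s s₂)) =
      pair (S.tensor s' s₂') (T.tensor t' t₂') := by
  have e := PermBimod.map_tensor l (pair t s) (pair t₂ s₂)
  rw [h, h₂] at e
  exact e

end PROP

open PROP

/-- The comultiplication of the last wire. -/
def CComonPROP.deltaLast (b : ℕ) : CComonPROP.{u}.Hom (b + 1) (b + 2) := CMonPROP.muLast b

theorem CMonPROP.muLast_tensor_id (b : ℕ) :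
    CMonPROP.{u}.tensor (CMonPROP.muLast b) (CMonPROP.id 1) =
      CMonPROP.tensor (CMonPROP.id b) (CMonPROP.tensor CMonPROP.mu (CMonPROP.id 1)) :=
  PROP.tensor_tensor_one CMonPROP.{u} _ _ _

/-- Merging two wires next to an identity wire, reduced by permutations to the case in which the
merged wires are adjacent. -/
theorem CMonPROP.ins_succ_tensor_id {b : ℕ} (j : Fin (b + 1)) :
    CMonPROP.tensor (CMonPROP.ins.{u} j) (CMonPROP.id 1) =
      CMonPROP.comp (n := b + 1 + 2) (m := b + 1 + 2) (CMonPROP.perm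
        (blockSum (Equiv.swap (Fin.last b) j).symm (Equiv.refl (Fin 2))))
      (CMonPROP.comp (m := b + 1 + 1)
        (CMonPROP.tensor (a := b + 2) (b := b + 1) (CMonPROP.muLast b) (CMonPROP.id 1))
        (CMonPROP.tensor (CMonPROP.perm (Equiv.swap (Fin.last b) j)) (CMonPROP.id 1))) := by
  have h : CMonPROP.ins.{u} j = CMonPROP.comp (m := b + 1 + 1) (CMonPROP.perm
      (blockSum (Equiv.swap (Fin.last b) j).symm (Equiv.refl (Fin 1))))
      (CMonPROP.comp (CMonPROP.muLast b) (CMonPROP.perm (Equiv.swap (Fin.last b) j))) := rfl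
  rw [h, PROP.comp_tensor_id, PROP.comp_tensor_id, PROP.perm_tensor_id]
  exact congrArg (fun σ => CMonPROP.comp (CMonPROP.perm σ) _)
    (blockSum_blockSum_one (Equiv.swap (Fin.last b) j).symm 1)

section Lambda

variable {l : CComonPROP.{u}.bimod ⊗ CMonPROP.{u}.bimod ⟶ CMonPROP.{u}.bimod ⊗ CComonPROP.{u}.bimod}
  {E : ∀ {n k m : ℕ}, CComonPROP.{u}.Hom n k → CMonPROP.{u}.Hom k m → Prop}

/-- Moving the comultiplication of the last wire past an arbitrary morphism `f` of `M`, by induction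
on the number of the other wires. Depending on how the function denoted by `f` treats the two new
wires, `f` starts with the product of the two (special equation), or with the product of one of them
with an earlier wire (Frobenius equation), or leaves both alone. -/
theorem PROP.LawStable.deltaLast (hl : IsDistributiveLaw CComonPROP.{u}.bimod CMonPROP.{u}.bimod l)
    (hF : SatisfiesF l) (hE : LawStable l E)
    (frob : E (n := 2) (k := 3) (m := 2) (CComonPROP.tensor (CComonPROP.id 1) CComonPROP.delta)
      (CMonPROP.tensor CMonPROP.mu (CMonPROP.id 1)))
    (special : E (n := 1) (m := 1) CComonPROP.delta CMonPROP.mu) (d : ℕ) {m : ℕ}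
    (f : CMonPROP.{u}.Hom (d + 2) m) : E (CComonPROP.deltaLast d) f := by
  -- The two legs are multiplied with each other.
  have hspecial : ∀ (d : ℕ) {m : ℕ} (f : CMonPROP.{u}.Hom (d + 2) m),
      CMonPROP.toFun f (Fin.natAdd d 0) = CMonPROP.toFun f (Fin.natAdd d 1) →
      E (CComonPROP.deltaLast d) f := by
    intro d m f h
    obtain ⟨f', rfl⟩ := CMonPROP.exists_eq_tensor_ins_comp (n := d + 1) (c := 0) f (Fin.last d) h
    have e : CMonPROP.tensor (CMonPROP.ins.{u} (Fin.last d)) (CMonPROP.id 0) = CMonPROP.muLast d :=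
      (CMonPROP.tensor_id _).trans (CMonPROP.ins_last d)
    rw [e]
    have v : PermBimod.app l (pair (CComonPROP.deltaLast d) (CMonPROP.muLast d)) =
        pair (CMonPROP.id (d + 1)) (CComonPROP.id (d + 1)) :=
      (app_pair_tensor (app_pair_id_left hl (CMonPROP.id d)) hF.special).trans
        (congrArg₂ pair (CMonPROP.id_tensor_id d 1) (CComonPROP.id_tensor_id d 1))
    -- After the loop has vanished, an identity of `C` is left to be moved past `f'`.
    exact hE.mul_right (hE.tensor (hE.id_left (CMonPROP.id d)) special) v (hE.id_left _)
  -- The first leg is multiplied with an earlier wire.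
  have hfirst : ∀ (d : ℕ), (∀ b, d = b + 1 → ∀ {m : ℕ} (f : CMonPROP.{u}.Hom (b + 2) m),
      E (CComonPROP.deltaLast b) f) → ∀ {m : ℕ} (f : CMonPROP.{u}.Hom (d + 2) m) (j : Fin d),
      CMonPROP.toFun f (Fin.castAdd 2 j) = CMonPROP.toFun f (Fin.natAdd d 0) →
      E (CComonPROP.deltaLast d) f := by
    intro d ih m f j h
    obtain _ | b := d
    · exact j.elim0
    obtain ⟨f', rfl⟩ := CMonPROP.exists_eq_tensor_ins_comp (n := b + 1) (c := 1) f j h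
    rw [CMonPROP.ins_succ_tensor_id j, CMonPROP.comp_assoc, CMonPROP.comp_assoc]
    refine (hE.middle (k := b + 3) (CComonPROP.deltaLast (b + 1)) _ _).1 ?_
    have hs : CComonPROP.comp (m := b + 1 + 2) (k := b + 1 + 2) (CComonPROP.deltaLast (b + 1))
          (CComonPROP.perm
          (blockSum (Equiv.swap (Fin.last b) j).symm (Equiv.refl (Fin 2)))) =
        CComonPROP.comp (n := b + 1 + 1) (m := b + 1 + 1) (k := b + 1 + 2) (CComonPROP.perm
          (blockSum (Equiv.swap (Fin.last b) j).symm (Equiv.refl (Fin 1))))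
          (CComonPROP.deltaLast.{u} (b + 1)) :=
      PROP.id_tensor_comp_perm CComonPROP.{u} (Equiv.swap (Fin.last b) j).symm CComonPROP.delta
    rw [hs]
    refine hE.perm_comp (k := b + 2) _ ?_
    have hd : CComonPROP.deltaLast.{u} (b + 1) =
        CComonPROP.tensor (CComonPROP.id b) (CComonPROP.tensor (CComonPROP.id 1) CComonPROP.delta) :=
      CMonPROP.muLast_succ b
    rw [hd, CMonPROP.muLast_tensor_id]
    -- The Frobenius equation leaves a comultiplication with one wire less to its left.
    refine hE.mul_right (b := b + 2) (c := b + 1) (s₁' := CMonPROP.muLast b)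
      (t' := CComonPROP.deltaLast b)
      (hE.tensor (a := b) (b := b) (c := b) (hE.id_left (CMonPROP.id b)) frob) ?_ (ih b rfl _)
    exact app_pair_tensor (app_pair_id_left hl (CMonPROP.id b)) hF.frob_right
  have step : ∀ (d : ℕ), (∀ b, d = b + 1 → ∀ {m : ℕ} (f : CMonPROP.{u}.Hom (b + 2) m),
      E (CComonPROP.deltaLast b) f) → ∀ {m : ℕ} (f : CMonPROP.{u}.Hom (d + 2) m),
      E (CComonPROP.deltaLast d) f := by
    intro d ih m f
    by_cases h₁ : CMonPROP.toFun f (Fin.natAdd d 0) = CMonPROP.toFun f (Fin.natAdd d 1)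
    · exact hspecial d f h₁
    by_cases h₂ : ∃ j : Fin d, CMonPROP.toFun f (Fin.castAdd 2 j) =
        CMonPROP.toFun f (Fin.natAdd d 0)
    · obtain ⟨j, hj⟩ := h₂
      exact hfirst d ih f j hj
    by_cases h₃ : ∃ j : Fin d, CMonPROP.toFun f (Fin.castAdd 2 j) =
        CMonPROP.toFun f (Fin.natAdd d 1)
    · -- Cocommutativity exchanges the two legs.
      obtain ⟨j, hj⟩ := h₃
      have hc : CComonPROP.comp (CComonPROP.deltaLast.{u} d) (CComonPROP.perm (flipLast d)) =
          CComonPROP.deltaLast d := by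
        have h := CMonPROP.flip_comp_muLast.{u} d
        rw [← flipLast_symm] at h
        exact h
      have hf : f = CMonPROP.comp (CMonPROP.perm (flipLast d))
          (CMonPROP.comp (CMonPROP.perm (flipLast d)) f) := by
        have h := (flipLast d).self_trans_symm
        rw [flipLast_symm] at h
        rw [PROP.perm_comp_perm_comp, h, CMonPROP.id_comp]
      rw [hf]
      refine (hE.middle (CComonPROP.deltaLast d) _ _).1 ?_
      rw [hc]
      refine hfirst d ih _ j ?_
      rw [CMonPROP.toFun_comp, CMonPROP.toFun_perm]
      have e₁ : flipLast d (Fin.castAdd 2 j) = Fin.castAdd 2 j := blockSum_castAdd _ _ _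
      have e₂ : flipLast d (Fin.natAdd d 0) = Fin.natAdd d 1 := blockSum_natAdd _ _ _
      rw [Function.comp_apply, Function.comp_apply, e₁, e₂, hj]
    · -- Neither leg is multiplied with anything.
      obtain ⟨p, f', σ, rfl⟩ := CMonPROP.exists_eq_tensor_id_comp_perm f
        (by
          intro i j hij
          fin_cases i <;> fin_cases j
          · rfl
          · exact absurd hij h₁
          · exact absurd hij.symm h₁
          · rfl)
        (by
          intro i j hij
          fin_cases j
          · exact h₂ ⟨i, hij⟩
          · exact h₃ ⟨i, hij⟩)
      exact hE.comp_perm _ (hE.tensor (hE.id_left f') (hE.id_right CComonPROP.delta))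
  induction d generalizing m with
  | zero => exact step 0 (fun b h => absurd h (by omega)) f
  | succ b ih =>
    refine step (b + 1) (fun b' h => ?_) f
    obtain rfl : b = b' := by omega
    exact ih

/-- A property of pairs in `C ; M` that is stable under the axioms of a distributive law is valid
as soon as it is valid for the pairs in the Frobenius and special equations. -/
theorem PROP.LawStable.comonoid_monoid
    (hl : IsDistributiveLaw CComonPROP.{u}.bimod CMonPROP.{u}.bimod l)
    (hF : SatisfiesF l) (hE : LawStable l E)
    (frob : E (n := 2) (k := 3) (m := 2) (CComonPROP.tensor (CComonPROP.id 1) CComonPROP.delta)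
      (CMonPROP.tensor CMonPROP.mu (CMonPROP.id 1)))
    (special : E (n := 1) (m := 1) CComonPROP.delta CMonPROP.mu) {n k m : ℕ}
    (c : CComonPROP.{u}.Hom n k) (f : CMonPROP.{u}.Hom k m) : E c f := by
  revert m
  refine CMonPROP.layer_induction (P := fun {k n} c => ∀ {m : ℕ} (f : CMonPROP.{u}.Hom k m),
    E (n := n) c f) ?_ ?_ ?_ ?_ c
  · intro k n σ m f
    exact hE.perm_left σ.symm f
  · intro b m f
    exact hE.deltaLast hl hF frob special b f
  · intro b m f
    -- A counit meets no generator of `M`.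
    have h := hE.tensor (hE.id_left f) (hE.id_right CComonPROP.epsilon)
    rw [show CMonPROP.tensor f (CMonPROP.id 0) = f from CMonPROP.tensor_id f] at h
    exact h
  · intro k b n c₂ c₁ h₂ h₁ m f
    obtain ⟨c, s', t', e⟩ := exists_pair (PermBimod.app l (pair (T := CComonPROP.{u}) (n := b) c₂ f))
    exact hE.mul_left (t₁ := c₁) (t₂ := c₂) (h₂ f) e (h₁ s')

end Lambda

open PROP

theorem CMonPROP.ins_succ {b : ℕ} (j : Fin (b + 1)) :
    CMonPROP.ins.{u} j = CMonPROP.comp (n := b + 1 + 1) (m := b + 1 + 1) (CMonPROP.perm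
      (blockSum (Equiv.swap (Fin.last b) j).symm (Equiv.refl (Fin 1))))
      (CMonPROP.comp (CMonPROP.muLast b) (CMonPROP.perm (Equiv.swap (Fin.last b) j))) := rfl

namespace PhasePROP

variable {G : Type u} [CommGroup G]

/-- The wire before the phase carries the neutral phase, so that (P1) and (P2) apply. -/
theorem phaseLast_succ (b : ℕ) (g : G) :
    phaseLast (b + 1) g = (PhasePROP G).tensor (a := b) (b := b) (c := 2) (d := 2)
      ((PhasePROP G).id b) ((PhasePROP G).tensor (phase 1) (phase g)) := by
  rw [phase_one, phaseLast, ← PROP.id_tensor_id (PhasePROP G) b 1]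
  exact PROP.tensor_tensor_one _ _ _ _

theorem phaseLast_comp_perm (b : ℕ) (g : G) {b' : ℕ} (τ : Fin b ≃ Fin b') :
    (PhasePROP G).comp (phaseLast b g) ((PhasePROP G).perm (blockSum τ (Equiv.refl (Fin 1)))) =
      (PhasePROP G).comp ((PhasePROP G).perm (blockSum τ (Equiv.refl (Fin 1)))) (phaseLast b' g) :=
  PROP.id_tensor_comp_perm (PhasePROP G) τ (phase g)

end PhasePROP

section Sigma

open PhasePROP

variable {G : Type u} [CommGroup G]
  {s : (PhasePROP G).bimod ⊗ CMonPROP.{u}.bimod ⟶ CMonPROP.{u}.bimod ⊗ (PhasePROP G).bimod}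
  {E : ∀ {n k m : ℕ}, (PhasePROP G).Hom n k → CMonPROP.{u}.Hom k m → Prop}

/-- Moving a phase on the last wire past an arbitrary morphism `f` of `M`, by induction on the number
of the other wires: `f` either starts with the product of the last wire with an earlier one, or
leaves the last wire alone. -/
theorem PROP.LawStable.phaseLast_monoid
    (hs : IsDistributiveLaw (PhasePROP G).bimod CMonPROP.{u}.bimod s)
    (hP : SatisfiesP1 G s) (hE : LawStable s E)
    (mul : ∀ g h : G, E (k := 2) (m := 1) ((PhasePROP G).tensor (phase g) (phase h)) CMonPROP.mu)
    (d : ℕ) (g : G) {m : ℕ} (f : CMonPROP.{u}.Hom (d + 1) m) : E (phaseLast d g) f := by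
  have step : ∀ d : ℕ, (∀ b, d = b + 1 → ∀ {m : ℕ} (f : CMonPROP.{u}.Hom (b + 1) m),
      E (phaseLast b g) f) → ∀ {m : ℕ} (f : CMonPROP.{u}.Hom (d + 1) m), E (phaseLast d g) f := by
    intro d ih m f
    by_cases h : ∃ j : Fin d, CMonPROP.toFun f (Fin.castAdd 1 j) =
        CMonPROP.toFun f (Fin.natAdd d 0)
    · obtain ⟨j, hj⟩ := h
      obtain _ | b := d
      · exact j.elim0
      obtain ⟨f', rfl⟩ := CMonPROP.exists_eq_tensor_ins_comp (n := b + 1) (c := 0) f j hj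
      have e : CMonPROP.tensor (CMonPROP.ins.{u} j) (CMonPROP.id 0) = CMonPROP.ins j :=
        CMonPROP.tensor_id _
      rw [e, CMonPROP.ins_succ j, CMonPROP.comp_assoc, CMonPROP.comp_assoc]
      refine (hE.middle (k := b + 1 + 1) (phaseLast (b + 1) g) _ _).1 ?_
      rw [phaseLast_comp_perm]
      refine hE.perm_comp (k := b + 1 + 1) _ ?_
      rw [phaseLast_succ]
      refine hE.mul_right (b := b + 1) (c := b + 1) (s₁' := CMonPROP.muLast b)
        (t' := phaseLast b g)
        (hE.tensor (a := b) (b := b) (c := b) (hE.id_left (CMonPROP.id b)) (mul 1 g)) ?_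
        (ih b rfl _)
      have h := hP 1 g
      rw [_root_.one_mul] at h
      exact app_pair_tensor (app_pair_id_left hs (CMonPROP.id b)) h
    · obtain ⟨p, f', σ, rfl⟩ := CMonPROP.exists_eq_tensor_id_comp_perm f
        (fun i j _ => Subsingleton.elim i j)
        (fun i j hij => h ⟨i, by rw [hij, Subsingleton.elim j 0]⟩)
      exact hE.comp_perm _ (hE.tensor (hE.id_left f') (hE.id_right (phase g)))
  induction d generalizing m with
  | zero => exact step 0 (fun b h => absurd h (by omega)) f
  | succ b ih =>
    refine step (b + 1) (fun b' h => ?_) f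
    obtain rfl : b = b' := by omega
    exact ih

/-- A property of pairs in `PG ; M` that is stable under the axioms of a distributive law is valid
as soon as it is valid for the pairs in equation (P1). -/
theorem PROP.LawStable.phase_monoid
    (hs : IsDistributiveLaw (PhasePROP G).bimod CMonPROP.{u}.bimod s)
    (hP : SatisfiesP1 G s) (hE : LawStable s E)
    (mul : ∀ g h : G, E (k := 2) (m := 1) ((PhasePROP G).tensor (phase g) (phase h)) CMonPROP.mu)
    {n k m : ℕ} (x : (PhasePROP G).Hom n k) (f : CMonPROP.{u}.Hom k m) : E x f := by
  revert m
  refine PhasePROP.layer_induction (P := fun {n k} x => ∀ {m : ℕ} (f : CMonPROP.{u}.Hom k m),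
    E x f) ?_ ?_ ?_ x
  · intro n k σ m f
    exact hE.perm_left σ f
  · intro b g m f
    exact hE.phaseLast_monoid hs hP mul b g f
  · intro n b k x₁ x₂ h₁ h₂ m f
    obtain ⟨c, s', t', e⟩ := exists_pair (PermBimod.app s (pair x₂ f))
    exact hE.mul_left (h₂ f) e (h₁ s')

end Sigma

section Rho

open PhasePROP

variable {G : Type u} [CommGroup G]
  {r : CComonPROP.{u}.bimod ⊗ (PhasePROP G).bimod ⟶ (PhasePROP G).bimod ⊗ CComonPROP.{u}.bimod}
  {E : ∀ {n k m : ℕ}, CComonPROP.{u}.Hom n k → (PhasePROP G).Hom k m → Prop}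

/-- The mirror image of `phaseLast_monoid`: a morphism of `C` is a morphism of `M` backwards. -/
theorem PROP.LawStable.comonoid_phaseLast
    (hr : IsDistributiveLaw CComonPROP.{u}.bimod (PhasePROP G).bimod r)
    (hP : SatisfiesP2 G r) (hE : LawStable r E)
    (mul : ∀ g h : G,
      E (n := 1) (k := 2) CComonPROP.delta ((PhasePROP G).tensor (phase g) (phase h)))
    (d : ℕ) (g : G) {n : ℕ} (c : CComonPROP.{u}.Hom n (d + 1)) : E c (phaseLast d g) := by
  have step : ∀ d : ℕ, (∀ b, d = b + 1 → ∀ {n : ℕ} (c : CComonPROP.{u}.Hom n (b + 1)),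
      E c (phaseLast b g)) → ∀ {n : ℕ} (c : CComonPROP.{u}.Hom n (d + 1)),
      E c (phaseLast d g) := by
    intro d ih n c
    by_cases h : ∃ j : Fin d, CMonPROP.toFun (n := d + 1) (m := n) c (Fin.castAdd 1 j) =
        CMonPROP.toFun (n := d + 1) (m := n) c (Fin.natAdd d 0)
    · obtain ⟨j, hj⟩ := h
      obtain _ | b := d
      · exact j.elim0
      obtain ⟨f', hc⟩ := CMonPROP.exists_eq_tensor_ins_comp (n := b + 1) (c := 0) (m := n) c j hj
      have e : CMonPROP.tensor (CMonPROP.ins.{u} j) (CMonPROP.id 0) = CMonPROP.ins j :=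
        CMonPROP.tensor_id _
      let τ := Equiv.swap (Fin.last b) j
      have hc' : c = CComonPROP.comp (m := b + 1 + 1) (CComonPROP.comp
            (CComonPROP.comp f' (CComonPROP.perm τ.symm)) (CComonPROP.deltaLast b))
          (CComonPROP.perm (blockSum τ (Equiv.refl (Fin 1)))) := by
        rw [hc, e, CMonPROP.ins_succ j]
        have h := CMonPROP.comp_assoc (b := b + 1 + 1) (CMonPROP.perm
          (blockSum (Equiv.swap (Fin.last b) j).symm (Equiv.refl (Fin 1)))) (CMonPROP.comp
            (CMonPROP.muLast b) (CMonPROP.perm (Equiv.swap (Fin.last b) j))) f'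
        exact h.trans (congrArg (CMonPROP.comp (m := b + 1 + 1) (CMonPROP.perm
          (blockSum τ.symm (Equiv.refl (Fin 1))))) (CMonPROP.comp_assoc _ _ f'))
      rw [hc']
      refine (hE.middle (k := b + 1 + 1) _ _ _).2 ?_
      rw [← phaseLast_comp_perm]
      refine hE.comp_perm (k' := b + 1 + 1) _ ?_
      rw [phaseLast_succ]
      refine hE.mul_left (b := b + 2) (c := b + 1) (s' := phaseLast b g)
        (t₂' := CComonPROP.deltaLast b)
        (hE.tensor (a := b) (b := b) (c := b) (hE.id_left ((PhasePROP G).id b)) (mul 1 g)) ?_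
        (ih b rfl _)
      have h := hP 1 g
      rw [_root_.one_mul] at h
      exact app_pair_tensor (app_pair_id_left hr ((PhasePROP G).id b)) h
    · obtain ⟨p, f', σ, rfl⟩ := CMonPROP.exists_eq_tensor_id_comp_perm (m := n) c
        (fun i j _ => Subsingleton.elim i j)
        (fun i j hij => h ⟨i, by rw [hij, Subsingleton.elim j 0]⟩)
      exact hE.perm_comp (k' := d + 1) σ.symm (t := CComonPROP.tensor (b := d) f' (CComonPROP.id 1))
        (hE.tensor (b := d) (hE.id_right f') (hE.id_left (phase g)))
  induction d generalizing n with
  | zero => exact step 0 (fun b h => absurd h (by omega)) c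
  | succ b ih =>
    refine step (b + 1) (fun b' h => ?_) c
    obtain rfl : b = b' := by omega
    exact ih

/-- A property of pairs in `C ; PG` that is stable under the axioms of a distributive law is valid
as soon as it is valid for the pairs in equation (P2). -/
theorem PROP.LawStable.comonoid_phase
    (hr : IsDistributiveLaw CComonPROP.{u}.bimod (PhasePROP G).bimod r)
    (hP : SatisfiesP2 G r) (hE : LawStable r E)
    (mul : ∀ g h : G,
      E (n := 1) (k := 2) CComonPROP.delta ((PhasePROP G).tensor (phase g) (phase h)))
    {n k m : ℕ} (c : CComonPROP.{u}.Hom n k) (x : (PhasePROP G).Hom k m) : E c x := by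
  revert n
  refine PhasePROP.layer_induction (P := fun {k m} x => ∀ {n : ℕ} (c : CComonPROP.{u}.Hom n k),
    E c x) ?_ ?_ ?_ x
  · intro k m σ n c
    exact hE.perm_right c σ
  · intro b g n c
    exact hE.comonoid_phaseLast hr hP mul b g c
  · intro k b m x₁ x₂ h₁ h₂ n c
    obtain ⟨a, s', t', e⟩ := exists_pair (PermBimod.app r (pair c x₁))
    exact hE.mul_right (h₁ c) e (h₂ t')

end Rho

open PROP

/-! ### Equations in `FG` -/

namespace FrobPROP

variable {G : Type u} [CommGroup G]

theorem frob_left : (FrobPROP G).comp (n := 2) (m := 3) (k := 2)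
    (PROP.map (inclC G) (CComonPROP.tensor CComonPROP.delta (CComonPROP.id 1)))
    (PROP.map (inclM G) (CMonPROP.tensor (CMonPROP.id 1) CMonPROP.mu)) =
      (FrobPROP G).comp (PROP.map (inclM G) CMonPROP.mu) (PROP.map (inclC G) CComonPROP.delta) :=
  PropPresentation.toHom_eq (pres := frobPresentation G) FrobRel.frob_left

theorem frob_right : (FrobPROP G).comp (n := 2) (m := 3) (k := 2)
    (PROP.map (inclC G) (CComonPROP.tensor (CComonPROP.id 1) CComonPROP.delta))
    (PROP.map (inclM G) (CMonPROP.tensor CMonPROP.mu (CMonPROP.id 1))) =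
      (FrobPROP G).comp (PROP.map (inclM G) CMonPROP.mu) (PROP.map (inclC G) CComonPROP.delta) :=
  PropPresentation.toHom_eq (pres := frobPresentation G) FrobRel.frob_right

theorem special : (FrobPROP G).comp (n := 1) (k := 1)
    (PROP.map (inclC G) CComonPROP.delta) (PROP.map (inclM G) CMonPROP.mu) =
      (FrobPROP G).comp (PROP.map (inclM G) (CMonPROP.id 1))
        (PROP.map (inclC G) (CComonPROP.id 1)) :=
  (PropPresentation.toHom_eq (pres := frobPresentation G) FrobRel.special).trans
    ((FrobPROP G).id_comp _).symm

theorem phase_mu (g h : G) : (FrobPROP G).comp (m := 2) (k := 1)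
    (PROP.map (inclP G) ((PhasePROP G).tensor (PhasePROP.phase g) (PhasePROP.phase h)))
    (PROP.map (inclM G) CMonPROP.mu) =
      (FrobPROP G).comp (PROP.map (inclM G) CMonPROP.mu)
        (PROP.map (inclP G) (PhasePROP.phase (g * h))) :=
  PropPresentation.toHom_eq (pres := frobPresentation G) (FrobRel.phase_mu g h)

theorem phase_delta (g h : G) : (FrobPROP G).comp (n := 1) (m := 2)
    (PROP.map (inclC G) CComonPROP.delta)
    (PROP.map (inclP G) ((PhasePROP G).tensor (PhasePROP.phase g) (PhasePROP.phase h))) =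
      (FrobPROP G).comp (PROP.map (inclP G) (PhasePROP.phase (g * h)))
        (PROP.map (inclC G) CComonPROP.delta) :=
  PropPresentation.toHom_eq (pres := frobPresentation G) (FrobRel.phase_delta g h)

end FrobPROP

/-! ### Existence and uniqueness of the laws -/

open FrobPROP

section Laws

variable {G : Type u} [CommGroup G]

/-- The law exists because labelled cospans decompose uniquely, and it satisfies (F) because
cospans do; two laws that satisfy (F) agree by induction. -/
theorem existsUnique_lambda :
    ∃! l : CComonPROP.{u}.bimod ⊗ CMonPROP.{u}.bimod ⟶ CMonPROP.{u}.bimod ⊗ CComonPROP.{u}.bimod,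
      IsDistributiveLaw CComonPROP.{u}.bimod CMonPROP.{u}.bimod l ∧ SatisfiesF l := by
  -- The cospans over the trivial group suffice.
  obtain ⟨l, hl, e⟩ := exists_isDistributiveLaw (cospanC PUnit.{u + 1}) (cospanM PUnit.{u + 1})
    compositeMap_cospan_injective_MC exists_compositeMap_cospan_MC
  have key : ∀ {n k k' m : ℕ} (c : CComonPROP.{u}.Hom n k) (f : CMonPROP.{u}.Hom k m)
      (f' : CMonPROP.{u}.Hom n k') (c' : CComonPROP.{u}.Hom k' m),
      (FrobPROP PUnit.{u + 1}).comp (PROP.map (inclC _) c) (PROP.map (inclM _) f) =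
        (FrobPROP PUnit.{u + 1}).comp (PROP.map (inclM _) f') (PROP.map (inclC _) c') →
      PermBimod.app l (pair c f) = pair f' c' := by
    intro n k k' m c f f' c' h
    refine compositeMap_cospan_injective_MC (G := PUnit.{u + 1}) _ _ ?_
    refine (congrArg (fun F => PermBimod.app F (pair c f)) e).trans ?_
    have h := congrArg (fun t => PROP.map (toLCospan PUnit.{u + 1}) t) h
    simp only [PROP.map_comp] at h
    exact h
  refine ⟨l, ⟨hl, ⟨key _ _ _ _ frob_left, key _ _ _ _ frob_right, key _ _ _ _ special⟩⟩, ?_⟩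
  rintro l' ⟨hl', hF'⟩
  have hF : SatisfiesF l :=
    ⟨key _ _ _ _ frob_left, key _ _ _ _ frob_right, key _ _ _ _ special⟩
  ext n m z
  obtain ⟨k, c, f, rfl⟩ := exists_pair z
  exact (LawStable.of_isDistributiveLaw hl hl').comonoid_monoid hl hF
    (hF'.frob_right.trans hF.frob_right.symm) (hF'.special.trans hF.special.symm) c f

variable (G)

theorem existsUnique_sigma :
    ∃! s : (PhasePROP G).bimod ⊗ CMonPROP.{u}.bimod ⟶ CMonPROP.{u}.bimod ⊗ (PhasePROP G).bimod,
      IsDistributiveLaw (PhasePROP G).bimod CMonPROP.{u}.bimod s ∧ SatisfiesP1 G s := by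
  obtain ⟨s, hs, e⟩ := exists_isDistributiveLaw (cospanP G) (cospanM G)
    compositeMap_cospan_injective_MP exists_compositeMap_cospan_MP
  have hP : SatisfiesP1 G s := by
    intro g h
    refine compositeMap_cospan_injective_MP (G := G) _ _ ?_
    refine (congrArg (fun F => PermBimod.app F (pair ((PhasePROP G).tensor (PhasePROP.phase g)
      (PhasePROP.phase h)) CMonPROP.mu)) e).trans ?_
    have h := congrArg (fun t => PROP.map (toLCospan G) t) (phase_mu g h)
    simp only [PROP.map_comp] at h
    exact h
  refine ⟨s, ⟨hs, hP⟩, ?_⟩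
  rintro s' ⟨hs', hP'⟩
  ext n m z
  obtain ⟨k, x, f, rfl⟩ := exists_pair z
  exact (LawStable.of_isDistributiveLaw hs hs').phase_monoid hs hP
    (fun g h => (hP' g h).trans (hP g h).symm) x f

theorem existsUnique_rho :
    ∃! r : CComonPROP.{u}.bimod ⊗ (PhasePROP G).bimod ⟶
        (PhasePROP G).bimod ⊗ CComonPROP.{u}.bimod,
      IsDistributiveLaw CComonPROP.{u}.bimod (PhasePROP G).bimod r ∧ SatisfiesP2 G r := by
  obtain ⟨r, hr, e⟩ := exists_isDistributiveLaw (cospanC G) (cospanP G)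
    compositeMap_cospan_injective_PC exists_compositeMap_cospan_PC
  have hP : SatisfiesP2 G r := by
    intro g h
    refine compositeMap_cospan_injective_PC (G := G) _ _ ?_
    refine (congrArg (fun F => PermBimod.app F (pair CComonPROP.delta
      ((PhasePROP G).tensor (PhasePROP.phase g) (PhasePROP.phase h)))) e).trans ?_
    have h := congrArg (fun t => PROP.map (toLCospan G) t) (phase_delta g h)
    simp only [PROP.map_comp] at h
    exact h
  refine ⟨r, ⟨hr, hP⟩, ?_⟩
  rintro r' ⟨hr', hP'⟩
  ext n m z
  obtain ⟨k, c, x, rfl⟩ := exists_pair z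
  exact (LawStable.of_isDistributiveLaw hr hr').comonoid_phase hr hP
    (fun g h => (hP' g h).trans (hP g h).symm) c x

end Laws

open PROP FrobPROP

/-! ### The composite monad `M ; PG ; C` -/

section Transport

universe v w

variable {𝒱 : Type w} [Category.{v} 𝒱] [MonoidalCategory 𝒱]

/-- A unit and a multiplication that a monomorphism carries to those of a monoid satisfy the axioms
of a monoid. -/
@[reducible] def monObjOfMono {X M : 𝒱} [MonObj M] (F : X ⟶ M) [Mono F] (e : 𝟙_ 𝒱 ⟶ X)
    (m : X ⊗ X ⟶ X) (he : e ≫ F = η[M]) (hm : m ≫ F = (F ⊗ₘ F) ≫ μ[M]) : MonObj X where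
  one := e
  mul := m
  one_mul := by
    rw [← cancel_mono F, Category.assoc, hm, MonoidalCategory.tensorHom_def, ← Category.assoc,
      ← Category.assoc, ← comp_whiskerRight, he, Category.assoc, ← whisker_exchange_assoc]
    simp
  mul_one := by
    rw [← cancel_mono F, Category.assoc, hm, MonoidalCategory.tensorHom_def', ← Category.assoc,
      ← Category.assoc, ← MonoidalCategory.whiskerLeft_comp, he, Category.assoc,
      whisker_exchange_assoc]
    simp
  mul_assoc := by
    have h₁ : m ▷ X ≫ (F ⊗ₘ F) = ((F ⊗ₘ F) ⊗ₘ F) ≫ μ[M] ▷ M := by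
      rw [← tensorHom_id, ← tensorHom_id, MonoidalCategory.tensorHom_comp_tensorHom,
        MonoidalCategory.tensorHom_comp_tensorHom, hm, Category.id_comp, Category.comp_id]
    have h₂ : X ◁ m ≫ (F ⊗ₘ F) = (F ⊗ₘ (F ⊗ₘ F)) ≫ M ◁ μ[M] := by
      rw [← id_tensorHom, ← id_tensorHom, MonoidalCategory.tensorHom_comp_tensorHom,
        MonoidalCategory.tensorHom_comp_tensorHom, hm, Category.id_comp, Category.comp_id]
    rw [← cancel_mono F, Category.assoc, Category.assoc, Category.assoc, hm, reassoc_of% h₁,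
      reassoc_of% h₂, MonObj.mul_assoc, associator_naturality_assoc]

end Transport

theorem PermBimod.isIso_of_bijective {X Y : PermBimod.{u}} (F : X ⟶ Y)
    (h : ∀ n m : ℕ, Function.Bijective (fun x : X.Hom n m => PermBimod.app F x)) : IsIso F := by
  choose g hg using fun (n m : ℕ) (y : Y.Hom n m) => (h n m).2 y
  have hg : ∀ {n m : ℕ} (y : Y.Hom n m), PermBimod.app F (g n m y) = y := fun y => hg _ _ y
  have inj : ∀ {n m : ℕ} {x x' : X.Hom n m}, PermBimod.app F x = PermBimod.app F x' → x = x' :=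
    fun e => (h _ _).1 e
  let F' : Y ⟶ X :=
    { app := fun {n m} y => g n m y
      app_lact := fun σ y => inj (by rw [PermBimod.map_lact, hg, hg])
      app_ract := fun y σ => inj (by rw [PermBimod.map_ract, hg, hg])
      app_unit := inj (by rw [PermBimod.map_unit, hg])
      app_tensor := fun y y' => inj (by rw [PermBimod.map_tensor, hg, hg, hg]) }
  refine ⟨F', ?_, ?_⟩
  · ext n m x
    exact inj (hg _)
  · ext n m y
    exact hg y

theorem PROP.comp_comp_eq {T : PROP.{u}} {a b b' c d : ℕ} {f : T.Hom a b} {g : T.Hom b c}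
    {f' : T.Hom a b'} {g' : T.Hom b' c} (h : T.comp f g = T.comp f' g') (t : T.Hom c d) :
    T.comp f (T.comp g t) = T.comp f' (T.comp g' t) := by
  rw [← T.comp_assoc, h, T.comp_assoc]

namespace FrobPROP

variable {G : Type u} [CommGroup G]
  {l : CComonPROP.{u}.bimod ⊗ CMonPROP.{u}.bimod ⟶ CMonPROP.{u}.bimod ⊗ CComonPROP.{u}.bimod}
  {s : (PhasePROP G).bimod ⊗ CMonPROP.{u}.bimod ⟶ CMonPROP.{u}.bimod ⊗ (PhasePROP G).bimod}
  {r : CComonPROP.{u}.bimod ⊗ (PhasePROP G).bimod ⟶ (PhasePROP G).bimod ⊗ CComonPROP.{u}.bimod}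

/-- The equations of `FG` contain those imposed by a law that satisfies (F). -/
theorem comp_of_lambda (hl : IsDistributiveLaw CComonPROP.{u}.bimod CMonPROP.{u}.bimod l)
    (hF : SatisfiesF l) {n k k' m : ℕ} {c : CComonPROP.{u}.Hom n k} {f : CMonPROP.{u}.Hom k m}
    {f' : CMonPROP.{u}.Hom n k'} {c' : CComonPROP.{u}.Hom k' m}
    (h : PermBimod.app l (pair c f) = pair f' c') :
    (FrobPROP G).comp (PROP.map (inclC G) c) (PROP.map (inclM G) f) =
      (FrobPROP G).comp (PROP.map (inclM G) f') (PROP.map (inclC G) c') := by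
  have e := (LawStable.of_map hl (inclC G) (inclM G)).comonoid_monoid hl hF
    ((congrArg (fun z => PermBimod.app (compositeMap (inclM G) (inclC G)) z) hF.frob_right).trans
      frob_right.symm)
    ((congrArg (fun z => PermBimod.app (compositeMap (inclM G) (inclC G)) z) hF.special).trans
      special.symm) c f
  rw [h] at e
  exact e.symm

/-- The equations of `FG` contain those imposed by a law that satisfies (P1). -/
theorem comp_of_sigma (hs : IsDistributiveLaw (PhasePROP G).bimod CMonPROP.{u}.bimod s)
    (hP : SatisfiesP1 G s) {n k k' m : ℕ} {x : (PhasePROP G).Hom n k} {f : CMonPROP.{u}.Hom k m}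
    {f' : CMonPROP.{u}.Hom n k'} {x' : (PhasePROP G).Hom k' m}
    (h : PermBimod.app s (pair x f) = pair f' x') :
    (FrobPROP G).comp (PROP.map (inclP G) x) (PROP.map (inclM G) f) =
      (FrobPROP G).comp (PROP.map (inclM G) f') (PROP.map (inclP G) x') := by
  have e := (LawStable.of_map hs (inclP G) (inclM G)).phase_monoid hs hP
    (fun g h => (congrArg (fun z => PermBimod.app (compositeMap (inclM G) (inclP G)) z)
      (hP g h)).trans (phase_mu g h).symm) x f
  rw [h] at e
  exact e.symm

/-- The equations of `FG` contain those imposed by a law that satisfies (P2). -/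
theorem comp_of_rho (hr : IsDistributiveLaw CComonPROP.{u}.bimod (PhasePROP G).bimod r)
    (hP : SatisfiesP2 G r) {n k k' m : ℕ} {c : CComonPROP.{u}.Hom n k} {x : (PhasePROP G).Hom k m}
    {x' : (PhasePROP G).Hom n k'} {c' : CComonPROP.{u}.Hom k' m}
    (h : PermBimod.app r (pair c x) = pair x' c') :
    (FrobPROP G).comp (PROP.map (inclC G) c) (PROP.map (inclP G) x) =
      (FrobPROP G).comp (PROP.map (inclP G) x') (PROP.map (inclC G) c') := by
  have e := (LawStable.of_map hr (inclC G) (inclP G)).comonoid_phase hr hP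
    (fun g h => (congrArg (fun z => PermBimod.app (compositeMap (inclP G) (inclC G)) z)
      (hP g h)).trans (phase_delta g h).symm) c x
  rw [h] at e
  exact e.symm

/-- Both sides of the Yang-Baxter equation compose to the same morphism of `FG`. -/
theorem yangBaxter (hl : IsDistributiveLaw CComonPROP.{u}.bimod CMonPROP.{u}.bimod l)
    (hF : SatisfiesF l) (hs : IsDistributiveLaw (PhasePROP G).bimod CMonPROP.{u}.bimod s)
    (hP₁ : SatisfiesP1 G s) (hr : IsDistributiveLaw CComonPROP.{u}.bimod (PhasePROP G).bimod r)
    (hP₂ : SatisfiesP2 G r) :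
    YangBaxter CMonPROP.{u}.bimod (PhasePROP G).bimod CComonPROP.{u}.bimod s l r := by
  ext n m z
  induction z using PermBimod.CompHom.ind with | _ k w f => ?_
  induction w using PermBimod.CompHom.ind with | _ k' c x => ?_
  obtain ⟨_, x₁, c₁, e₁⟩ := exists_pair (PermBimod.app r (pair c x))
  obtain ⟨_, f₁, c₂, e₂⟩ := exists_pair (PermBimod.app l (pair c₁ f))
  obtain ⟨_, f₂, x₂, e₃⟩ := exists_pair (PermBimod.app s (pair x₁ f₁))
  obtain ⟨_, f₁', x₁', e₁'⟩ := exists_pair (PermBimod.app s (pair x f))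
  obtain ⟨_, f₂', c₁', e₂'⟩ := exists_pair (PermBimod.app l (pair c f₁'))
  obtain ⟨_, x₂', c₂', e₃'⟩ := exists_pair (PermBimod.app r (pair c₁' x₁'))
  have lhs : PermBimod.app (r ▷ CMonPROP.{u}.bimod ≫ (α_ _ _ _).hom ≫ (PhasePROP G).bimod ◁ l ≫
      (α_ _ _ _).inv ≫ s ▷ CComonPROP.{u}.bimod ≫ (α_ _ _ _).hom)
      (PermBimod.pair (X := CComonPROP.{u}.bimod ⊗ (PhasePROP G).bimod) (Y := CMonPROP.{u}.bimod)
        (pair c x) f) = triple f₂ x₂ c₂ := by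
    change PermBimod.app ((α_ _ _ _).hom ≫ (PhasePROP G).bimod ◁ l ≫
      (α_ _ _ _).inv ≫ s ▷ CComonPROP.{u}.bimod ≫ (α_ _ _ _).hom)
      (PermBimod.pair (X := (PhasePROP G).bimod ⊗ CComonPROP.{u}.bimod) (Y := CMonPROP.{u}.bimod)
        (PermBimod.app r (pair c x)) f) = _
    rw [e₁]
    change PermBimod.app ((α_ _ _ _).inv ≫ s ▷ CComonPROP.{u}.bimod ≫ (α_ _ _ _).hom)
      (PermBimod.pair (X := (PhasePROP G).bimod) (Y := CMonPROP.{u}.bimod ⊗ CComonPROP.{u}.bimod)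
        x₁ (PermBimod.app l (pair c₁ f))) = _
    rw [e₂]
    change PermBimod.app (α_ _ _ _).hom
      (PermBimod.pair (X := CMonPROP.{u}.bimod ⊗ (PhasePROP G).bimod) (Y := CComonPROP.{u}.bimod)
        (PermBimod.app s (pair x₁ f₁)) c₂) = _
    rw [e₃]
    rfl
  have rhs : PermBimod.app ((α_ _ _ _).hom ≫ CComonPROP.{u}.bimod ◁ s ≫ (α_ _ _ _).inv ≫
      l ▷ (PhasePROP G).bimod ≫ (α_ _ _ _).hom ≫ CMonPROP.{u}.bimod ◁ r)
      (PermBimod.pair (X := CComonPROP.{u}.bimod ⊗ (PhasePROP G).bimod) (Y := CMonPROP.{u}.bimod)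
        (pair c x) f) = triple f₂' x₂' c₂' := by
    change PermBimod.app ((α_ _ _ _).inv ≫
      l ▷ (PhasePROP G).bimod ≫ (α_ _ _ _).hom ≫ CMonPROP.{u}.bimod ◁ r)
      (PermBimod.pair (X := CComonPROP.{u}.bimod) (Y := CMonPROP.{u}.bimod ⊗ (PhasePROP G).bimod)
        c (PermBimod.app s (pair x f))) = _
    rw [e₁']
    change PermBimod.app ((α_ _ _ _).hom ≫ CMonPROP.{u}.bimod ◁ r)
      (PermBimod.pair (X := CMonPROP.{u}.bimod ⊗ CComonPROP.{u}.bimod) (Y := (PhasePROP G).bimod)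
        (PermBimod.app l (pair c f₁')) x₁') = _
    rw [e₂']
    change PermBimod.pair (X := CMonPROP.{u}.bimod)
      (Y := (PhasePROP G).bimod ⊗ CComonPROP.{u}.bimod) f₂' (PermBimod.app r (pair c₁' x₁')) = _
    rw [e₃']
    rfl
  refine lhs.trans (Eq.trans (app_canonicalMap_injective _ _ ?_) rhs.symm)
  rw [app_canonicalMap_triple, app_canonicalMap_triple]
  have p₁ := comp_of_rho hr hP₂ e₁
  have p₂ := comp_of_lambda (G := G) hl hF e₂
  have p₃ := comp_of_sigma hs hP₁ e₃
  have p₁' := comp_of_sigma hs hP₁ e₁'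
  have p₂' := comp_of_lambda (G := G) hl hF e₂'
  have p₃' := comp_of_rho hr hP₂ e₃'
  rw [← (FrobPROP G).comp_assoc, ← p₃, (FrobPROP G).comp_assoc, ← p₂, ← (FrobPROP G).comp_assoc,
    ← p₁, (FrobPROP G).comp_assoc, p₁', ← (FrobPROP G).comp_assoc, p₂', (FrobPROP G).comp_assoc, p₃']

/-- The multiplication on representatives: `c₀` is moved past `f₁`, then `x₀` past the result, and
finally what became of `c₀` past `x₁`. -/
theorem app_seriesMul {a b c d e f i j k n : ℕ} {f₀ : CMonPROP.{u}.Hom a b}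
    {x₀ : (PhasePROP G).Hom b c} {c₀ : CComonPROP.{u}.Hom c d} {f₁ : CMonPROP.{u}.Hom d e}
    {x₁ : (PhasePROP G).Hom e f} {c₁ : CComonPROP.{u}.Hom f i}
    {f' : CMonPROP.{u}.Hom c j} {c' : CComonPROP.{u}.Hom j e}
    {f'' : CMonPROP.{u}.Hom b k} {x' : (PhasePROP G).Hom k j}
    {x'' : (PhasePROP G).Hom j n} {c'' : CComonPROP.{u}.Hom n f}
    (h₁ : PermBimod.app l (pair c₀ f₁) = pair f' c')
    (h₂ : PermBimod.app s (pair x₀ f') = pair f'' x')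
    (h₃ : PermBimod.app r (pair c' x₁) = pair x'' c'') :
    PermBimod.app (seriesMul s l r) (PermBimod.pair
      (X := CMonPROP.{u}.bimod ⊗ ((PhasePROP G).bimod ⊗ CComonPROP.{u}.bimod))
      (Y := CMonPROP.{u}.bimod ⊗ ((PhasePROP G).bimod ⊗ CComonPROP.{u}.bimod))
      (triple f₀ x₀ c₀) (triple f₁ x₁ c₁)) =
    triple (CMonPROP.comp f₀ f'') ((PhasePROP G).comp x' x'') (CComonPROP.comp c'' c₁) := by
  have hlaw : PermBimod.app (iteratedLaw s l) (PermBimod.pair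
      (X := (PhasePROP G).bimod ⊗ CComonPROP.{u}.bimod) (Y := CMonPROP.{u}.bimod)
      (pair x₀ c₀) f₁) = triple f'' x' c' := by
    change PermBimod.app ((α_ _ _ _).inv ≫ s ▷ CComonPROP.{u}.bimod ≫ (α_ _ _ _).hom)
      (PermBimod.pair (X := (PhasePROP G).bimod) (Y := CMonPROP.{u}.bimod ⊗ CComonPROP.{u}.bimod)
        x₀ (PermBimod.app l (pair c₀ f₁))) = _
    rw [h₁]
    change PermBimod.app (α_ _ _ _).hom
      (PermBimod.pair (X := CMonPROP.{u}.bimod ⊗ (PhasePROP G).bimod) (Y := CComonPROP.{u}.bimod)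
        (PermBimod.app s (pair x₀ f')) c') = _
    rw [h₂]
    rfl
  have hmul : PermBimod.app (compositeMul μ[(PhasePROP G).bimod] μ[CComonPROP.{u}.bimod] r)
      (PermBimod.pair (X := (PhasePROP G).bimod ⊗ CComonPROP.{u}.bimod)
        (Y := (PhasePROP G).bimod ⊗ CComonPROP.{u}.bimod) (pair x' c') (pair x₁ c₁)) =
      pair ((PhasePROP G).comp x' x'') (CComonPROP.comp c'' c₁) := by
    change PermBimod.app ((PhasePROP G).bimod ◁ (α_ _ _ _).hom ≫ (α_ _ _ _).inv ≫
        (μ[(PhasePROP G).bimod] ⊗ₘ μ[CComonPROP.{u}.bimod]))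
      (PermBimod.pair (X := (PhasePROP G).bimod)
        (Y := ((PhasePROP G).bimod ⊗ CComonPROP.{u}.bimod) ⊗ CComonPROP.{u}.bimod) x'
        (PermBimod.pair (X := (PhasePROP G).bimod ⊗ CComonPROP.{u}.bimod)
          (Y := CComonPROP.{u}.bimod) (PermBimod.app r (pair c' x₁)) c₁)) = _
    rw [h₃]
    rfl
  change PermBimod.app (CMonPROP.{u}.bimod ◁ (α_ _ _ _).hom ≫ (α_ _ _ _).inv ≫
      (μ[CMonPROP.{u}.bimod] ⊗ₘ compositeMul μ[(PhasePROP G).bimod] μ[CComonPROP.{u}.bimod] r))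
    (PermBimod.pair (X := CMonPROP.{u}.bimod)
      (Y := (CMonPROP.{u}.bimod ⊗ ((PhasePROP G).bimod ⊗ CComonPROP.{u}.bimod)) ⊗
        ((PhasePROP G).bimod ⊗ CComonPROP.{u}.bimod)) f₀
      (PermBimod.pair (X := CMonPROP.{u}.bimod ⊗ ((PhasePROP G).bimod ⊗ CComonPROP.{u}.bimod))
        (Y := (PhasePROP G).bimod ⊗ CComonPROP.{u}.bimod)
        (PermBimod.app (iteratedLaw s l) (PermBimod.pair
          (X := (PhasePROP G).bimod ⊗ CComonPROP.{u}.bimod) (Y := CMonPROP.{u}.bimod)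
          (pair x₀ c₀) f₁)) (pair x₁ c₁))) = _
  rw [hlaw]
  change PermBimod.pair (X := CMonPROP.{u}.bimod)
      (Y := (PhasePROP G).bimod ⊗ CComonPROP.{u}.bimod) (CMonPROP.comp f₀ f'')
      (PermBimod.app (compositeMul μ[(PhasePROP G).bimod] μ[CComonPROP.{u}.bimod] r)
      (PermBimod.pair (X := (PhasePROP G).bimod ⊗ CComonPROP.{u}.bimod)
        (Y := (PhasePROP G).bimod ⊗ CComonPROP.{u}.bimod) (pair x' c') (pair x₁ c₁))) = _
  rw [hmul]
  rfl

/-- The canonical map is multiplicative because each of the three laws holds in `FG`. -/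
theorem seriesMul_comp_canonicalMap
    (hl : IsDistributiveLaw CComonPROP.{u}.bimod CMonPROP.{u}.bimod l)
    (hF : SatisfiesF l) (hs : IsDistributiveLaw (PhasePROP G).bimod CMonPROP.{u}.bimod s)
    (hP₁ : SatisfiesP1 G s) (hr : IsDistributiveLaw CComonPROP.{u}.bimod (PhasePROP G).bimod r)
    (hP₂ : SatisfiesP2 G r) :
    seriesMul s l r ≫ canonicalMap G =
      (canonicalMap G ⊗ₘ canonicalMap G) ≫ μ[(FrobPROP G).bimod] := by
  ext n m z
  induction z using PermBimod.CompHom.ind with | _ k z w => ?_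
  obtain ⟨_, _, f₀, x₀, c₀, rfl⟩ := exists_triple z
  obtain ⟨_, _, f₁, x₁, c₁, rfl⟩ := exists_triple w
  obtain ⟨_, f', c', h₁⟩ := exists_pair (PermBimod.app l (pair c₀ f₁))
  obtain ⟨_, f'', x', h₂⟩ := exists_pair (PermBimod.app s (pair x₀ f'))
  obtain ⟨_, x'', c'', h₃⟩ := exists_pair (PermBimod.app r (pair c' x₁))
  refine (congrArg (fun z => PermBimod.app (canonicalMap G) z) (app_seriesMul h₁ h₂ h₃)).trans ?_
  rw [app_canonicalMap_triple, PROP.map_comp, PROP.map_comp, PROP.map_comp]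
  have p₁ := comp_of_lambda (G := G) hl hF h₁
  have p₂ := comp_of_sigma hs hP₁ h₂
  have p₃ := comp_of_rho hr hP₂ h₃
  change _ = (FrobPROP G).comp
    ((FrobPROP G).comp (PROP.map (inclM G) f₀)
        ((FrobPROP G).comp (PROP.map (inclP G) x₀) (PROP.map (inclC G) c₀)))
    ((FrobPROP G).comp (PROP.map (inclM G) f₁)
        ((FrobPROP G).comp (PROP.map (inclP G) x₁) (PROP.map (inclC G) c₁)))
  have q₁ := fun {o : ℕ} => PROP.comp_comp_eq (d := o) p₁
  have q₂ := fun {o : ℕ} => PROP.comp_comp_eq (d := o) p₂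
  have q₃ := fun {o : ℕ} => PROP.comp_comp_eq (d := o) p₃
  simp only [PROP.comp_assoc, q₁, q₂, q₃]

theorem seriesUnit_comp_canonicalMap :
    seriesUnit CMonPROP.{u}.bimod (PhasePROP G).bimod CComonPROP.{u}.bimod ≫ canonicalMap G =
      η[(FrobPROP G).bimod] := by
  ext n m σ
  change (FrobPROP G).comp (PROP.map (inclM G) (CMonPROP.perm (Equiv.refl _)))
    ((FrobPROP G).comp (PROP.map (inclP G) ((PhasePROP G).perm (Equiv.refl _)))
      (PROP.map (inclC G) (CComonPROP.perm σ.down))) = (FrobPROP G).perm σ.down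
  rw [PROP.map_perm, PROP.map_perm, PROP.map_perm, (FrobPROP G).id_comp, (FrobPROP G).id_comp]

/-- The image of the canonical map contains the generators, and it is closed under composition
because the laws hold in `FG`. -/
theorem app_canonicalMap_surjective {n m : ℕ} (y : (FrobPROP G).Hom n m) :
    ∃ z, PermBimod.app (canonicalMap G) z = y := by
  obtain ⟨l, ⟨hl, hF⟩, -⟩ := existsUnique_lambda.{u}
  obtain ⟨s, ⟨hs, hP₁⟩, -⟩ := existsUnique_sigma G
  obtain ⟨r, ⟨hr, hP₂⟩, -⟩ := existsUnique_rho G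
  have hmul := seriesMul_comp_canonicalMap hl hF hs hP₁ hr hP₂
  induction y using Quotient.ind with | _ t => ?_
  induction t with
  | @gen n m x =>
    have ofM : ∀ {n m : ℕ} (f : CMonPROP.{u}.Hom n m),
        ∃ z, PermBimod.app (canonicalMap G) z = PROP.map (inclM G) f := fun f =>
      ⟨triple f ((PhasePROP G).id _) (CComonPROP.id _), by
        rw [app_canonicalMap_triple, PROP.map_id, PROP.map_id, PROP.comp_id', PROP.comp_id']⟩
    have ofP : ∀ {n m : ℕ} (x : (PhasePROP G).Hom n m),
        ∃ z, PermBimod.app (canonicalMap G) z = PROP.map (inclP G) x := fun x =>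
      ⟨triple (CMonPROP.id _) x (CComonPROP.id _), by
        rw [app_canonicalMap_triple, PROP.map_id, PROP.map_id, PROP.comp_id', PROP.id_comp']⟩
    have ofC : ∀ {n m : ℕ} (c : CComonPROP.{u}.Hom n m),
        ∃ z, PermBimod.app (canonicalMap G) z = PROP.map (inclC G) c := fun c =>
      ⟨triple (CMonPROP.id _) ((PhasePROP G).id _) c, by
        rw [app_canonicalMap_triple, PROP.map_id, PROP.map_id, PROP.id_comp', PROP.id_comp']⟩
    cases x with
    | mu => exact ofM CMonPROP.mu
    | eta => exact ofM CMonPROP.eta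
    | phase g => exact ofP (PhasePROP.phase g)
    | delta => exact ofC CComonPROP.delta
    | epsilon => exact ofC CComonPROP.epsilon
  | perm σ =>
    have h := congrArg (fun F => PermBimod.app F (⟨σ⟩ : PermBimod.permBimod.Hom _ _))
      (seriesUnit_comp_canonicalMap (G := G))
    exact ⟨PermBimod.app (seriesUnit _ _ _) (⟨σ⟩ : PermBimod.permBimod.Hom _ _), h⟩
  | comp t t' ih ih' =>
    obtain ⟨z, hz⟩ := ih
    obtain ⟨z', hz'⟩ := ih'
    have h := congrArg (fun F => PermBimod.app F (PermBimod.pair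
      (X := CMonPROP.{u}.bimod ⊗ ((PhasePROP G).bimod ⊗ CComonPROP.{u}.bimod))
      (Y := CMonPROP.{u}.bimod ⊗ ((PhasePROP G).bimod ⊗ CComonPROP.{u}.bimod)) z z')) hmul
    exact ⟨_, h.trans (congrArg₂ (FrobPROP G).comp hz hz')⟩
  | tensor t t' ih ih' =>
    obtain ⟨z, hz⟩ := ih
    obtain ⟨z', hz'⟩ := ih'
    exact ⟨_, (PermBimod.map_tensor (canonicalMap G) z z').trans
      (congrArg₂ (FrobPROP G).tensor hz hz')⟩

instance isIso_canonicalMap : IsIso (canonicalMap G) :=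
  PermBimod.isIso_of_bijective _ fun _ _ =>
    ⟨fun z w h => app_canonicalMap_injective z w h, app_canonicalMap_surjective⟩

theorem canonicalMap_naturality {H : Type u} [CommGroup H] (φ : G →* H) :
    CMonPROP.{u}.bimod ◁ (PROP.bimodMap (PhasePROP.map φ) ▷ CComonPROP.{u}.bimod) ≫
        canonicalMap H = canonicalMap G ≫ PROP.bimodMap (FrobPROP.map φ) := by
  have hM : inclM G ≫ FrobPROP.map φ = inclM H := by
    refine PropPresentation.hom_ext (pres := cmonPresentation) fun n m x => ?_
    cases x <;> rfl
  have hP : inclP G ≫ FrobPROP.map φ = PhasePROP.map φ ≫ inclP H := by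
    refine PropPresentation.hom_ext (pres := phasePresentation G) fun n m x => ?_
    cases x; rfl
  have hC : ∀ {n m : ℕ} (c : CComonPROP.{u}.Hom n m),
      PROP.map (FrobPROP.map φ) (PROP.map (inclC G) c) = PROP.map (inclC H) c := by
    let op (F : CComonPROP.{u} ⟶ FrobPROP H) : CMonPROP.{u} ⟶ (FrobPROP H).op := PROP.opMap F
    have h : op (inclC G ≫ FrobPROP.map φ) = op (inclC H) := by
      refine PropPresentation.hom_ext (pres := cmonPresentation) fun n m x => ?_
      cases x <;> rfl
    intro n m c
    exact congrArg (fun F : CMonPROP.{u} ⟶ (FrobPROP H).op => PROP.map F (n := m) (m := n) c) h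
  ext n m z
  obtain ⟨_, _, f, x, c, rfl⟩ := exists_triple z
  change (FrobPROP H).comp (PROP.map (inclM H) f) ((FrobPROP H).comp
      (PROP.map (PhasePROP.map φ ≫ inclP H) x) (PROP.map (inclC H) c)) =
    PROP.map (FrobPROP.map φ) ((FrobPROP G).comp (PROP.map (inclM G) f)
        ((FrobPROP G).comp (PROP.map (inclP G) x) (PROP.map (inclC G) c)))
  rw [PROP.map_comp, PROP.map_comp, hC, ← hM, ← hP]
  rfl

end FrobPROP

theorem mainTheorem2 :
    (∃! l : CComonPROP.{u}.bimod ⊗ CMonPROP.{u}.bimod ⟶ CMonPROP.{u}.bimod ⊗ CComonPROP.{u}.bimod,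
      IsDistributiveLaw CComonPROP.{u}.bimod CMonPROP.{u}.bimod l ∧ SatisfiesF l) ∧
    (∀ G : CommGrpCat.{u},
      (∃! s : (PhasePROP G).bimod ⊗ CMonPROP.{u}.bimod ⟶
          CMonPROP.{u}.bimod ⊗ (PhasePROP G).bimod,
        IsDistributiveLaw (PhasePROP G).bimod CMonPROP.{u}.bimod s ∧ SatisfiesP1 G s) ∧
      (∃! r : CComonPROP.{u}.bimod ⊗ (PhasePROP G).bimod ⟶
          (PhasePROP G).bimod ⊗ CComonPROP.{u}.bimod,
        IsDistributiveLaw CComonPROP.{u}.bimod (PhasePROP G).bimod r ∧ SatisfiesP2 G r)) ∧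
    (∀ (G : CommGrpCat.{u})
      (l : CComonPROP.{u}.bimod ⊗ CMonPROP.{u}.bimod ⟶ CMonPROP.{u}.bimod ⊗ CComonPROP.{u}.bimod)
      (s : (PhasePROP G).bimod ⊗ CMonPROP.{u}.bimod ⟶ CMonPROP.{u}.bimod ⊗ (PhasePROP G).bimod)
      (r : CComonPROP.{u}.bimod ⊗ (PhasePROP G).bimod ⟶
        (PhasePROP G).bimod ⊗ CComonPROP.{u}.bimod),
      IsDistributiveLaw CComonPROP.{u}.bimod CMonPROP.{u}.bimod l → SatisfiesF l →
      IsDistributiveLaw (PhasePROP G).bimod CMonPROP.{u}.bimod s → SatisfiesP1 G s →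
      IsDistributiveLaw CComonPROP.{u}.bimod (PhasePROP G).bimod r → SatisfiesP2 G r →
      IsDistributiveSeries CMonPROP.{u}.bimod (PhasePROP G).bimod CComonPROP.{u}.bimod s l r ∧
      ∃ mon : MonObj (CMonPROP.{u}.bimod ⊗ ((PhasePROP G).bimod ⊗ CComonPROP.{u}.bimod)),
        mon.one = seriesUnit CMonPROP.{u}.bimod (PhasePROP G).bimod CComonPROP.{u}.bimod ∧
        mon.mul = seriesMul s l r ∧
        IsMonHom (canonicalMap G) ∧ IsIso (canonicalMap G)) ∧
    (∀ (G H : CommGrpCat.{u}) (φ : G ⟶ H),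
      CMonPROP.{u}.bimod ◁ (PROP.bimodMap (PhasePROP.map φ.hom) ▷ CComonPROP.{u}.bimod) ≫
          canonicalMap H =
        canonicalMap G ≫ PROP.bimodMap (DagPROP.homOf (frobFunctor.map φ))) ∧
    (∀ (G : CommGrpCat.{u}) (n n' : ℕ) (f : (frobFunctor.obj G).Hom n n'),
      ∃ (m : ℕ) (nabla : CMonPROP.{u}.Hom n m) (g : Fin m → G) (Delta : CComonPROP.{u}.Hom m n'),
        f = (FrobPROP G).comp (PROP.map (FrobPROP.inclM G) nabla)
          ((FrobPROP G).comp (PROP.map (FrobPROP.inclP G) (PhasePROP.diag g))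
            (PROP.map (FrobPROP.inclC G) Delta))) := by
  refine ⟨existsUnique_lambda, fun G => ⟨existsUnique_sigma G, existsUnique_rho G⟩, ?_,
    fun G H φ => canonicalMap_naturality φ.hom, ?_⟩
  · intro G l s r hl hF hs hP₁ hr hP₂
    have hη := seriesUnit_comp_canonicalMap (G := G)
    have hμ := seriesMul_comp_canonicalMap hl hF hs hP₁ hr hP₂
    refine ⟨⟨hs, hl, hr, yangBaxter hl hF hs hP₁ hr hP₂⟩,
      monObjOfMono (canonicalMap G) _ _ hη hμ, rfl, rfl, ?_, inferInstance⟩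
    exact @IsMonHom.mk _ _ _ _ _ (monObjOfMono (canonicalMap G) _ _ hη hμ) _ _ hη hμ
  · intro G n n' f
    obtain ⟨z, rfl⟩ := app_canonicalMap_surjective (G := G) f
    obtain ⟨m, a, g, b, rfl⟩ := exists_triple_diag z
    exact ⟨m, CMonPROP.ofFun a, g, CComonPROP.ofFun b, app_canonicalMap_triple _ _ _⟩
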